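/- Setting. Let $\mathcal T$ be a complex of hypercubes: a collection of axis-parallel (possibly degenerate) boxes in some $\mathbb R^N$, called cells, containing every face of each of its members; a cell $T$ of dimension $m$ is a copy of $I^m$, $I=[0,1]$. For $T\in\mathcal T$ let $\mathfrak E^k(T)$ be the space of $k$-forms on $T$ whose pullback to each face of $T$ (including $T$) is in $\mathrm L^2$ and has its (weak) exterior derivative in $\mathrm L^2$. A finite element system (FES) on $\mathcal T$ is a family of finite-dimensional subspaces $A^k(T)\subseteq\mathfrak E^k(T)$ ($T\in\mathcal T$, $k\ge 0$) such that $\mathrm d$ maps $A^k(T)$ into $A^{k+1}(T)$ and pullback to a face $T'$ of $T$ maps $A^k(T)$ into $A^k(T')$. Let $A^k(\partial T)$ be the space of families $(u_F)_F$, $u_F\in A^k(F)$, indexed by the proper faces $F$ of $T$ and compatible with pullback to faces, and let $A^k_0(T)$ be the space of those $u\in A^k(T)$ whose pullback to $\partial T$ is zero. The FES $A$ is compatible if for all $T$ the restriction $A^k(T)\to A^k(\partial T)$ is onto for each $k$, and the sequence $0\to\mathbb R\to A^0(T)\to A^1(T)\to\cdots\to A^{\dim T}(T)\to 0$ is exact.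 Let $\mathcal P_s\Lambda^k(T)$ be the space of $k$-forms on $T$ whose coefficients are polynomials of total degree at most $s$ (zero if $s<0$ or $k>\dim T$), and $\mathcal P_s\Lambda^k_0(T)$ the subspace of those with zero pullback to $\partial T$. Statement. Let $r\ge n\ge 0$, let all cells of $\mathcal T$ have dimension at most $n$, and let $A$ be a compatible FES on $\mathcal T$ with $\mathcal P_{r-k}\Lambda^k(T)\subseteq A^k(T)$ for all $T\in\mathcal T$ and all $k$. Call $A$ minimal if $\dim A^k(T)\le\dim B^k(T)$ for all $T$ and $k$, for every compatible FES $B$ on $\mathcal T$ with $\mathcal P_{r-k}\Lambda^k(T)\subseteq B^k(T)$ for all $T$ and $k$. Then $A$ is minimal if and only if $$A^k_0(T)=\mathcal P_{r-k}\Lambda^k_0(T)\qquad\text{for all } T\in\mathcal T \text{ and all } k.$$ In this case the spaces $\mathcal P_{r+k-2m}\Lambda^{m-k}(F)$, $m=\dim F$, provide unisolvent degrees of freedom on $A$: for each $T\in\mathcal T$ and each $k$, the linear map $$A^k(T)\to\prod_{F}\bigl(\mathcal P_{r+k-2\dim F}\Lambda^{\dim F-k}(F)\bigr)^{*},\qquad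 u\mapsto\Bigl(v\mapsto\int_F u|_F\wedge v\Bigr)_F,$$ where $F$ runs through the faces of $T$ (including $T$) of dimension at least $k$, is bijective. -/

import Mathlib

open MeasureTheory Finset
open scoped ContDiff

noncomputable section

namespace CubeFES

/-- An axis-parallel (possibly degenerate) box in `ℝ^N`. A direction `i` with `lo i < hi i` is a
free direction. A box with `m` free directions is a copy of the hypercube `I^m`, and a box without
free directions is a point. -/
@[ext]
structure Cell (N : ℕ) where
  lo : Fin N → ℝ
  hi : Fin N → ℝ
  lo_le_hi : lo ≤ hi

variable {N : ℕ}

/-- The set of free directions of a cell. -/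
def Cell.dirs (T : Cell N) : Finset (Fin N) := by
  classical
  exact univ.filter fun i => T.lo i < T.hi i

/-- The dimension of a cell. -/
def Cell.dim (T : Cell N) : ℕ := #T.dirs

/-- The `dim T`-dimensional Lebesgue measure on the box `T`, as a measure on `ℝ^N`:
one-dimensional Lebesgue measure on `[lo i, hi i]` in the free directions and a unit point mass in
the other ones. -/
def Cell.measure (T : Cell N) : Measure (Fin N → ℝ) := by
  classical
  exact Measure.pi fun i =>
    if T.lo i < T.hi i then volume.restrict (Set.Icc (T.lo i) (T.hi i))
    else Measure.dirac (T.lo i)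

/-- The facet `{x ∈ T : x i = hi i}` (for `b = true`) or `{x ∈ T : x i = lo i}`
(for `b = false`); this is only used for free directions `i`. -/
def Cell.facet (T : Cell N) (i : Fin N) (b : Bool) : Cell N where
  lo := if b then Function.update T.lo i (T.hi i) else T.lo
  hi := if b then T.hi else Function.update T.hi i (T.lo i)
  lo_le_hi := by
    intro j
    have h := T.lo_le_hi j
    by_cases hj : j = i
    · subst hj; cases b <;> simp
    · cases b <;> simp [hj, h]

/-- `F` is a face of `T`, of any dimension; `T` is a face of itself. -/
def Cell.IsFace (F T : Cell N) : Prop :=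
  ∀ i, (F.lo i = T.lo i ∧ F.hi i = T.hi i) ∨ (F.lo i = T.lo i ∧ F.hi i = T.lo i) ∨
    (F.lo i = T.hi i ∧ F.hi i = T.hi i)

/-- A proper face of `T`, that is, a cell of the boundary complex `∂T`. -/
def Cell.IsProperFace (F T : Cell N) : Prop := F.IsFace T ∧ F ≠ T

variable (N) in
/-- A complex of hypercubes: a collection of boxes that contains all faces of its members. (Nothing
is required about the mutual position of the members, so the usual conforming cubical meshes are
included, and so is the complex of all faces of a single hypercube.) -/
structure CubicalComplex where
  cells : Set (Cell N)
  face_mem : ∀ {F T : Cell N}, T ∈ cells → F.IsFace T → F ∈ cells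

/-- The `k`-forms on the cell `T` with square integrable coefficients: `u` stands for
`∑_J u_J dx_J`, where `J` runs through the `k`-element sets of free directions of `T` and
`dx_J = dx_{j₁} ∧ … ∧ dx_{j_k}` for `J = {j₁ < … < j_k}`. -/
def L2Form (T : Cell N) (k : ℕ) : Submodule ℝ (Finset (Fin N) → Lp ℝ 2 T.measure) where
  carrier := {u | ∀ J, ¬ (J ⊆ T.dirs ∧ #J = k) → u J = 0}
  add_mem' := by
    intro u v hu hv J hJ
    simp [hu J hJ, hv J hJ]
  zero_mem' := by
    intro J _
    rfl
  smul_mem' := by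
    intro c u hu J hJ
    simp [hu J hJ]

/-- The sign with `dx_i ∧ dx_{J \ {i}} = insSign i J • dx_J`, for `i ∈ J`. -/
def insSign (i : Fin N) (J : Finset (Fin N)) : ℝ := (-1) ^ #{j ∈ J | j < i}

/-- The sign with `dx_J ∧ dx_K = wedgeSign J K • dx_{J ∪ K}`, for disjoint `J` and `K`. -/
def wedgeSign (J K : Finset (Fin N)) : ℝ := (-1) ^ #{p ∈ J ×ˢ K | p.2 < p.1}

/-- The `i`-th partial derivative. -/
def partialDeriv (i : Fin N) (ψ : (Fin N → ℝ) → ℝ) (x : Fin N → ℝ) : ℝ :=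
  fderiv ℝ ψ x (Pi.single i 1)

/-- `w` is the weak exterior derivative of `u` on the (relative) interior of `T`: the identity
`(du)_L = ∑_{i ∈ L} insSign i L • ∂_i u_{L \ {i}}`, tested against smooth functions
that vanish near the boundary of `T`. -/
def IsExtDeriv (T : Cell N) {k : ℕ} (u : L2Form T k) (w : L2Form T (k + 1)) : Prop :=
  ∀ L ⊆ T.dirs, ∀ ψ : (Fin N → ℝ) → ℝ, ContDiff ℝ ∞ ψ →
    (∀ x ∈ tsupport ψ, ∀ i ∈ T.dirs, T.lo i < x i ∧ x i < T.hi i) →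
    ∫ x, w.1 L x * ψ x ∂T.measure =
      - ∑ i ∈ L, insSign i L * ∫ x, u.1 (L.erase i) x * partialDeriv i ψ x ∂T.measure

/-- The Stokes formula on `T`, with all smooth test functions: `w` is the exterior derivative of
`u`, and the trace (pullback) of `u` on each facet `F` of `T` is the form `v F`. -/
def StokesFormula (T : Cell N) {k : ℕ} (u : L2Form T k) (w : L2Form T (k + 1))
    (v : ∀ F : Cell N, L2Form F k) : Prop :=
  ∀ L ⊆ T.dirs, ∀ ψ : (Fin N → ℝ) → ℝ, ContDiff ℝ ∞ ψ →
    ∫ x, w.1 L x * ψ x ∂T.measure +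
      ∑ i ∈ L, insSign i L * ∫ x, u.1 (L.erase i) x * partialDeriv i ψ x ∂T.measure =
    ∑ i ∈ L, insSign i L *
      (∫ x, (v (T.facet i true)).1 (L.erase i) x * ψ x ∂(T.facet i true).measure -
        ∫ x, (v (T.facet i false)).1 (L.erase i) x * ψ x ∂(T.facet i false).measure)

/-- `U` gives, on all the faces of `T`, the pullbacks of the form `U T`: on each face `F` of `T`
the form `U F` is square integrable with square integrable exterior derivative, and its trace on
each facet of `F` is given by `U`. Only the values of `U` on the faces of `T` matter. -/
def IsTraceFamily (T : Cell N) {k : ℕ} (U : ∀ F : Cell N, L2Form F k) : Prop :=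
  ∀ F : Cell N, F.IsFace T → ∃ w : L2Form F (k + 1), StokesFormula F (U F) w U

/-- The forms on `T` whose pullback to each face of `T` is square integrable with square integrable
exterior derivative. -/
def fullSpace (T : Cell N) (k : ℕ) : Set (L2Form T k) :=
  {u | ∃ U : ∀ F : Cell N, L2Form F k, IsTraceFamily T U ∧ U T = u}

/-- The form `u` has zero pullback to the boundary of `T`. -/
def IsTraceFree (T : Cell N) {k : ℕ} (u : L2Form T k) : Prop :=
  ∃ U : ∀ F : Cell N, L2Form F k, IsTraceFamily T U ∧ U T = u ∧
    ∀ F : Cell N, F.IsProperFace T → U F = 0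

/-- `𝒫_s Λ^k(T)`: the `k`-forms on `T` whose coefficients are polynomials of degree at most `s`.
It is zero for `s < 0`. -/
def polyForms (T : Cell N) (s : ℤ) (k : ℕ) : Submodule ℝ (L2Form T k) where
  carrier := {u | ∀ J, ∃ p : MvPolynomial (Fin N) ℝ,
    (∀ d ∈ p.support, (d.degree : ℤ) ≤ s) ∧ u.1 J =ᵐ[T.measure] fun x => MvPolynomial.eval x p}
  add_mem' := by
    classical
    intro u v hu hv J
    obtain ⟨p, hp, hup⟩ := hu J
    obtain ⟨q, hq, hvq⟩ := hv J
    refine ⟨p + q, fun d hd => ?_, ?_⟩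
    · rcases Finset.mem_union.1 (MvPolynomial.support_add hd) with h | h
      · exact hp d h
      · exact hq d h
    · have h : (u + v).1 J = u.1 J + v.1 J := rfl
      rw [h]
      filter_upwards [Lp.coeFn_add (u.1 J) (v.1 J), hup, hvq] with x hx h1 h2
      rw [hx, Pi.add_apply, h1, h2, map_add]
  zero_mem' := by
    intro J
    refine ⟨0, by simp, ?_⟩
    filter_upwards [Lp.coeFn_zero ℝ 2 T.measure] with x hx
    simpa using hx
  smul_mem' := by
    intro c u hu J
    obtain ⟨p, hp, hup⟩ := hu J
    refine ⟨c • p, fun d hd => hp d (MvPolynomial.support_smul hd), ?_⟩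
    have h : (c • u).1 J = c • u.1 J := rfl
    rw [h]
    filter_upwards [Lp.coeFn_smul c (u.1 J), hup] with x hx h1
    rw [hx, Pi.smul_apply, h1, MvPolynomial.smul_eval, smul_eq_mul]

/-- The integrated wedge product `∫_T u ∧ v`, for the orientation of `T` in which the free
directions are taken in increasing order. -/
def integralWedge (T : Cell N) {k l : ℕ} (u : L2Form T k) (v : L2Form T l) : ℝ :=
  ∑ J ∈ T.dirs.powerset,
    wedgeSign J (T.dirs \ J) * ∫ x, u.1 J x * v.1 (T.dirs \ J) x ∂T.measure

/-- A finite element system on a complex of hypercubes. -/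
structure FES (C : CubicalComplex N) where
  space : ∀ (T : Cell N) (k : ℕ), Submodule ℝ (L2Form T k)
  finiteDimensional : ∀ T ∈ C.cells, ∀ k, FiniteDimensional ℝ (space T k)
  subset_fullSpace : ∀ T ∈ C.cells, ∀ k, ∀ u ∈ space T k, u ∈ fullSpace T k
  extDeriv_mem : ∀ T ∈ C.cells, ∀ k, ∀ u ∈ space T k, ∀ w : L2Form T (k + 1),
    IsExtDeriv T u w → w ∈ space T (k + 1)
  pullback_mem : ∀ T ∈ C.cells, ∀ k, ∀ U : ∀ F : Cell N, L2Form F k, IsTraceFamily T U →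
    U T ∈ space T k → ∀ F : Cell N, F.IsFace T → U F ∈ space F k

namespace FES

variable {C : CubicalComplex N}

/-- The subspace `A^k_0(T)` of forms in `A^k(T)` with zero pullback to the boundary. -/
def zeroSpace (A : FES C) (T : Cell N) (k : ℕ) : Set (L2Form T k) :=
  {u | u ∈ A.space T k ∧ IsTraceFree T u}

/-- The restriction `A^k(T) → A^k(∂T)` is onto, for all `T` and `k`. An element of `A^k(∂T)` is a
family of forms in `A^k(F)`, for the proper faces `F` of `T`, that is compatible with pullbacks. -/
def AdmitsExtensions (A : FES C) : Prop :=
  ∀ T ∈ C.cells, ∀ (k : ℕ) (U : ∀ F : Cell N, L2Form F k),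
    (∀ F : Cell N, F.IsProperFace T → U F ∈ A.space F k ∧ IsTraceFamily F U) →
    ∃ V : ∀ F : Cell N, L2Form F k, IsTraceFamily T V ∧ V T ∈ A.space T k ∧
      ∀ F : Cell N, F.IsProperFace T → V F = U F

/-- Exactness of `0 → ℝ → A^0(T) → A^1(T) → ⋯ → A^{dim T}(T) → 0`, for all `T`. -/
def LocallyExact (A : FES C) : Prop :=
  ∀ T ∈ C.cells,
    (∀ u : L2Form T 0, (u ∈ A.space T 0 ∧ IsExtDeriv T u 0) ↔
      ∃ c : ℝ, u.1 ∅ =ᵐ[T.measure] fun _ => c) ∧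
    ∀ (k : ℕ), ∀ u ∈ A.space T (k + 1), IsExtDeriv T u 0 →
      ∃ v ∈ A.space T k, IsExtDeriv T v u

/-- Compatibility of a finite element system. -/
def Compatible (A : FES C) : Prop := A.AdmitsExtensions ∧ A.LocallyExact

/-- `A^k(T)` contains `𝒫_{r-k} Λ^k(T)`, for all `T` and `k`. -/
def ContainsPoly (A : FES C) (r : ℕ) : Prop :=
  ∀ T ∈ C.cells, ∀ k : ℕ, polyForms T ((r : ℤ) - k) k ≤ A.space T k

/-- `A` is a minimal compatible finite element system containing the spaces `𝒫_{r-k} Λ^k(T)`: it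
has the smallest dimensions among all such systems. -/
def IsMinimal (A : FES C) (r : ℕ) : Prop :=
  A.Compatible ∧ A.ContainsPoly r ∧
    ∀ B : FES C, B.Compatible → B.ContainsPoly r →
      ∀ T ∈ C.cells, ∀ k : ℕ, Module.finrank ℝ (A.space T k) ≤ Module.finrank ℝ (B.space T k)

/-- The spaces `𝒫_{r+k-2m} Λ^{m-k}(F)`, with `m = dim F`, provide unisolvent degrees of freedom on
`A`: for each cell `T` the map that sends `u ∈ A^k(T)` to the collection of linear forms
`v ↦ ∫_F u|_F ∧ v` on these spaces, for the faces `F` of `T` (including `T`), is a bijection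
onto the product of their duals. (There are no such linear forms when `k > m`.) -/
def Unisolvent (A : FES C) (r : ℕ) : Prop :=
  ∀ T ∈ C.cells, ∀ (k : ℕ)
    (ℓ : ∀ F : Cell N, polyForms F ((r : ℤ) + k - 2 * F.dim) (F.dim - k) →ₗ[ℝ] ℝ),
    ∃! u : L2Form T k, u ∈ A.space T k ∧
      ∃ U : ∀ F : Cell N, L2Form F k, IsTraceFamily T U ∧ U T = u ∧
        ∀ F : Cell N, F.IsFace T → k ≤ F.dim →
          ∀ v : polyForms F ((r : ℤ) + k - 2 * F.dim) (F.dim - k),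
            integralWedge F (U F) v.1 = ℓ F v

end FES

end CubeFES

end

noncomputable section

namespace CubeFES

variable {N : ℕ}

/-! ### Cells and faces -/

/-! The Stokes formula determines traces, so a form has at most one family of pullbacks
(`IsD.eq_zero`), and the pullbacks of du are the derivatives of the pullbacks of u
(`IsD.stokesFormula_deriv`). Everything else is linear algebra on these families, together with
explicit polynomial computations.

When restriction to the boundary is onto, A^k(T) is, non-canonically, the direct sum of the spaces
A^k_0(F) over the faces F of T: maps that are injective on each A^k_0(F) are jointly injective on
A^k(T) (`eq_zero_of_dofs`), and values on the faces can be prescribed one face at a time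
(`exists_of_dofs`). Hence an inclusion A^k_0(F) ⊆ B^k_0(F) on all cells gives dim A^k(T) ≤ dim
B^k(T). Since every competitor B satisfies 𝒫_{r-k}Λ^k_0 ⊆ B^k_0, a system with A^k_0 = 𝒫_{r-k}Λ^k_0
is minimal.

For the converse, every compatible A contains a compatible subsystem whose spaces without traces are
exactly the polynomial ones; minimality then forces A to equal it. Let Z be the forms in A^k_0(F)
with derivative in 𝒫_{r-k-1}Λ^{k+1}_0(F), and let G be a space with 𝒫 ⊆ G, G ∩ Z ⊆ 𝒫 and G + Z
everything. The subsystem `minSystem` consists of the u in A for which u and du lie in G on every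
face. A trace-free u in it has du in G ∩ Z, so du is polynomial, hence u is in G ∩ Z and is
polynomial as well (`zeroSubmodule_minSystem`). Boundary data still extend, because an extension in
A can be corrected by trace-free forms; this uses that the complex A_0 modulo 𝒫_0 is exact in
positive degrees (`exists_of_almostClosed`).

That exactness, and the local exactness of the subsystem, rest on an equivalence for systems with
extensions: the complexes A(F) resolve ℝ on all faces if and only if each A_0(F) has only the
cohomology detected by the integral over F (`zeroExact_of_locallyExact`,
`locallyExact_of_zeroExact`). It is proved by imposing or dropping the boundary condition on one
facet at a time, as in the long exact sequence of a pair. The polynomial forms without traces have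
this cohomology too, by a homotopy operator in each coordinate direction
(`exists_polyZero_primitive`); the volume form is among them because dim F ≤ r.

For unisolvence, the coefficient of dx_J in a trace-free polynomial form is divisible by the product
of (x_i - lo_i)(hi_i - x_i) over the free i outside J. With m = dim T the quotients are the
coefficients of a form in 𝒫_{r+k-2m}Λ^{m-k}(T), and the wedge pairing becomes a weighted L² inner
product, positive inside T. So the degrees of freedom are bijective on each A^k_0(F), and the direct
sum structure gives the result on T. -/

theorem Cell.mem_dirs {T : Cell N} {i : Fin N} : i ∈ T.dirs ↔ T.lo i < T.hi i := by
  simp [Cell.dirs]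

theorem Cell.lo_eq_hi {T : Cell N} {i : Fin N} (h : i ∉ T.dirs) : T.lo i = T.hi i :=
  le_antisymm (T.lo_le_hi i) (not_lt.1 fun h' => h (Cell.mem_dirs.2 h'))

theorem Cell.IsFace.refl (T : Cell N) : T.IsFace T := fun _ => Or.inl ⟨rfl, rfl⟩

theorem Cell.IsFace.trans {E F T : Cell N} (h : E.IsFace F) (h' : F.IsFace T) : E.IsFace T := by
  intro i
  have h1 := h i
  have h2 := h' i
  grind

theorem Cell.IsFace.dirs_subset {F T : Cell N} (h : F.IsFace T) : F.dirs ⊆ T.dirs := by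
  intro i hi
  rw [Cell.mem_dirs] at *
  have := h i
  grind

theorem Cell.IsFace.dim_le {F T : Cell N} (h : F.IsFace T) : F.dim ≤ T.dim :=
  card_le_card h.dirs_subset

theorem Cell.IsFace.eq_of_dirs {F T : Cell N} (h : F.IsFace T) (hd : T.dirs ⊆ F.dirs) :
    F = T := by
  have key : ∀ i, F.lo i = T.lo i ∧ F.hi i = T.hi i := by
    intro i
    by_cases hi : i ∈ T.dirs
    · have h1 := Cell.mem_dirs.1 (hd hi)
      have := h i
      grind
    · have h1 := Cell.lo_eq_hi hi
      have := h i
      grind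
  ext i
  · exact (key i).1
  · exact (key i).2

theorem Cell.IsProperFace.dim_lt {F T : Cell N} (h : F.IsProperFace T) : F.dim < T.dim := by
  refine card_lt_card ⟨h.1.dirs_subset, fun hd => h.2 (h.1.eq_of_dirs hd)⟩

theorem Cell.facet_lo_self (T : Cell N) (i : Fin N) (b : Bool) :
    (T.facet i b).lo i = if b then T.hi i else T.lo i := by
  cases b <;> simp [Cell.facet]

theorem Cell.facet_hi_self (T : Cell N) (i : Fin N) (b : Bool) :
    (T.facet i b).hi i = if b then T.hi i else T.lo i := by
  cases b <;> simp [Cell.facet]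

theorem Cell.facet_lo_ne (T : Cell N) {i j : Fin N} (b : Bool) (h : j ≠ i) :
    (T.facet i b).lo j = T.lo j := by
  cases b <;> simp [Cell.facet, h]

theorem Cell.facet_hi_ne (T : Cell N) {i j : Fin N} (b : Bool) (h : j ≠ i) :
    (T.facet i b).hi j = T.hi j := by
  cases b <;> simp [Cell.facet, h]

theorem Cell.facet_isFace (T : Cell N) (i : Fin N) (b : Bool) : (T.facet i b).IsFace T := by
  intro j
  by_cases h : j = i
  · subst h
    rw [Cell.facet_lo_self, Cell.facet_hi_self]
    cases b <;> simp
  · left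
    exact ⟨T.facet_lo_ne b h, T.facet_hi_ne b h⟩

theorem Cell.facet_dirs (T : Cell N) (i : Fin N) (b : Bool) :
    (T.facet i b).dirs = T.dirs.erase i := by
  ext j
  rw [mem_erase, Cell.mem_dirs, Cell.mem_dirs]
  by_cases h : j = i
  · subst h
    rw [Cell.facet_lo_self, Cell.facet_hi_self]
    simp
  · rw [T.facet_lo_ne b h, T.facet_hi_ne b h]
    simp [h]

theorem Cell.facet_isProperFace {T : Cell N} {i : Fin N} (hi : i ∈ T.dirs) (b : Bool) :
    (T.facet i b).IsProperFace T := by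
  refine ⟨T.facet_isFace i b, fun h => ?_⟩
  have h2 := T.facet_dirs i b
  rw [h] at h2
  rw [h2] at hi
  simp at hi

theorem Cell.facet_comm (T : Cell N) {i j : Fin N} (h : i ≠ j) (b c : Bool) :
    (T.facet i b).facet j c = (T.facet j c).facet i b := by
  ext l
  · by_cases hi : l = i
    · subst hi
      rw [Cell.facet_lo_ne _ _ h, Cell.facet_lo_self, Cell.facet_lo_self, Cell.facet_lo_ne _ _ h,
        Cell.facet_hi_ne _ _ h]
    · rw [Cell.facet_lo_ne _ b hi]
      by_cases hj : l = j
      · subst hj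
        rw [Cell.facet_lo_self, Cell.facet_lo_self, Cell.facet_lo_ne _ _ hi, Cell.facet_hi_ne _ _ hi]
      · rw [Cell.facet_lo_ne _ _ hj, Cell.facet_lo_ne _ _ hj, Cell.facet_lo_ne _ _ hi]
  · by_cases hi : l = i
    · subst hi
      rw [Cell.facet_hi_ne _ _ h, Cell.facet_hi_self, Cell.facet_hi_self, Cell.facet_lo_ne _ _ h,
        Cell.facet_hi_ne _ _ h]
    · rw [Cell.facet_hi_ne _ b hi]
      by_cases hj : l = j
      · subst hj
        rw [Cell.facet_hi_self, Cell.facet_hi_self, Cell.facet_lo_ne _ _ hi, Cell.facet_hi_ne _ _ hi]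
      · rw [Cell.facet_hi_ne _ _ hj, Cell.facet_hi_ne _ _ hj, Cell.facet_hi_ne _ _ hi]

/-- A proper face lies in a facet. -/
theorem Cell.IsProperFace.exists_facet {F T : Cell N} (h : F.IsProperFace T) :
    ∃ i ∈ T.dirs, ∃ b, F.IsFace (T.facet i b) := by
  have : ¬ T.dirs ⊆ F.dirs := fun hd => h.2 (h.1.eq_of_dirs hd)
  obtain ⟨i, hi, hiF⟩ := not_subset.1 this
  have hF := Cell.lo_eq_hi hiF
  have hlt := Cell.mem_dirs.1 hi
  have key : ∀ b, F.lo i = (if b then T.hi i else T.lo i) → F.IsFace (T.facet i b) := by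
    intro b hb j
    by_cases hj : j = i
    · subst hj
      rw [Cell.facet_lo_self, Cell.facet_hi_self]
      left
      exact ⟨hb, hF ▸ hb⟩
    · rw [T.facet_lo_ne b hj, T.facet_hi_ne b hj]
      exact h.1 j
  rcases h.1 i with h1 | h1 | h1
  · exact ⟨i, hi, false, key _ (by simpa using h1.1)⟩
  · exact ⟨i, hi, false, key _ (by simpa using h1.1)⟩
  · exact ⟨i, hi, true, key _ (by simpa using h1.1)⟩

/-! ### The measure of a cell -/

/-- The factors of the measure of a cell. -/
def Cell.axisMeasure (T : Cell N) (i : Fin N) : Measure ℝ := by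
  classical
  exact if T.lo i < T.hi i then volume.restrict (Set.Icc (T.lo i) (T.hi i))
    else Measure.dirac (T.lo i)

theorem Cell.measure_eq (T : Cell N) : T.measure = Measure.pi T.axisMeasure := rfl

theorem Cell.axisMeasure_of_mem {T : Cell N} {i : Fin N} (h : i ∈ T.dirs) :
    T.axisMeasure i = volume.restrict (Set.Icc (T.lo i) (T.hi i)) := by
  simp [Cell.axisMeasure, Cell.mem_dirs.1 h]

theorem Cell.axisMeasure_of_notMem {T : Cell N} {i : Fin N} (h : i ∉ T.dirs) :
    T.axisMeasure i = Measure.dirac (T.lo i) := by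
  have := mt Cell.mem_dirs.2 h
  simp [Cell.axisMeasure, this]

instance (T : Cell N) (i : Fin N) : IsFiniteMeasure (T.axisMeasure i) := by
  by_cases h : i ∈ T.dirs
  · rw [Cell.axisMeasure_of_mem h]
    infer_instance
  · rw [Cell.axisMeasure_of_notMem h]
    infer_instance

instance (T : Cell N) : IsFiniteMeasure T.measure := by
  rw [Cell.measure_eq]
  infer_instance

/-- The relatively open box of a cell. -/
def Cell.inside (T : Cell N) : Set (Fin N → ℝ) :=
  {x | ∀ i, (i ∈ T.dirs → T.lo i < x i ∧ x i < T.hi i) ∧ (i ∉ T.dirs → x i = T.lo i)}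

theorem Cell.ae_inside (T : Cell N) : ∀ᵐ x ∂T.measure, x ∈ T.inside := by
  have key : ∀ i, ∀ᵐ t ∂T.axisMeasure i,
      (i ∈ T.dirs → T.lo i < t ∧ t < T.hi i) ∧ (i ∉ T.dirs → t = T.lo i) := by
    intro i
    by_cases h : i ∈ T.dirs
    · rw [Cell.axisMeasure_of_mem h, ← restrict_Ioo_eq_restrict_Icc]
      filter_upwards [ae_restrict_mem measurableSet_Ioo] with t ht
      exact ⟨fun _ => ht, fun h' => absurd h h'⟩
    · rw [Cell.axisMeasure_of_notMem h]
      rw [ae_dirac_eq]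
      exact ⟨fun h' => absurd h' h, fun _ => rfl⟩
  rw [Cell.measure_eq]
  have := fun i => (Measure.quasiMeasurePreserving_eval T.axisMeasure i).ae (key i)
  exact ae_all_iff.2 this

/-- A closed box. -/
def Cell.box (T : Cell N) : Set (Fin N → ℝ) := Set.Icc T.lo T.hi

theorem Cell.inside_subset_box (T : Cell N) : T.inside ⊆ T.box := by
  intro x hx
  constructor <;> intro i <;> by_cases h : i ∈ T.dirs
  · exact ((hx i).1 h).1.le
  · exact ((hx i).2 h).ge
  · exact ((hx i).1 h).2.le
  · exact ((hx i).2 h).le.trans (T.lo_le_hi i)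

theorem Cell.ae_box (T : Cell N) : ∀ᵐ x ∂T.measure, x ∈ T.box := by
  filter_upwards [T.ae_inside] with x hx using T.inside_subset_box hx

theorem Cell.exists_bound (T : Cell N) {ψ : (Fin N → ℝ) → ℝ} (hψ : Continuous ψ) :
    ∃ c : ℝ, ∀ᵐ x ∂T.measure, ‖ψ x‖ ≤ c := by
  obtain ⟨c, hc⟩ := (isCompact_Icc (a := T.lo) (b := T.hi)).exists_bound_of_continuousOn
    hψ.continuousOn
  exact ⟨c, by filter_upwards [T.ae_box] with x hx using hc x hx⟩

theorem Cell.integrable_of_continuous (T : Cell N) {ψ : (Fin N → ℝ) → ℝ} (hψ : Continuous ψ) :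
    Integrable ψ T.measure := by
  obtain ⟨c, hc⟩ := T.exists_bound hψ
  exact Integrable.of_bound hψ.aestronglyMeasurable c hc

theorem Cell.memLp_of_continuous (T : Cell N) {ψ : (Fin N → ℝ) → ℝ} (hψ : Continuous ψ) :
    MemLp ψ 2 T.measure := by
  obtain ⟨c, hc⟩ := T.exists_bound hψ
  exact MemLp.of_bound hψ.aestronglyMeasurable c hc

/-- A continuous function that vanishes almost everywhere on a cell vanishes on the cell. -/
theorem Cell.eq_zero_of_ae (T : Cell N) {ψ : (Fin N → ℝ) → ℝ} (hψ : Continuous ψ)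
    (h : ψ =ᵐ[T.measure] 0) {x : Fin N → ℝ} (hx : x ∈ T.box) : ψ x = 0 := by
  by_contra hne
  obtain ⟨ε, hε, hball⟩ := Metric.isOpen_iff.1 (hψ.isOpen_preimage {0}ᶜ isOpen_compl_singleton) x hne
  have h0 : T.measure (Metric.ball x ε) = 0 :=
    measure_mono_null hball (ae_iff.1 h)
  -- Balls of the sup metric are products, so a null ball has a null factor; but each factor
  -- contains either an interval of positive length or the point mass.
  rw [Cell.measure_eq, Measure.pi_ball _ _ hε, Finset.prod_eq_zero_iff] at h0
  obtain ⟨i, -, hi⟩ := h0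
  by_cases hd : i ∈ T.dirs
  · rw [Cell.axisMeasure_of_mem hd] at hi
    have hlt := Cell.mem_dirs.1 hd
    have h1 := hx.1 i
    have h2 := hx.2 i
    have : Set.Ioo (max (T.lo i) (x i - ε)) (min (T.hi i) (x i + ε)) ⊆
        Metric.ball (x i) ε ∩ Set.Icc (T.lo i) (T.hi i) := by
      rintro t ⟨ht1, ht2⟩
      rw [max_lt_iff] at ht1
      rw [lt_min_iff] at ht2
      refine ⟨?_, ht1.1.le, ht2.1.le⟩
      rw [Real.ball_eq_Ioo]
      exact ⟨ht1.2, ht2.2⟩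
    rw [Measure.restrict_apply measurableSet_ball] at hi
    have h3 := measure_mono_null this hi
    rw [Real.volume_Ioo, ENNReal.ofReal_eq_zero] at h3
    have : max (T.lo i) (x i - ε) < min (T.hi i) (x i + ε) := by
      rw [max_lt_iff, lt_min_iff, lt_min_iff]
      refine ⟨⟨hlt, ?_⟩, ?_, ?_⟩ <;> linarith
    linarith
  · rw [Cell.axisMeasure_of_notMem hd, Measure.dirac_apply' _ measurableSet_ball] at hi
    have h1 := hx.1 i
    have h2 := hx.2 i
    have h3 := Cell.lo_eq_hi hd
    have : T.lo i ∈ Metric.ball (x i) ε := by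
      rw [show T.lo i = x i by linarith]
      exact Metric.mem_ball_self hε
    simp [this] at hi

theorem Cell.measureReal_univ_ne_zero (T : Cell N) : T.measure.real Set.univ ≠ 0 := by
  intro h
  rw [measureReal_eq_zero_iff, Measure.measure_univ_eq_zero] at h
  have := T.eq_zero_of_ae (ψ := fun _ => 1) continuous_const (by rw [h]; rfl)
    (show T.lo ∈ T.box from ⟨le_rfl, T.lo_le_hi⟩)
  exact one_ne_zero this

/-! ### Integration along one direction -/

/-- Overwriting the i-th coordinate by an independent one of law μ replaces the i-th factor; the old
factor has mass one and disappears. With a facet as the starting point, μ is Lebesgue measure when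
the cell is recovered, and a point mass when moving to the opposite facet. -/
theorem pi_update_eq_map {ι : Type*} [Fintype ι] [DecidableEq ι] (m : ι → Measure ℝ)
    [∀ i, SigmaFinite (m i)] (i : ι) [IsProbabilityMeasure (m i)] (μ : Measure ℝ) [SigmaFinite μ] :
    Measure.pi (Function.update m i μ) =
      Measure.map (fun p : (ι → ℝ) × ℝ => Function.update p.1 i p.2) ((Measure.pi m).prod μ) := by
  have hs : ∀ j, SigmaFinite (Function.update m i μ j) := by
    intro j
    by_cases h : j = i
    · subst h; simpa
    · simp only [Function.update_of_ne h]; infer_instance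
  have hmeas : Measurable (fun p : (ι → ℝ) × ℝ => Function.update p.1 i p.2) := by
    refine measurable_pi_lambda _ fun j => ?_
    by_cases h : j = i
    · subst h; simpa using measurable_snd
    · simp only [Function.update_of_ne h]
      exact (measurable_pi_apply j).comp measurable_fst
  refine Measure.pi_eq fun s hsm => ?_
  rw [Measure.map_apply hmeas (MeasurableSet.univ_pi hsm)]
  have : (fun p : (ι → ℝ) × ℝ => Function.update p.1 i p.2) ⁻¹' (Set.univ.pi s) =
      (Set.univ.pi (Function.update s i Set.univ)) ×ˢ (s i) := by
    ext ⟨x, t⟩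
    simp only [Set.mem_preimage, Set.mem_pi, Set.mem_univ, true_implies, Set.mem_prod]
    constructor
    · intro h
      refine ⟨fun j => ?_, by simpa using h i⟩
      by_cases hj : j = i
      · subst hj; simp
      · simpa [hj] using h j
    · rintro ⟨h, h'⟩ j
      by_cases hj : j = i
      · subst hj; simpa using h'
      · simpa [hj] using h j
  rw [this, Measure.prod_prod, Measure.pi_pi]
  rw [← mul_prod_erase univ _ (mem_univ i), ← mul_prod_erase univ (fun j => (Function.update m i μ j) (s j)) (mem_univ i)]
  simp only [Function.update_self, measure_univ, one_mul]
  rw [mul_comm]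
  congr 1
  refine prod_congr rfl fun j hj => ?_
  have hj := ne_of_mem_erase hj
  simp [hj]

theorem Cell.facet_axisMeasure (T : Cell N) (i : Fin N) (b : Bool) :
    (T.facet i b).axisMeasure =
      Function.update T.axisMeasure i (Measure.dirac (if b then T.hi i else T.lo i)) := by
  funext j
  by_cases h : j = i
  · subst h
    rw [Function.update_self, Cell.axisMeasure_of_notMem (by simp [Cell.facet_dirs]),
      Cell.facet_lo_self]
  · simp [Function.update_of_ne h, Cell.axisMeasure, T.facet_lo_ne b h, T.facet_hi_ne b h]

theorem Cell.measure_eq_map (T : Cell N) (i : Fin N) (b : Bool) :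
    T.measure = Measure.map (fun p : (Fin N → ℝ) × ℝ => Function.update p.1 i p.2)
      ((T.facet i b).measure.prod (T.axisMeasure i)) := by
  have h1 : T.axisMeasure = Function.update (T.facet i b).axisMeasure i (T.axisMeasure i) := by
    rw [Cell.facet_axisMeasure, Function.update_idem, Function.update_eq_self]
  have : IsProbabilityMeasure ((T.facet i b).axisMeasure i) := by
    rw [Cell.facet_axisMeasure, Function.update_self]
    infer_instance
  rw [Cell.measure_eq, Cell.measure_eq, ← pi_update_eq_map, ← h1]

theorem continuous_update_prod (i : Fin N) :
    Continuous (fun p : (Fin N → ℝ) × ℝ => Function.update p.1 i p.2) :=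
  continuous_fst.update i continuous_snd

/-- Integration over a cell as an iterated integral. -/
theorem Cell.integral_eq_iterated {T : Cell N} {i : Fin N} (hi : i ∈ T.dirs) (b : Bool)
    {f : (Fin N → ℝ) → ℝ} (hf : Continuous f) :
    ∫ x, f x ∂T.measure =
      ∫ x, (∫ t in (T.lo i)..(T.hi i), f (Function.update x i t)) ∂(T.facet i b).measure := by
  have hm := (continuous_update_prod i).measurable
  have hint := T.integrable_of_continuous hf
  rw [T.measure_eq_map i b] at hint ⊢
  rw [integral_map hm.aemeasurable hf.aestronglyMeasurable, integral_prod]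
  · rw [Cell.axisMeasure_of_mem hi]
    refine integral_congr_ae (Filter.Eventually.of_forall fun x => ?_)
    simp only
    rw [intervalIntegral.integral_of_le (T.lo_le_hi i), integral_Icc_eq_integral_Ioc]
  · exact (integrable_map_measure hf.aestronglyMeasurable hm.aemeasurable).1 hint

/-- Brings integrals over the two opposite facets under one measure, so that the boundary terms of
the divergence theorem can be compared pointwise. -/
theorem Cell.integral_facet (T : Cell N) (i : Fin N) (b c : Bool)
    {f : (Fin N → ℝ) → ℝ} (hf : Continuous f) :
    ∫ x, f x ∂(T.facet i b).measure =
      ∫ x, f (Function.update x i (if b then T.hi i else T.lo i)) ∂(T.facet i c).measure := by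
  have hm := (continuous_update_prod i).measurable
  have key : (T.facet i b).measure =
      Measure.map (fun p : (Fin N → ℝ) × ℝ => Function.update p.1 i p.2)
        ((T.facet i c).measure.prod (Measure.dirac (if b then T.hi i else T.lo i))) := by
    have : IsProbabilityMeasure ((T.facet i c).axisMeasure i) := by
      rw [Cell.facet_axisMeasure, Function.update_self]
      infer_instance
    rw [Cell.measure_eq, Cell.measure_eq, ← pi_update_eq_map, Cell.facet_axisMeasure,
      Cell.facet_axisMeasure, Function.update_idem]
  have hint := (T.facet i b).integrable_of_continuous hf
  rw [key] at hint ⊢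
  rw [integral_map hm.aemeasurable hf.aestronglyMeasurable, integral_prod]
  · simp
  · exact (integrable_map_measure hf.aestronglyMeasurable hm.aemeasurable).1 hint

theorem hasDerivAt_comp_update {f : (Fin N → ℝ) → ℝ} (hf : Differentiable ℝ f) (x : Fin N → ℝ)
    (i : Fin N) (t : ℝ) :
    HasDerivAt (fun s => f (Function.update x i s)) (partialDeriv i f (Function.update x i t)) t := by
  have h1 := (hf (Function.update x i t)).hasFDerivAt
  exact h1.comp_hasDerivAt t (hasDerivAt_update x i t)

theorem continuous_partialDeriv {f : (Fin N → ℝ) → ℝ} (hf : ContDiff ℝ ∞ f) (i : Fin N) :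
    Continuous (partialDeriv i f) :=
  (hf.continuous_fderiv (by simp)).clm_apply continuous_const

theorem contDiff_partialDeriv {f : (Fin N → ℝ) → ℝ} (hf : ContDiff ℝ ∞ f) (i : Fin N) :
    ContDiff ℝ ∞ (partialDeriv i f) :=
  (hf.fderiv_right (m := ∞) (by simp)).clm_apply contDiff_const

/-- The divergence theorem in one direction on a cell. -/
theorem Cell.integral_partialDeriv {T : Cell N} {i : Fin N} (hi : i ∈ T.dirs)
    {f : (Fin N → ℝ) → ℝ} (hf : ContDiff ℝ ∞ f) :
    ∫ x, partialDeriv i f x ∂T.measure =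
      ∫ x, f x ∂(T.facet i true).measure - ∫ x, f x ∂(T.facet i false).measure := by
  have hu : ∀ t : ℝ, Continuous fun x : Fin N → ℝ => Function.update x i t :=
    fun t => continuous_id.update i continuous_const
  rw [T.integral_eq_iterated hi false (continuous_partialDeriv hf i),
    T.integral_facet i true false hf.continuous, T.integral_facet i false false hf.continuous,
    ← integral_sub]
  · refine integral_congr_ae (Filter.Eventually.of_forall fun x => ?_)
    simp only
    rw [intervalIntegral.integral_eq_sub_of_hasDerivAt
      (f := fun s => f (Function.update x i s)) (fun t _ => hasDerivAt_comp_update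
        (hf.differentiable (by simp)) x i t)]
    · simp
    · refine Continuous.intervalIntegrable ?_ _ _
      exact (continuous_partialDeriv hf i).comp (continuous_const.update i continuous_id)
  · exact (T.facet i false).integrable_of_continuous (hf.continuous.comp (hu _))
  · exact (T.facet i false).integrable_of_continuous (hf.continuous.comp (hu _))

/-! ### Pairing with test functions -/

/-- The integral of the product of a square integrable function and a test function. -/
def pairing (T : Cell N) (ψ : (Fin N → ℝ) → ℝ) (f : Lp ℝ 2 T.measure) : ℝ :=
  ∫ x, f x * ψ x ∂T.measure

section pairing

variable {T : Cell N} {ψ : (Fin N → ℝ) → ℝ}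

theorem integrable_pairing (hψ : Continuous ψ) (f : Lp ℝ 2 T.measure) :
    Integrable (fun x => f x * ψ x) T.measure :=
  (Lp.memLp f).integrable_mul (T.memLp_of_continuous hψ)

theorem pairing_add (hψ : Continuous ψ) (f g : Lp ℝ 2 T.measure) :
    pairing T ψ (f + g) = pairing T ψ f + pairing T ψ g := by
  unfold pairing
  rw [← integral_add (integrable_pairing hψ f) (integrable_pairing hψ g)]
  refine integral_congr_ae ?_
  filter_upwards [Lp.coeFn_add f g] with x hx
  rw [hx, Pi.add_apply, add_mul]

theorem pairing_smul (c : ℝ) (f : Lp ℝ 2 T.measure) :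
    pairing T ψ (c • f) = c * pairing T ψ f := by
  unfold pairing
  rw [← integral_const_mul]
  refine integral_congr_ae ?_
  filter_upwards [Lp.coeFn_smul c f] with x hx
  rw [hx, Pi.smul_apply, smul_eq_mul, mul_assoc]

theorem pairing_zero : pairing T ψ (0 : Lp ℝ 2 T.measure) = 0 := by
  have := pairing_smul (T := T) (ψ := ψ) 0 0
  simpa using this

theorem pairing_of_ae {f : Lp ℝ 2 T.measure} {g : (Fin N → ℝ) → ℝ} (h : f =ᵐ[T.measure] g) :
    pairing T ψ f = ∫ x, g x * ψ x ∂T.measure := by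
  refine integral_congr_ae ?_
  filter_upwards [h] with x hx
  rw [hx]

theorem pairing_eq_zero_of_inside (h : ∀ x ∈ T.inside, ψ x = 0) (f : Lp ℝ 2 T.measure) :
    pairing T ψ f = 0 := by
  refine integral_eq_zero_of_ae ?_
  filter_upwards [T.ae_inside] with x hx
  simp [h x hx]

/-- The fundamental lemma of the calculus of variations. The open set is left free so that tests can
be localised in the ambient space, away from other cells. -/
theorem eq_zero_of_pairing {O : Set (Fin N → ℝ)} (hO : IsOpen O) (hT : T.inside ⊆ O)
    (f : Lp ℝ 2 T.measure)
    (h : ∀ ψ : (Fin N → ℝ) → ℝ, ContDiff ℝ ∞ ψ → tsupport ψ ⊆ O → pairing T ψ f = 0) :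
    f = 0 := by
  have hf : Integrable f T.measure := (Lp.memLp f).integrable (by norm_num)
  have := hO.ae_eq_zero_of_integral_contDiff_smul_eq_zero
    (hf.locallyIntegrable.locallyIntegrableOn O) (fun ψ h1 _ h3 => by
      rw [← h ψ h1 h3]
      exact integral_congr_ae (Filter.Eventually.of_forall fun x => by simp [mul_comm]))
  rw [Lp.eq_zero_iff_ae_eq_zero]
  filter_upwards [this, T.ae_inside] with x hx hx'
  exact hx (hT hx')

end pairing

theorem L2Form.ext {T : Cell N} {k : ℕ} {u v : L2Form T k}
    (h : ∀ J ⊆ T.dirs, #J = k → u.1 J = v.1 J) : u = v := by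
  refine Subtype.ext (funext fun J => ?_)
  by_cases hJ : J ⊆ T.dirs ∧ #J = k
  · exact h J hJ.1 hJ.2
  · rw [u.2 J hJ, v.2 J hJ]

theorem L2Form.eq_zero_of_dim_lt {T : Cell N} {k : ℕ} (h : T.dim < k) (u : L2Form T k) : u = 0 := by
  refine L2Form.ext fun J hJ hJk => ?_
  have := card_le_card hJ
  rw [hJk] at this
  exact absurd this (not_le.2 h)

/-! ### Stokes formula -/

section stokes

variable {T : Cell N} {k : ℕ}

theorem stokesFormula_iff {u : L2Form T k} {w : L2Form T (k + 1)} {v : ∀ F : Cell N, L2Form F k} :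
    StokesFormula T u w v ↔ ∀ L ⊆ T.dirs, ∀ ψ : (Fin N → ℝ) → ℝ, ContDiff ℝ ∞ ψ →
      pairing T ψ (w.1 L) + ∑ i ∈ L, insSign i L * pairing T (partialDeriv i ψ) (u.1 (L.erase i)) =
      ∑ i ∈ L, insSign i L * (pairing (T.facet i true) ψ ((v (T.facet i true)).1 (L.erase i)) -
        pairing (T.facet i false) ψ ((v (T.facet i false)).1 (L.erase i))) :=
  Iff.rfl

theorem StokesFormula.add {u u' : L2Form T k} {w w' : L2Form T (k + 1)}
    {v v' : ∀ F : Cell N, L2Form F k} (h : StokesFormula T u w v) (h' : StokesFormula T u' w' v') :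
    StokesFormula T (u + u') (w + w') (v + v') := by
  rw [stokesFormula_iff] at *
  intro L hL ψ hψ
  have h1 := h L hL ψ hψ
  have h2 := h' L hL ψ hψ
  simp only [Submodule.coe_add, Pi.add_apply, pairing_add hψ.continuous,
    pairing_add (continuous_partialDeriv hψ _), mul_add, mul_sub, sum_add_distrib,
    sum_sub_distrib] at *
  linarith

theorem StokesFormula.smul (c : ℝ) {u : L2Form T k} {w : L2Form T (k + 1)}
    {v : ∀ F : Cell N, L2Form F k} (h : StokesFormula T u w v) :
    StokesFormula T (c • u) (c • w) (c • v) := by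
  rw [stokesFormula_iff] at *
  intro L hL ψ hψ
  have h1 := congrArg (c * ·) (h L hL ψ hψ)
  simp only [Submodule.coe_smul, Pi.smul_apply, pairing_smul, mul_add, mul_sub,
    sum_sub_distrib, mul_sum] at *
  simp only [mul_left_comm _ c]
  exact h1

theorem stokesFormula_zero : StokesFormula T (0 : L2Form T k) 0 0 := by
  rw [stokesFormula_iff]
  intro L hL ψ hψ
  simp [pairing_zero]

theorem StokesFormula.isExtDeriv {u : L2Form T k} {w : L2Form T (k + 1)}
    {v : ∀ F : Cell N, L2Form F k} (h : StokesFormula T u w v) : IsExtDeriv T u w := by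
  intro L hL ψ hψ hs
  have h1 := stokesFormula_iff.1 h L hL ψ hψ
  have h2 : ∀ i ∈ L, ∀ b, pairing (T.facet i b) ψ ((v (T.facet i b)).1 (L.erase i)) = 0 := by
    intro i hi b
    refine pairing_eq_zero_of_inside (fun x hx => ?_) _
    by_contra hne
    have h3 := hs x (subset_tsupport ψ hne) i (hL hi)
    have h4 := (hx i).2 (by simp [Cell.facet_dirs])
    rw [Cell.facet_lo_self] at h4
    cases b <;> simp at h4 <;> linarith
  rw [sum_eq_zero (s := L) (f := fun i => insSign i L * (_ - _))
    (fun i hi => by rw [h2 i hi, h2 i hi]; simp)] at h1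
  change pairing T ψ (w.1 L) = -∑ i ∈ L, insSign i L * pairing T (partialDeriv i ψ) (u.1 (L.erase i))
  linarith

theorem isExtDeriv_iff {u : L2Form T k} {w : L2Form T (k + 1)} :
    IsExtDeriv T u w ↔ ∀ L ⊆ T.dirs, ∀ ψ : (Fin N → ℝ) → ℝ, ContDiff ℝ ∞ ψ →
      (∀ x ∈ tsupport ψ, ∀ i ∈ T.dirs, T.lo i < x i ∧ x i < T.hi i) →
      pairing T ψ (w.1 L) =
        - ∑ i ∈ L, insSign i L * pairing T (partialDeriv i ψ) (u.1 (L.erase i)) :=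
  Iff.rfl

theorem isOpen_openBox (T : Cell N) :
    IsOpen {x : Fin N → ℝ | ∀ i ∈ T.dirs, T.lo i < x i ∧ x i < T.hi i} := by
  have : {x : Fin N → ℝ | ∀ i ∈ T.dirs, T.lo i < x i ∧ x i < T.hi i} =
      ⋂ i ∈ T.dirs, {x : Fin N → ℝ | T.lo i < x i ∧ x i < T.hi i} := by
    ext x; simp
  rw [this]
  refine isOpen_biInter_finset fun i _ => ?_
  exact (isOpen_lt continuous_const (continuous_apply i)).inter
    (isOpen_lt (continuous_apply i) continuous_const)

theorem IsExtDeriv.unique {u : L2Form T k} {w w' : L2Form T (k + 1)} (h : IsExtDeriv T u w)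
    (h' : IsExtDeriv T u w') : w = w' := by
  refine L2Form.ext fun L hL _ => ?_
  rw [← sub_eq_zero]
  refine eq_zero_of_pairing (isOpen_openBox T) (fun x hx i hi => (hx i).1 hi) _
    fun ψ hψ hs => ?_
  have h1 := isExtDeriv_iff.1 h L hL ψ hψ hs
  have h2 := isExtDeriv_iff.1 h' L hL ψ hψ hs
  have h3 := pairing_add (T := T) hψ.continuous (w.1 L - w'.1 L) (w'.1 L)
  rw [sub_add_cancel] at h3
  linarith

theorem insSign_mul_self (i : Fin N) (J : Finset (Fin N)) : insSign i J * insSign i J = 1 := by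
  unfold insSign
  rw [← mul_pow]
  simp

theorem insSign_ne_zero (i : Fin N) (J : Finset (Fin N)) : insSign i J ≠ 0 :=
  left_ne_zero_of_mul_eq_one (insSign_mul_self i J)

/-- A test function supported near the relative interior of one facet sees only the trace on that
facet, and all volume terms are zero. -/
theorem StokesFormula.trace_eq_zero {v : ∀ F : Cell N, L2Form F k}
    (h : StokesFormula T (0 : L2Form T k) 0 v) {i : Fin N} (hi : i ∈ T.dirs) (b : Bool) :
    v (T.facet i b) = 0 := by
  refine L2Form.ext fun J hJ _ => ?_
  rw [Cell.facet_dirs] at hJ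
  have hiJ : i ∉ J := fun h => notMem_erase i _ (hJ h)
  -- This open set contains the relative interior of the facet and misses every other facet of `T`,
  -- including the opposite one.
  set O : Set (Fin N → ℝ) := {x | ∀ j ∈ (T.facet i b).dirs,
    (T.facet i b).lo j < x j ∧ x j < (T.facet i b).hi j} ∩
    {x | if b then T.lo i < x i else x i < T.hi i} with hO
  have hlt := Cell.mem_dirs.1 hi
  refine eq_zero_of_pairing (O := O) ((isOpen_openBox _).inter ?_) (fun x hx => ⟨fun j hj =>
    (hx j).1 hj, ?_⟩) _ fun ψ hψ hs => ?_
  · cases b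
    · simpa using isOpen_lt (continuous_apply i) continuous_const
    · simpa using isOpen_lt continuous_const (continuous_apply i)
  · have := (hx i).2 (by simp [Cell.facet_dirs])
    rw [Cell.facet_lo_self] at this
    cases b
    · simpa [this] using hlt
    · simpa [this] using hlt
  -- Adding the direction `i` to the index set makes the `i`-th boundary term of the formula contain
  -- the coefficient `J` of the trace.
  have hL : insert i J ⊆ T.dirs := insert_subset hi (hJ.trans (erase_subset _ _))
  have h1 := stokesFormula_iff.1 h _ hL ψ hψ
  have h2 : ∀ j ∈ insert i J, ∀ c, (j, c) ≠ (i, b) →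
      pairing (T.facet j c) ψ ((v (T.facet j c)).1 ((insert i J).erase j)) = 0 := by
    intro j hj c hne
    refine pairing_eq_zero_of_inside (fun x hx => ?_) _
    by_contra hx0
    have h3 := hs (subset_tsupport ψ hx0)
    have h4 := (hx j).2 (by simp [Cell.facet_dirs])
    rw [Cell.facet_lo_self] at h4
    by_cases hji : j = i
    · subst hji
      have h5 := h3.2
      cases b <;> cases c <;> simp at h4 h5 hne <;> linarith
    · have h5 := h3.1 j (by rw [Cell.facet_dirs]; exact mem_erase.2 ⟨hji, hL hj⟩)
      rw [T.facet_lo_ne b hji, T.facet_hi_ne b hji] at h5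
      cases c <;> simp at h4 <;> linarith
  rw [sum_insert hiJ, sum_insert hiJ, sum_eq_zero (s := J) (f := fun j => insSign j (insert i J) * (_ - _))
    (fun j hj => by
      have hji : j ≠ i := fun h => hiJ (h ▸ hj)
      rw [h2 j (mem_insert_of_mem hj) _ (by simp [hji]),
        h2 j (mem_insert_of_mem hj) _ (by simp [hji])]; simp)] at h1
  simp only [Submodule.coe_zero, Pi.zero_apply, pairing_zero, mul_zero, sum_const_zero,
    add_zero] at h1
  have h3 := (mul_eq_zero.1 h1.symm).resolve_left (insSign_ne_zero _ _)
  have h4 := fun c (hc : (i, c) ≠ (i, b)) => h2 i (mem_insert_self i J) c hc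
  rw [erase_insert hiJ] at h3 h4
  cases b
  · linarith [h4 true (by simp)]
  · linarith [h4 false (by simp)]

end stokes

/-! ### Families of pullbacks -/

/-- `W` gives the exterior derivatives of the trace family `U` on the faces of `T`. -/
def IsD (T : Cell N) {k : ℕ} (U : ∀ F : Cell N, L2Form F k) (W : ∀ F : Cell N, L2Form F (k + 1)) :
    Prop :=
  ∀ F : Cell N, F.IsFace T → StokesFormula F (U F) (W F) U

section families

variable {T : Cell N} {k : ℕ} {U U' : ∀ F : Cell N, L2Form F k}
  {W W' : ∀ F : Cell N, L2Form F (k + 1)}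

theorem isTraceFamily_iff : IsTraceFamily T U ↔ ∃ W, IsD T U W := by
  classical
  constructor
  · intro h
    refine ⟨fun F => if hF : F.IsFace T then (h F hF).choose else 0, fun F hF => ?_⟩
    simp only [hF, dif_pos]
    exact (h F hF).choose_spec
  · rintro ⟨W, hW⟩ F hF
    exact ⟨W F, hW F hF⟩

theorem IsD.isTraceFamily (h : IsD T U W) : IsTraceFamily T U := isTraceFamily_iff.2 ⟨W, h⟩

theorem IsD.face (h : IsD T U W) {F : Cell N} (hF : F.IsFace T) : IsD F U W :=
  fun _ hE => h _ (hE.trans hF)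

theorem IsTraceFamily.face (h : IsTraceFamily T U) {F : Cell N} (hF : F.IsFace T) :
    IsTraceFamily F U :=
  fun _ hE => h _ (hE.trans hF)

theorem IsD.add (h : IsD T U W) (h' : IsD T U' W') : IsD T (U + U') (W + W') :=
  fun F hF => (h F hF).add (h' F hF)

theorem IsD.smul (c : ℝ) (h : IsD T U W) : IsD T (c • U) (c • W) :=
  fun F hF => (h F hF).smul c

theorem isD_zero : IsD T (0 : ∀ F : Cell N, L2Form F k) 0 := fun _ _ => stokesFormula_zero

theorem IsD.neg (h : IsD T U W) : IsD T (-U) (-W) := by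
  have := h.smul (-1)
  rwa [neg_one_smul ℝ U, neg_one_smul ℝ W] at this

theorem IsD.sub (h : IsD T U W) (h' : IsD T U' W') : IsD T (U - U') (W - W') := by
  rw [sub_eq_add_neg, sub_eq_add_neg]
  exact h.add h'.neg

theorem IsTraceFamily.add (h : IsTraceFamily T U) (h' : IsTraceFamily T U') :
    IsTraceFamily T (U + U') := by
  obtain ⟨W, hW⟩ := isTraceFamily_iff.1 h
  obtain ⟨W', hW'⟩ := isTraceFamily_iff.1 h'
  exact (hW.add hW').isTraceFamily

theorem IsTraceFamily.smul (c : ℝ) (h : IsTraceFamily T U) : IsTraceFamily T (c • U) := by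
  obtain ⟨W, hW⟩ := isTraceFamily_iff.1 h
  exact (hW.smul c).isTraceFamily

theorem IsTraceFamily.sub (h : IsTraceFamily T U) (h' : IsTraceFamily T U') :
    IsTraceFamily T (U - U') := by
  obtain ⟨W, hW⟩ := isTraceFamily_iff.1 h
  obtain ⟨W', hW'⟩ := isTraceFamily_iff.1 h'
  exact (hW.sub hW').isTraceFamily

theorem isTraceFamily_zero : IsTraceFamily T (0 : ∀ F : Cell N, L2Form F k) :=
  isD_zero.isTraceFamily

theorem StokesFormula.congr {u : L2Form T k} {w : L2Form T (k + 1)} (h : StokesFormula T u w U)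
    (hU : ∀ i ∈ T.dirs, ∀ b, U (T.facet i b) = U' (T.facet i b)) : StokesFormula T u w U' := by
  rw [stokesFormula_iff] at *
  intro L hL ψ hψ
  rw [h L hL ψ hψ]
  refine sum_congr rfl fun i hi => ?_
  rw [hU i (hL hi), hU i (hL hi)]

theorem IsD.congr (h : IsD T U W) (hU : ∀ F : Cell N, F.IsFace T → U F = U' F)
    (hW : ∀ F : Cell N, F.IsFace T → W F = W' F) : IsD T U' W' := by
  intro F hF
  rw [← hU F hF, ← hW F hF]
  exact (h F hF).congr fun i _ b => hU _ ((F.facet_isFace i b).trans hF)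

theorem IsTraceFamily.congr (h : IsTraceFamily T U)
    (hU : ∀ F : Cell N, F.IsFace T → U F = U' F) : IsTraceFamily T U' := by
  obtain ⟨W, hW⟩ := isTraceFamily_iff.1 h
  exact (hW.congr hU fun _ _ => rfl).isTraceFamily

theorem IsD.isExtDeriv (h : IsD T U W) {F : Cell N} (hF : F.IsFace T) : IsExtDeriv F (U F) (W F) :=
  (h F hF).isExtDeriv

theorem IsD.deriv_eq_of_eq_zero (h : IsD T U W) (hU : U T = 0) : W T = 0 := by
  have h1 := h.isExtDeriv (Cell.IsFace.refl T)
  rw [hU] at h1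
  exact h1.unique stokesFormula_zero.isExtDeriv

/-- Induction on dimension: a zero form has zero derivative, so by `trace_eq_zero` its facet traces
vanish, and every proper face lies in a facet. Applied to differences, this makes traces and their
derivatives functions of the form on `T`. -/
theorem IsD.eq_zero (h : IsD T U W) (hU : U T = 0) {F : Cell N} (hF : F.IsFace T) :
    U F = 0 ∧ W F = 0 := by
  induction hm : T.dim using Nat.strong_induction_on generalizing T with
  | _ m ih =>
    have hW := h.deriv_eq_of_eq_zero hU
    by_cases hFT : F = T
    · rw [hFT]
      exact ⟨hU, hW⟩
    · obtain ⟨i, hi, b, hFi⟩ := Cell.IsProperFace.exists_facet ⟨hF, hFT⟩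
      have h1 := h T (Cell.IsFace.refl T)
      rw [hU, hW] at h1
      exact ih _ (hm ▸ (Cell.facet_isProperFace hi b).dim_lt) (h.face (T.facet_isFace i b))
        (h1.trace_eq_zero hi b) hFi rfl

theorem IsTraceFamily.eq_zero (h : IsTraceFamily T U) (hU : U T = 0) {F : Cell N}
    (hF : F.IsFace T) : U F = 0 := by
  obtain ⟨W, hW⟩ := isTraceFamily_iff.1 h
  exact (hW.eq_zero hU hF).1

theorem IsTraceFamily.unique (h : IsTraceFamily T U) (h' : IsTraceFamily T U') (hU : U T = U' T)
    {F : Cell N} (hF : F.IsFace T) : U F = U' F :=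
  sub_eq_zero.1 ((h.sub h').eq_zero (sub_eq_zero.2 hU) hF)

theorem IsD.unique (h : IsD T U W) (h' : IsD T U' W') (hU : U T = U' T)
    {F : Cell N} (hF : F.IsFace T) : W F = W' F :=
  sub_eq_zero.1 ((h.sub h').eq_zero (sub_eq_zero.2 hU) hF).2

theorem IsD.eq_of_isExtDeriv (h : IsD T U W) {w : L2Form T (k + 1)} (hw : IsExtDeriv T (U T) w) :
    w = W T :=
  hw.unique (h.isExtDeriv (Cell.IsFace.refl T))

end families

/-! ### The exterior derivative commutes with pullbacks -/

/-- For i < j, removing j does not change the position of i, while removing i lowers the position of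
j by one. Every cancellation of the type d ∘ d = 0 below comes from this sign. -/
theorem insSign_mul_insSign {i j : Fin N} {L : Finset (Fin N)} (hij : i ≠ j) (hi : i ∈ L)
    (hj : j ∈ L) :
    insSign i L * insSign j (L.erase i) = -(insSign j L * insSign i (L.erase j)) := by
  wlog hlt : i < j generalizing i j
  · rw [this hij.symm hj hi (lt_of_le_of_ne (not_lt.1 hlt) hij.symm), neg_neg]
  have h1 : {l ∈ L.erase j | l < i} = {l ∈ L | l < i} := by
    ext l
    simp only [mem_filter, mem_erase]
    constructor
    · rintro ⟨⟨-, h⟩, h'⟩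
      exact ⟨h, h'⟩
    · rintro ⟨h, h'⟩
      exact ⟨⟨(h'.trans hlt).ne, h⟩, h'⟩
  have h2 : {l ∈ L | l < j} = insert i {l ∈ L.erase i | l < j} := by
    ext l
    simp only [mem_filter, mem_erase, mem_insert]
    grind
  unfold insSign
  rw [h1, h2, card_insert_of_notMem (by simp)]
  ring

theorem partialDeriv_comm {ψ : (Fin N → ℝ) → ℝ} (hψ : ContDiff ℝ ∞ ψ) (i j : Fin N) :
    partialDeriv i (partialDeriv j ψ) = partialDeriv j (partialDeriv i ψ) := by
  have key : ∀ i j : Fin N, ∀ x, partialDeriv i (partialDeriv j ψ) x =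
      fderiv ℝ (fderiv ℝ ψ) x (Pi.single i 1) (Pi.single j 1) := by
    intro i j x
    have hd : DifferentiableAt ℝ (fderiv ℝ ψ) x :=
      (hψ.fderiv_right (m := ∞) (by simp)).differentiable (by simp) x
    unfold partialDeriv
    rw [fderiv_clm_apply hd (differentiableAt_const _)]
    simp
  funext x
  rw [key, key]
  exact (hψ.contDiffAt.isSymmSndFDerivAt (by
    rw [minSmoothness_of_isRCLikeNormedField]; exact WithTop.coe_le_coe.2 (le_top (a := (2 : ℕ∞))))) _ _

theorem sum_erase_comm {ι : Type*} [DecidableEq ι] (L : Finset ι) (g : ι → ι → ℝ) :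
    ∑ i ∈ L, ∑ j ∈ L.erase i, g i j = ∑ j ∈ L, ∑ i ∈ L.erase j, g i j := by
  refine sum_comm' fun i j => ?_
  simp only [mem_erase]
  tauto

theorem sum_erase_antisymm {ι : Type*} [DecidableEq ι] (L : Finset ι) (g : ι → ι → ℝ)
    (h : ∀ i ∈ L, ∀ j ∈ L, i ≠ j → g i j = - g j i) :
    ∑ i ∈ L, ∑ j ∈ L.erase i, g i j = 0 := by
  have h1 := sum_erase_comm L g
  have h2 : ∑ j ∈ L, ∑ i ∈ L.erase j, g i j = ∑ j ∈ L, ∑ i ∈ L.erase j, - g j i := by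
    refine sum_congr rfl fun j hj => sum_congr rfl fun i hi => ?_
    exact h i (mem_of_mem_erase hi) j hj (ne_of_mem_erase hi)
  simp only [sum_neg_distrib] at h2
  linarith

/-- Stokes is applied on `T` with the tests ∂_i ψ and on each facet with ψ. Terms with second
derivatives cancel by their symmetry, terms on faces of codimension two cancel because each is
reached through two facets with opposite signs, and the remaining facet terms occur in both
expansions and match. -/
theorem IsD.stokesFormula_deriv {T : Cell N} {k : ℕ} {U : ∀ F : Cell N, L2Form F k}
    {W : ∀ F : Cell N, L2Form F (k + 1)} (h : IsD T U W) : StokesFormula T (W T) 0 W := by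
  rw [stokesFormula_iff]
  intro L hL ψ hψ
  have hT := fun i (_ : i ∈ L) => stokesFormula_iff.1 (h T (Cell.IsFace.refl T)) (L.erase i)
    ((erase_subset _ _).trans hL) (partialDeriv i ψ) (contDiff_partialDeriv hψ i)
  have hF := fun j (_ : j ∈ L) (c : Bool) => stokesFormula_iff.1 (h _ (T.facet_isFace j c))
    (L.erase j) (by rw [Cell.facet_dirs]; exact erase_subset_erase _ hL) ψ hψ
  -- `E` collects the facet terms with one derivative on ψ, `D` the terms on `T` with two, and `Q`
  -- the terms on faces of codimension two.
  set E : Fin N → Bool → Fin N → ℝ := fun j c i => pairing (T.facet j c) (partialDeriv i ψ)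
    ((U (T.facet j c)).1 ((L.erase j).erase i)) with hE
  set D : Fin N → Fin N → ℝ := fun i j => pairing T (partialDeriv j (partialDeriv i ψ))
    ((U T).1 ((L.erase i).erase j)) with hD
  set Q : Fin N → Bool → Fin N → Bool → ℝ := fun j c i b => pairing ((T.facet j c).facet i b) ψ
    ((U ((T.facet j c).facet i b)).1 ((L.erase j).erase i)) with hQ
  have hDs : ∀ i j, D i j = D j i := by
    intro i j
    simp only [hD]
    rw [partialDeriv_comm hψ, erase_right_comm]
  have hQs : ∀ j c i b, j ≠ i → Q j c i b = Q i b j c := by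
    intro j c i b hij
    simp only [hQ]
    rw [Cell.facet_comm T hij, erase_right_comm]
  have hTE : ∀ i ∈ L, pairing T (partialDeriv i ψ) ((W T).1 (L.erase i)) =
      ∑ j ∈ L.erase i, insSign j (L.erase i) * (E j true i - E j false i - D i j) := by
    intro i hi
    have h1 := hT i hi
    simp only [mul_sub, sum_sub_distrib] at h1 ⊢
    simp only [hE, hD, erase_right_comm (s := L) (b := i)] at h1 ⊢
    linarith
  have hFE : ∀ j ∈ L, ∀ c, pairing (T.facet j c) ψ ((W (T.facet j c)).1 (L.erase j)) =
      ∑ i ∈ L.erase j, insSign i (L.erase j) * (Q j c i true - Q j c i false - E j c i) := by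
    intro i hi c
    have h1 := hF i hi c
    simp only [mul_sub, sum_sub_distrib] at h1 ⊢
    simp only [hE, hQ] at h1 ⊢
    linarith
  have e1 := sum_congr rfl fun i hi => congrArg (insSign i L * ·) (hTE i hi)
  have e2 := sum_congr rfl fun j hj => congrArg₂ (fun a b => insSign j L * (a - b))
    (hFE j hj true) (hFE j hj false)
  rw [e1, e2]
  simp only [Submodule.coe_zero, Pi.zero_apply, pairing_zero, zero_add, mul_sum]
  have z1 := sum_erase_antisymm L (fun i j => insSign i L * (insSign j (L.erase i) * D i j))
    fun i hi j hj hij => by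
      rw [← mul_assoc, insSign_mul_insSign hij hi hj, hDs]; ring
  have z2 := sum_erase_antisymm L (fun j i => insSign j L * (insSign i (L.erase j) *
      (Q j true i true - Q j true i false - Q j false i true + Q j false i false)))
    fun j hj i hi hij => by
      rw [← mul_assoc, insSign_mul_insSign hij hj hi, hQs j _ i _ hij, hQs j _ i _ hij,
        hQs j _ i _ hij, hQs j _ i _ hij]
      ring
  have z3 := sum_erase_comm L
    (fun i j => insSign i L * (insSign j (L.erase i) * (E j true i - E j false i)))
  have z4 : ∑ j ∈ L, ∑ i ∈ L.erase j,
      insSign i L * (insSign j (L.erase i) * (E j true i - E j false i)) =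
      ∑ j ∈ L, ∑ i ∈ L.erase j,
      -(insSign j L * (insSign i (L.erase j) * (E j true i - E j false i))) := by
    refine sum_congr rfl fun j hj => sum_congr rfl fun i hi => ?_
    rw [← mul_assoc, insSign_mul_insSign (ne_of_mem_erase hi) (mem_of_mem_erase hi) hj]
    ring
  rw [z4] at z3
  simp only [mul_sub, mul_add, mul_sum, sum_sub_distrib, sum_add_distrib,
    sum_neg_distrib] at z1 z2 z3 ⊢
  linarith

theorem IsD.deriv {T : Cell N} {k : ℕ} {U : ∀ F : Cell N, L2Form F k}
    {W : ∀ F : Cell N, L2Form F (k + 1)} (h : IsD T U W) : IsD T W 0 :=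
  fun _ hF => (h.face hF).stokesFormula_deriv

/-- The derivatives on the faces are themselves a trace family, so if the one on `T` vanishes, all
do. -/
theorem IsTraceFamily.isD_zero_of_isExtDeriv {T : Cell N} {k : ℕ} {U : ∀ F : Cell N, L2Form F k}
    (h : IsTraceFamily T U) (hw : IsExtDeriv T (U T) 0) : IsD T U 0 := by
  obtain ⟨W, hW⟩ := isTraceFamily_iff.1 h
  have h0 := hW.eq_of_isExtDeriv hw
  exact hW.congr (fun _ _ => rfl) fun F hF => (hW.deriv.eq_zero h0.symm hF).1

/-! ### Polynomial forms -/

theorem contDiff_eval (p : MvPolynomial (Fin N) ℝ) :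
    ContDiff ℝ ∞ fun x => MvPolynomial.eval x p := by
  induction p using MvPolynomial.induction_on with
  | C a => simpa using contDiff_const
  | add p q hp hq => simpa using hp.add hq
  | mul_X p i hp => simpa using hp.mul (contDiff_apply ℝ ℝ i)

theorem partialDeriv_mul {f g : (Fin N → ℝ) → ℝ} (hf : ContDiff ℝ ∞ f) (hg : ContDiff ℝ ∞ g)
    (i : Fin N) (x : Fin N → ℝ) :
    partialDeriv i (fun y => f y * g y) x = partialDeriv i f x * g x + f x * partialDeriv i g x := by
  unfold partialDeriv
  rw [fderiv_fun_mul (hf.differentiable (by simp) x) (hg.differentiable (by simp) x)]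
  simp
  ring

theorem partialDeriv_eval (p : MvPolynomial (Fin N) ℝ) (i : Fin N) (x : Fin N → ℝ) :
    partialDeriv i (fun y => MvPolynomial.eval y p) x =
      MvPolynomial.eval x (MvPolynomial.pderiv i p) := by
  induction p using MvPolynomial.induction_on with
  | C a => simp [partialDeriv]
  | add p q hp hq =>
    rw [map_add, map_add, ← hp, ← hq]
    simp only [map_add]
    unfold partialDeriv
    rw [fderiv_fun_add ((contDiff_eval p).differentiable (by simp) x)
      ((contDiff_eval q).differentiable (by simp) x)]
    rfl
  | mul_X p j hp =>
    rw [Derivation.leibniz, map_add, smul_eq_mul, smul_eq_mul, map_mul, map_mul, ← hp]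
    simp only [map_mul, MvPolynomial.eval_X]
    rw [partialDeriv_mul (contDiff_eval p) (contDiff_apply ℝ ℝ j)]
    have : partialDeriv i (fun y : Fin N → ℝ => y j) x =
        MvPolynomial.eval x (MvPolynomial.pderiv i (MvPolynomial.X j)) := by
      unfold partialDeriv
      have h1 : fderiv ℝ (fun y : Fin N → ℝ => y j) x =
        ContinuousLinearMap.proj (R := ℝ) (φ := fun _ : Fin N => ℝ) j :=
        (ContinuousLinearMap.proj (R := ℝ) (φ := fun _ : Fin N => ℝ) j).hasFDerivAt.fderiv
      rw [h1, MvPolynomial.pderiv_X]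
      by_cases h : i = j
      · subst h; simp
      · simp [Ne.symm h]
    rw [this]
    ring

/-- A polynomial as a square integrable function on a cell. -/
def polyLp (T : Cell N) : MvPolynomial (Fin N) ℝ →ₗ[ℝ] Lp ℝ 2 T.measure where
  toFun p := (T.memLp_of_continuous (contDiff_eval p).continuous).toLp
  map_add' p q := by
    rw [← MemLp.toLp_add]
    congr 1
    funext x
    simp
  map_smul' c p := by
    rw [RingHom.id_apply, ← MemLp.toLp_const_smul]
    congr 1
    funext x
    simp

theorem coeFn_polyLp (T : Cell N) (p : MvPolynomial (Fin N) ℝ) :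
    polyLp T p =ᵐ[T.measure] fun x => MvPolynomial.eval x p :=
  MemLp.coeFn_toLp (T.memLp_of_continuous (contDiff_eval p).continuous)

theorem polyLp_eq_zero_iff {T : Cell N} {p : MvPolynomial (Fin N) ℝ} :
    polyLp T p = 0 ↔ ∀ x ∈ T.box, MvPolynomial.eval x p = 0 := by
  rw [Lp.eq_zero_iff_ae_eq_zero]
  constructor
  · intro h x hx
    exact T.eq_zero_of_ae (contDiff_eval p).continuous ((coeFn_polyLp T p).symm.trans h) hx
  · intro h
    filter_upwards [coeFn_polyLp T p, T.ae_box] with x hx hx'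
    rw [hx]
    exact h x hx'

/-- The `k`-form on `T` with given polynomial coefficients. -/
def polyForm (T : Cell N) (k : ℕ) :
    (Finset (Fin N) → MvPolynomial (Fin N) ℝ) →ₗ[ℝ] L2Form T k where
  toFun p := ⟨fun J => if J ⊆ T.dirs ∧ #J = k then polyLp T (p J) else 0, fun J hJ => if_neg hJ⟩
  map_add' p q := by
    refine Subtype.ext (funext fun J => ?_)
    by_cases h : J ⊆ T.dirs ∧ #J = k <;> simp [h]
  map_smul' c p := by
    refine Subtype.ext (funext fun J => ?_)
    by_cases h : J ⊆ T.dirs ∧ #J = k <;> simp [h]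

theorem polyForm_apply {T : Cell N} {k : ℕ} (p : Finset (Fin N) → MvPolynomial (Fin N) ℝ)
    {J : Finset (Fin N)} (hJ : J ⊆ T.dirs) (hk : #J = k) :
    (polyForm T k p).1 J = polyLp T (p J) :=
  if_pos ⟨hJ, hk⟩

theorem polyForm_apply_of_card_ne {T : Cell N} {k : ℕ}
    (p : Finset (Fin N) → MvPolynomial (Fin N) ℝ) {J : Finset (Fin N)} (hk : #J ≠ k) :
    (polyForm T k p).1 J = 0 :=
  if_neg fun h => hk h.2

/-- The exterior derivative on polynomial coefficients. -/
def polyD (p : Finset (Fin N) → MvPolynomial (Fin N) ℝ) (L : Finset (Fin N)) :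
    MvPolynomial (Fin N) ℝ :=
  ∑ i ∈ L, insSign i L • MvPolynomial.pderiv i (p (L.erase i))

theorem pairing_polyLp {T : Cell N} (ψ : (Fin N → ℝ) → ℝ) (p : MvPolynomial (Fin N) ℝ) :
    pairing T ψ (polyLp T p) = ∫ x, MvPolynomial.eval x p * ψ x ∂T.measure :=
  pairing_of_ae (coeFn_polyLp T p)

theorem pairing_sum {T : Cell N} {ψ : (Fin N → ℝ) → ℝ} (hψ : Continuous ψ) {ι : Type*}
    (s : Finset ι) (c : ι → ℝ) (f : ι → Lp ℝ 2 T.measure) :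
    pairing T ψ (∑ i ∈ s, c i • f i) = ∑ i ∈ s, c i * pairing T ψ (f i) := by
  classical
  induction s using Finset.induction_on with
  | empty => simp [pairing_zero]
  | insert a s ha ih => rw [sum_insert ha, sum_insert ha, pairing_add hψ, pairing_smul, ih]

/-- The same coefficients serve on all faces, since pullback only discards the terms with a dx_i in
a direction that is no longer free. Stokes is then the divergence theorem for each product of a
coefficient with ψ. -/
theorem isD_polyForm (T : Cell N) (k : ℕ) (p : Finset (Fin N) → MvPolynomial (Fin N) ℝ) :
    IsD T (fun F => polyForm F k p) fun F => polyForm F (k + 1) (polyD p) := by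
  intro F _
  rw [stokesFormula_iff]
  intro L hL ψ hψ
  by_cases hk : #L = k + 1
  · have hc : ∀ i ∈ L, #(L.erase i) = k := fun i hi => by rw [card_erase_of_mem hi, hk]; simp
    rw [polyForm_apply _ hL hk]
    simp only [polyD, map_sum, map_smul]
    rw [pairing_sum hψ.continuous, ← sum_add_distrib]
    refine sum_congr rfl fun i hi => ?_
    have hs : ∀ b, L.erase i ⊆ (F.facet i b).dirs := fun b => by
      rw [Cell.facet_dirs]; exact erase_subset_erase _ hL
    rw [polyForm_apply _ ((erase_subset _ _).trans hL) (hc i hi), polyForm_apply _ (hs _) (hc i hi),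
      polyForm_apply _ (hs _) (hc i hi), ← mul_add]
    congr 1
    simp only [pairing_polyLp]
    rw [← Cell.integral_partialDeriv (hL hi) ((contDiff_eval (p (L.erase i))).mul hψ),
      ← integral_add]
    · refine integral_congr_ae (Filter.Eventually.of_forall fun x => ?_)
      simp only
      rw [partialDeriv_mul (contDiff_eval _) hψ, partialDeriv_eval]
    · exact F.integrable_of_continuous ((contDiff_eval _).continuous.mul hψ.continuous)
    · exact F.integrable_of_continuous
        ((contDiff_eval _).continuous.mul (continuous_partialDeriv hψ i))
  · have hc : ∀ i ∈ L, #(L.erase i) ≠ k := fun i hi => by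
      rw [card_erase_of_mem hi]
      have := card_pos.2 ⟨i, hi⟩
      omega
    rw [polyForm_apply_of_card_ne _ hk, pairing_zero, zero_add]
    refine sum_congr rfl fun i hi => ?_
    rw [polyForm_apply_of_card_ne _ (hc i hi), polyForm_apply_of_card_ne _ (hc i hi),
      polyForm_apply_of_card_ne _ (hc i hi), pairing_zero, pairing_zero, pairing_zero, sub_zero]

/-- The polynomials of degree at most `s`, which are zero for `s < 0`. -/
def degLE (N : ℕ) (s : ℤ) : Submodule ℝ (MvPolynomial (Fin N) ℝ) where
  carrier := {p | ∀ d ∈ p.support, (d.degree : ℤ) ≤ s}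
  add_mem' := by
    classical
    intro p q hp hq d hd
    rcases Finset.mem_union.1 (MvPolynomial.support_add hd) with h | h
    · exact hp d h
    · exact hq d h
  zero_mem' := by simp
  smul_mem' := fun c p hp d hd => hp d (MvPolynomial.support_smul hd)

theorem mem_polyForms_iff {T : Cell N} {s : ℤ} {k : ℕ} {u : L2Form T k} :
    u ∈ polyForms T s k ↔ ∃ p, (∀ J, p J ∈ degLE N s) ∧ polyForm T k p = u := by
  constructor
  · intro h
    choose p hp hu using h
    refine ⟨p, hp, L2Form.ext fun J hJ hk => ?_⟩
    rw [polyForm_apply _ hJ hk]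
    exact Lp.ext ((coeFn_polyLp T _).trans (hu J).symm)
  · rintro ⟨p, hp, rfl⟩ J
    by_cases hJ : J ⊆ T.dirs ∧ #J = k
    · exact ⟨p J, hp J, by rw [polyForm_apply _ hJ.1 hJ.2]; exact coeFn_polyLp T _⟩
    · refine ⟨0, by simp, ?_⟩
      have : (polyForm T k p).1 J = 0 := if_neg hJ
      rw [this]
      filter_upwards [Lp.coeFn_zero ℝ 2 T.measure] with x hx
      simpa using hx

theorem degLE_mono {s t : ℤ} (h : s ≤ t) : degLE N s ≤ degLE N t :=
  fun _ hp d hd => (hp d hd).trans h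

theorem polyForms_mono (T : Cell N) {s t : ℤ} (h : s ≤ t) (k : ℕ) :
    polyForms T s k ≤ polyForms T t k := by
  intro u hu
  obtain ⟨p, hp, rfl⟩ := mem_polyForms_iff.1 hu
  exact mem_polyForms_iff.2 ⟨p, fun J => degLE_mono h (hp J), rfl⟩

theorem monomial_mem_degLE {s : ℤ} {d : Fin N →₀ ℕ} (h : (d.degree : ℤ) ≤ s) (c : ℝ) :
    MvPolynomial.monomial d c ∈ degLE N s := by
  intro e he
  have := MvPolynomial.support_monomial_subset he
  rw [mem_singleton] at this
  rwa [this]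

/-- A linear map that raises the degrees of monomials by at most `t` does so for all
polynomials. -/
theorem map_mem_degLE {s t : ℤ} (f : MvPolynomial (Fin N) ℝ →ₗ[ℝ] MvPolynomial (Fin N) ℝ)
    (hf : ∀ d c, f (MvPolynomial.monomial d c) ∈ degLE N (d.degree + t))
    {p : MvPolynomial (Fin N) ℝ} (hp : p ∈ degLE N s) : f p ∈ degLE N (s + t) := by
  rw [p.as_sum, map_sum]
  refine Submodule.sum_mem _ fun d hd => degLE_mono ?_ (hf d _)
  have := hp d hd
  linarith

theorem pderiv_mem_degLE {s : ℤ} {p : MvPolynomial (Fin N) ℝ} (hp : p ∈ degLE N s) (i : Fin N) :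
    MvPolynomial.pderiv i p ∈ degLE N (s - 1) := by
  refine map_mem_degLE (t := -1) (MvPolynomial.pderiv i).toLinearMap (fun d c => ?_) hp
  rw [Derivation.coeFn_coe, MvPolynomial.pderiv_monomial]
  by_cases h : d i = 0
  · simp [h]
  · refine monomial_mem_degLE ?_ _
    have h1 : d - Finsupp.single i 1 + Finsupp.single i 1 = d :=
      tsub_add_cancel_of_le (by simpa [Finsupp.single_le_iff] using Nat.one_le_iff_ne_zero.2 h)
    have h2 := congrArg Finsupp.degree h1
    rw [map_add, Finsupp.degree_single] at h2
    omega

theorem polyD_mem_degLE {s : ℤ} {p : Finset (Fin N) → MvPolynomial (Fin N) ℝ}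
    (hp : ∀ J, p J ∈ degLE N s) (L : Finset (Fin N)) : polyD p L ∈ degLE N (s - 1) :=
  Submodule.sum_mem _ fun i _ => Submodule.smul_mem _ _ (pderiv_mem_degLE (hp _) i)

/-- Pullbacks and exterior derivatives of polynomial forms. -/
theorem exists_family_of_mem_polyForms {T : Cell N} {s : ℤ} {k : ℕ} {u : L2Form T k}
    (hu : u ∈ polyForms T s k) : ∃ U W, IsD T U W ∧ U T = u ∧
      ∀ F, U F ∈ polyForms F s k ∧ W F ∈ polyForms F (s - 1) (k + 1) := by
  obtain ⟨p, hp, rfl⟩ := mem_polyForms_iff.1 hu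
  exact ⟨_, _, isD_polyForm T k p, rfl, fun F => ⟨mem_polyForms_iff.2 ⟨p, hp, rfl⟩,
    mem_polyForms_iff.2 ⟨_, polyD_mem_degLE hp, rfl⟩⟩⟩

namespace FES

variable {C : CubicalComplex N} {A : FES C} {T : Cell N} {k : ℕ}

/-! ### Degrees of freedom and extensions -/

theorem exists_family (A : FES C) (hT : T ∈ C.cells) {u : L2Form T k} (hu : u ∈ A.space T k) :
    ∃ U, IsTraceFamily T U ∧ U T = u :=
  A.subset_fullSpace T hT k u hu

theorem deriv_mem (A : FES C) (hT : T ∈ C.cells) {U : ∀ F : Cell N, L2Form F k}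
    {W : ∀ F : Cell N, L2Form F (k + 1)} (h : IsD T U W) (hU : U T ∈ A.space T k) :
    W T ∈ A.space T (k + 1) :=
  A.extDeriv_mem T hT k _ hU _ (h.isExtDeriv (Cell.IsFace.refl T))

theorem face_mem (A : FES C) (hT : T ∈ C.cells) {U : ∀ F : Cell N, L2Form F k}
    (h : IsTraceFamily T U) (hU : U T ∈ A.space T k) {F : Cell N} (hF : F.IsFace T) :
    U F ∈ A.space F k :=
  A.pullback_mem T hT k U h hU F hF

/-- The subspace `A^k_0(T)`. -/
def zeroSubmodule (A : FES C) (T : Cell N) (k : ℕ) : Submodule ℝ (L2Form T k) where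
  carrier := A.zeroSpace T k
  add_mem' := by
    rintro _ _ ⟨ha, U, hU, rfl, hU0⟩ ⟨hb, V, hV, rfl, hV0⟩
    refine ⟨add_mem ha hb, U + V, hU.add hV, rfl, fun F hF => ?_⟩
    rw [Pi.add_apply, hU0 F hF, hV0 F hF, add_zero]
  zero_mem' := ⟨zero_mem _, 0, isTraceFamily_zero, rfl, fun _ _ => rfl⟩
  smul_mem' := by
    rintro c _ ⟨ha, U, hU, rfl, hU0⟩
    refine ⟨Submodule.smul_mem _ _ ha, c • U, hU.smul c, rfl, fun F hF => ?_⟩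
    rw [Pi.smul_apply, hU0 F hF, smul_zero]

theorem mem_zeroSubmodule {u : L2Form T k} :
    u ∈ A.zeroSubmodule T k ↔ u ∈ A.space T k ∧ IsTraceFree T u :=
  Iff.rfl

/-- By induction on dimension the form vanishes on proper faces, hence lies in A^k_0(T), where
injectivity applies. Extensions are not needed for this half. -/
theorem eq_zero_of_dofs {W : Cell N → Type*} [∀ F, AddCommGroup (W F)] [∀ F, Module ℝ (W F)]
    (φ : ∀ F : Cell N, L2Form F k →ₗ[ℝ] W F)
    (hφ : ∀ F ∈ C.cells, ∀ u ∈ A.zeroSubmodule F k, φ F u = 0 → u = 0)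
    (hT : T ∈ C.cells) {U : ∀ F : Cell N, L2Form F k} (hU : IsTraceFamily T U)
    (hUT : U T ∈ A.space T k) (h0 : ∀ F : Cell N, F.IsFace T → φ F (U F) = 0) : U T = 0 := by
  induction hm : T.dim using Nat.strong_induction_on generalizing T with
  | _ m ih =>
    refine hφ T hT _ ⟨hUT, U, hU, rfl, fun F hF => ?_⟩ (h0 T (Cell.IsFace.refl T))
    exact ih _ (hm ▸ hF.dim_lt) (C.face_mem hT hF.1) (hU.face hF.1) (A.face_mem hT hU hUT hF.1)
      (fun E hE => h0 E (hE.trans hF.1)) rfl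

/-- Solve on the proper faces by induction, glue, extend to `T`, and correct the value on `T` by a
trace-free form, which leaves the faces alone. The hypothesis `hw` asks for exactly this correction.
-/
theorem exists_of_dofs (hA : A.AdmitsExtensions) {W : Cell N → Type*} [∀ F, AddCommGroup (W F)]
    [∀ F, Module ℝ (W F)] (φ : ∀ F : Cell N, L2Form F k →ₗ[ℝ] W F) (w : ∀ F, W F)
    (hφ : ∀ F ∈ C.cells, ∀ u ∈ A.zeroSubmodule F k, φ F u = 0 → u = 0)
    (hw : ∀ F ∈ C.cells, ∀ u : L2Form F k, ∃ a ∈ A.zeroSubmodule F k, φ F a = w F - φ F u)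
    (hT : T ∈ C.cells) : ∃ U, IsTraceFamily T U ∧ U T ∈ A.space T k ∧
      ∀ F : Cell N, F.IsFace T → φ F (U F) = w F := by
  classical
  induction hm : T.dim using Nat.strong_induction_on generalizing T with
  | _ m ih =>
    have hp : ∀ F : Cell N, F.IsProperFace T → ∃ U, IsTraceFamily F U ∧ U F ∈ A.space F k ∧
        ∀ E : Cell N, E.IsFace F → φ E (U E) = w E :=
      fun F hF => ih _ (hm ▸ hF.dim_lt) (C.face_mem hT hF.1) rfl
    choose V hV1 hV2 hV3 using hp
    set X : ∀ F : Cell N, L2Form F k := fun F => if hF : F.IsProperFace T then V F hF F else 0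
      with hX
    have hprop : ∀ {E F : Cell N}, F.IsProperFace T → E.IsFace F → E.IsProperFace T := by
      intro E F hF hE
      refine ⟨hE.trans hF.1, ?_⟩
      rintro rfl
      exact absurd (hE.dim_le.trans_lt hF.dim_lt) (lt_irrefl _)
    -- The solutions on different faces were chosen independently; on common faces they have the
    -- same degrees of freedom, so they agree by `eq_zero_of_dofs`.
    have key : ∀ F (hF : F.IsProperFace T), ∀ E : Cell N, E.IsFace F → V F hF E = X E := by
      intro F hF E hE
      have hE' := hprop hF hE
      simp only [hX, hE', dif_pos]
      have hEC := C.face_mem hT hE'.1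
      rw [← sub_eq_zero, ← Pi.sub_apply]
      refine eq_zero_of_dofs (A := A) φ hφ hEC (((hV1 F hF).face hE).sub (hV1 E hE'))
        (sub_mem (A.face_mem (C.face_mem hT hF.1) (hV1 F hF) (hV2 F hF) hE) (hV2 E hE')) ?_
      intro G hG
      rw [Pi.sub_apply, map_sub, hV3 F hF G (hG.trans hE), hV3 E hE' G hG, sub_self]
    obtain ⟨Y, hY1, hY2, hY3⟩ := hA T hT k X fun F hF => by
      refine ⟨?_, (hV1 F hF).congr (key F hF)⟩
      rw [← key F hF F (Cell.IsFace.refl F)]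
      exact hV2 F hF
    obtain ⟨a, ⟨ha, Z, hZ1, rfl, hZ2⟩, haw⟩ := hw T hT (Y T)
    refine ⟨Y + Z, hY1.add hZ1, add_mem hY2 ha, fun F hF => ?_⟩
    by_cases hFT : F = T
    · subst hFT
      rw [Pi.add_apply, map_add, haw, add_sub_cancel]
    · have hF' : F.IsProperFace T := ⟨hF, hFT⟩
      rw [Pi.add_apply, hZ2 F hF', add_zero, hY3 F hF', ← key F hF' F (Cell.IsFace.refl F)]
      exact hV3 F hF' F (Cell.IsFace.refl F)

/-- Any linear left inverse of the inclusion of A^k_0(F) is a legitimate degree of freedom, which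
makes the two preceding results available for every system. -/
theorem exists_zeroProj (A : FES C) (F : Cell N) (k : ℕ) :
    ∃ φ : L2Form F k →ₗ[ℝ] A.zeroSubmodule F k,
      φ ∘ₗ (A.zeroSubmodule F k).subtype = LinearMap.id :=
  LinearMap.exists_leftInverse_of_injective _ (Submodule.ker_subtype _)

/-- A projection onto `A^k_0(F)`. -/
def zeroProj (A : FES C) (F : Cell N) (k : ℕ) : L2Form F k →ₗ[ℝ] A.zeroSubmodule F k :=
  (A.exists_zeroProj F k).choose

theorem zeroProj_coe (F : Cell N) (a : A.zeroSubmodule F k) : A.zeroProj F k a = a :=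
  LinearMap.congr_fun (A.exists_zeroProj F k).choose_spec a

theorem eq_zero_of_zeroProj_self {F : Cell N} {u : L2Form F k} (hu : u ∈ A.zeroSubmodule F k)
    (h0 : A.zeroProj F k u = 0) : u = 0 := by
  have := zeroProj_coe F ⟨u, hu⟩
  rw [h0] at this
  exact congrArg Subtype.val this.symm

theorem eq_zero_of_zeroProj (hT : T ∈ C.cells) {U : ∀ F : Cell N, L2Form F k}
    (hU : IsTraceFamily T U) (hUT : U T ∈ A.space T k)
    (h0 : ∀ F : Cell N, F.IsFace T → A.zeroProj F k (U F) = 0) : U T = 0 :=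
  eq_zero_of_dofs (W := fun F => A.zeroSubmodule F k) (fun F => A.zeroProj F k)
    (fun _ _ _ hu h0 => eq_zero_of_zeroProj_self hu h0) hT hU hUT h0

theorem eq_of_zeroProj (hT : T ∈ C.cells) {U V : ∀ F : Cell N, L2Form F k}
    (hU : IsTraceFamily T U) (hV : IsTraceFamily T V) (hUT : U T ∈ A.space T k)
    (hVT : V T ∈ A.space T k)
    (h : ∀ F : Cell N, F.IsFace T → A.zeroProj F k (U F) = A.zeroProj F k (V F)) : U T = V T := by
  rw [← sub_eq_zero]
  refine eq_zero_of_zeroProj hT (hU.sub hV) (sub_mem hUT hVT) fun F hF => ?_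
  rw [Pi.sub_apply, map_sub, h F hF, sub_self]

theorem exists_of_zeroProj (hA : A.AdmitsExtensions) (hT : T ∈ C.cells)
    (w : ∀ F : Cell N, A.zeroSubmodule F k) : ∃ U, IsTraceFamily T U ∧ U T ∈ A.space T k ∧
      ∀ F : Cell N, F.IsFace T → A.zeroProj F k (U F) = w F :=
  exists_of_dofs hA (W := fun F => A.zeroSubmodule F k) (fun F => A.zeroProj F k) w
    (fun _ _ _ hu h0 => eq_zero_of_zeroProj_self hu h0)
    (fun F _ u => ⟨_, Subtype.mem (w F - A.zeroProj F k u), zeroProj_coe F _⟩) hT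

/-- Extension from a subcomplex of the complex of faces of `T`. -/
theorem exists_extension (hA : A.AdmitsExtensions) (hT : T ∈ C.cells) (K : Set (Cell N))
    (hK : ∀ F ∈ K, ∀ E : Cell N, E.IsFace F → E ∈ K) (U : ∀ F : Cell N, L2Form F k)
    (hU : ∀ F ∈ K, F.IsFace T → IsTraceFamily F U ∧ U F ∈ A.space F k) :
    ∃ V, IsTraceFamily T V ∧ V T ∈ A.space T k ∧ ∀ F ∈ K, F.IsFace T → V F = U F := by
  classical
  -- The projections of `U` are prescribed on `K` and zero elsewhere. As `K` is closed under faces,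
  -- they determine the form on each member of `K`.
  obtain ⟨V, hV1, hV2, hV3⟩ := exists_of_zeroProj hA hT
    (fun F => if F ∈ K then A.zeroProj F k (U F) else 0)
  refine ⟨V, hV1, hV2, fun F hFK hFT => ?_⟩
  refine eq_of_zeroProj (A := A) (C.face_mem hT hFT) (hV1.face hFT) (hU F hFK hFT).1
    (A.face_mem hT hV1 hV2 hFT) (hU F hFK hFT).2 fun E hE => ?_
  rw [hV3 E (hE.trans hFT), if_pos (hK F hFK E hE)]

/-- Comparison of dimensions for two systems with ordered spaces `A^k_0(F)`. -/
theorem finrank_le_of_zeroSubmodule_le {B : FES C} (hB : B.AdmitsExtensions)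
    (h : ∀ F ∈ C.cells, A.zeroSubmodule F k ≤ B.zeroSubmodule F k) (hT : T ∈ C.cells) :
    Module.finrank ℝ (A.space T k) ≤ Module.finrank ℝ (B.space T k) := by
  classical
  -- The injection from A to B transports the projections of `u` on each face through A^k_0(F) ⊆
  -- B^k_0(F). It is obtained by choice, and its linearity follows from the uniqueness statement
  -- `huniq`.
  have hex : ∀ u : A.space T k, ∃ v : B.space T k, ∃ U V : ∀ F : Cell N, L2Form F k,
      IsTraceFamily T U ∧ IsTraceFamily T V ∧ U T = u ∧ V T = v ∧
      ∀ F : Cell N, F.IsFace T → (B.zeroProj F k (V F) : L2Form F k) = A.zeroProj F k (U F) := by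
    rintro ⟨u, hu⟩
    obtain ⟨U, hU, rfl⟩ := A.exists_family hT hu
    obtain ⟨V, hV1, hV2, hV3⟩ := exists_of_zeroProj hB hT
      (fun F => if hF : F ∈ C.cells then ⟨(A.zeroProj F k (U F) : L2Form F k), h F hF (Subtype.mem _)⟩ else 0)
    refine ⟨⟨V T, hV2⟩, U, V, hU, hV1, rfl, rfl, fun F hF => ?_⟩
    rw [hV3 F hF, dif_pos (C.face_mem hT hF)]
  choose f U V hU hV hUT hVT hUV using hex
  have huniq : ∀ {v v' : B.space T k} {Z Z' : ∀ F : Cell N, L2Form F k},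
      IsTraceFamily T Z → IsTraceFamily T Z' → Z T = v → Z' T = v' →
      (∀ F : Cell N, F.IsFace T → (B.zeroProj F k (Z F) : L2Form F k) = B.zeroProj F k (Z' F)) →
      v = v' := by
    intro v v' Z Z' hZ hZ' hv hv' h1
    refine Subtype.ext ?_
    rw [← hv, ← hv']
    exact eq_of_zeroProj hT hZ hZ' (hv ▸ v.2) (hv' ▸ v'.2) fun F hF => Subtype.ext (h1 F hF)
  have hadd : ∀ a b, f (a + b) = f a + f b := by
    intro a b
    refine huniq (hV (a + b)) ((hV a).add (hV b)) (hVT _)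
      (by rw [Pi.add_apply, hVT, hVT]; rfl) fun F hF => ?_
    have := ((hU a).add (hU b)).unique (hU (a + b)) (by rw [Pi.add_apply, hUT, hUT, hUT]; rfl) hF
    rw [hUV _ F hF, ← this, Pi.add_apply, Pi.add_apply, map_add, map_add, Submodule.coe_add,
      Submodule.coe_add, hUV a F hF, hUV b F hF]
  have hsmul : ∀ (c : ℝ) a, f (c • a) = c • f a := by
    intro c a
    refine huniq (hV (c • a)) ((hV a).smul c) (hVT _)
      (by rw [Pi.smul_apply, hVT]; rfl) fun F hF => ?_
    have := ((hU a).smul c).unique (hU (c • a)) (by rw [Pi.smul_apply, hUT, hUT]; rfl) hF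
    rw [hUV _ F hF, ← this, Pi.smul_apply, Pi.smul_apply, map_smul, map_smul, Submodule.coe_smul,
      Submodule.coe_smul, hUV a F hF]
  have hzero : ∀ a, f a = 0 → a = 0 := by
    intro a ha
    have hVa : V a T = 0 := by
      rw [hVT]
      exact congrArg Subtype.val ha
    refine Subtype.ext ?_
    rw [← hUT a]
    refine eq_zero_of_zeroProj hT (hU a) (by rw [hUT]; exact a.2) fun F hF => ?_
    refine Subtype.ext ?_
    rw [← hUV a F hF, (hV a).eq_zero hVa hF, map_zero]
    rfl
  let g : A.space T k →ₗ[ℝ] B.space T k := { toFun := f, map_add' := hadd, map_smul' := hsmul }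
  have := B.finiteDimensional T hT k
  refine LinearMap.finrank_le_finrank_of_injective (f := g) fun a b (hab : f a = f b) => ?_
  have h1 : a + (-1 : ℝ) • b = 0 := by
    refine hzero _ ?_
    rw [hadd, hsmul, hab]
    module
  rw [← sub_eq_zero, ← h1]
  module

end FES

/-! ### Intersections of facets, and the integral of forms of top degree -/

theorem Cell.not_isFace_opposite {E T : Cell N} {i : Fin N} (hi : i ∈ T.dirs) {b c : Bool}
    (hbc : b ≠ c) (h : E.IsFace (T.facet i b)) (h' : E.IsFace (T.facet i c)) : False := by
  have h1 := h i
  have h2 := h' i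
  simp only [Cell.facet_lo_self, Cell.facet_hi_self] at h1 h2
  have hlt := Cell.mem_dirs.1 hi
  cases b <;> cases c <;> simp at h1 h2 hbc <;> grind

theorem Cell.IsFace.facet_facet {E T : Cell N} {i j : Fin N} (hij : i ≠ j) {b c : Bool}
    (h : E.IsFace (T.facet i b)) (h' : E.IsFace (T.facet j c)) :
    E.IsFace ((T.facet i b).facet j c) := by
  intro l
  by_cases hl : l = j
  · subst hl
    have h2 := h' l
    simp only [Cell.facet_lo_self, Cell.facet_hi_self] at h2 ⊢
    rw [Cell.facet_lo_ne _ _ hij.symm, Cell.facet_hi_ne _ _ hij.symm]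
    exact h2
  · have h1 := h l
    rwa [Cell.facet_lo_ne _ _ hl, Cell.facet_hi_ne _ _ hl]

/-- The integral of a form of top degree; it is zero for the other forms. -/
def topInt (T : Cell N) {k : ℕ} (u : L2Form T k) : ℝ := pairing T (fun _ => 1) (u.1 T.dirs)

theorem topInt_sub {T : Cell N} {k : ℕ} (u v : L2Form T k) :
    topInt T (u - v) = topInt T u - topInt T v := by
  have := pairing_add (T := T) (ψ := fun _ => 1) continuous_const ((u - v).1 T.dirs) (v.1 T.dirs)
  rw [Submodule.coe_sub, Pi.sub_apply, sub_add_cancel] at this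
  unfold topInt
  rw [Submodule.coe_sub, Pi.sub_apply]
  linarith

theorem topInt_smul {T : Cell N} {k : ℕ} (c : ℝ) (u : L2Form T k) :
    topInt T (c • u) = c * topInt T u :=
  pairing_smul c _

theorem topInt_zero {T : Cell N} {k : ℕ} : topInt T (0 : L2Form T k) = 0 := pairing_zero

theorem topInt_eq_zero {T : Cell N} {k : ℕ} (h : k ≠ T.dim) (u : L2Form T k) : topInt T u = 0 := by
  unfold topInt
  rw [u.2 T.dirs (fun h' => h h'.2.symm), pairing_zero]

/-- Stokes' theorem for a form that vanishes on all facets but one. -/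
theorem IsD.exists_topInt {T : Cell N} {k : ℕ} {U : ∀ F : Cell N, L2Form F k}
    {W : ∀ F : Cell N, L2Form F (k + 1)} (h : IsD T U W) {i : Fin N} (hi : i ∈ T.dirs) (b : Bool)
    (h0 : ∀ j ∈ T.dirs, ∀ c, (j, c) ≠ (i, b) → U (T.facet j c) = 0) :
    ∃ ε : ℝ, ε ≠ 0 ∧ topInt T (W T) = ε * topInt (T.facet i b) (U (T.facet i b)) := by
  -- With the constant test function 1 the terms with derivatives of the test function drop out.
  have h1 := stokesFormula_iff.1 (h T (Cell.IsFace.refl T)) T.dirs subset_rfl (fun _ => 1)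
    contDiff_const
  have h2 : ∀ j, partialDeriv j (fun _ : Fin N → ℝ => (1 : ℝ)) = fun _ => 0 := by
    intro j
    funext x
    simp [partialDeriv]
  have h3 : ∀ f : Lp ℝ 2 T.measure, pairing T (fun _ => 0) f = 0 := fun f => by simp [pairing]
  simp only [h2, h3, mul_zero, sum_const_zero, add_zero] at h1
  rw [sum_eq_single_of_mem i hi fun j hj hji => by
    rw [h0 j hj _ (by simp [hji]), h0 j hj _ (by simp [hji])]
    simp only [Submodule.coe_zero, Pi.zero_apply, pairing_zero, sub_zero, mul_zero]] at h1
  have h4 : ∀ c, topInt (T.facet i c) (U (T.facet i c)) =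
      pairing (T.facet i c) (fun _ => 1) ((U (T.facet i c)).1 (T.dirs.erase i)) := by
    intro c
    unfold topInt
    rw [Cell.facet_dirs]
  rw [← h4, ← h4] at h1
  cases b
  · refine ⟨-insSign i T.dirs, neg_ne_zero.2 (insSign_ne_zero _ _), ?_⟩
    rw [h0 i hi true (by simp), topInt_zero] at h1
    unfold topInt at *
    rw [h1]
    ring
  · refine ⟨insSign i T.dirs, insSign_ne_zero _ _, ?_⟩
    rw [h0 i hi false (by simp), topInt_zero, sub_zero] at h1
    exact h1

namespace FES

variable {C : CubicalComplex N} {A : FES C} {T : Cell N} {k : ℕ} {Γ : Finset (Fin N × Bool)}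

/-! ### Cohomology relative to some facets -/

/-- `U` is a form in `A^k(T)` that vanishes on the facets of `T` given by `Γ`. -/
def Rel (A : FES C) (T : Cell N) (Γ : Finset (Fin N × Bool)) {k : ℕ}
    (U : ∀ F : Cell N, L2Form F k) : Prop :=
  IsTraceFamily T U ∧ U T ∈ A.space T k ∧ ∀ p ∈ Γ, p.1 ∈ T.dirs → U (T.facet p.1 p.2) = 0

/-- Exactness of the complex of forms on `T` that vanish on the facets given by `Γ`. -/
def RelExact (A : FES C) (T : Cell N) (Γ : Finset (Fin N × Bool)) : Prop :=
  (∀ U : ∀ F : Cell N, L2Form F 0, A.Rel T Γ U → IsD T U 0 → U T = 0) ∧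
  ∀ (k : ℕ) (U : ∀ F : Cell N, L2Form F (k + 1)), A.Rel T Γ U → IsD T U 0 →
    ∃ V, A.Rel T Γ V ∧ IsD T V U

/-- The complex `A_0(T)` has no cohomology but that detected by the integral over `T`. -/
def ZeroExact (A : FES C) (T : Cell N) : Prop :=
  (∀ U : ∀ F : Cell N, L2Form F 0, A.Rel T univ U → IsD T U 0 → topInt T (U T) = 0 → U T = 0) ∧
  ∀ (k : ℕ) (U : ∀ F : Cell N, L2Form F (k + 1)), A.Rel T univ U → IsD T U 0 →
    topInt T (U T) = 0 → ∃ V, A.Rel T univ V ∧ IsD T V U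

/-- The complex `A(T)` is a resolution of `ℝ`. -/
def LocallyExactAt (A : FES C) (T : Cell N) : Prop :=
  (∀ u : L2Form T 0, (u ∈ A.space T 0 ∧ IsExtDeriv T u 0) ↔
    ∃ c : ℝ, u.1 ∅ =ᵐ[T.measure] fun _ => c) ∧
  ∀ (k : ℕ), ∀ u ∈ A.space T (k + 1), IsExtDeriv T u 0 →
    ∃ v ∈ A.space T k, IsExtDeriv T v u

theorem Rel.add {U V : ∀ F : Cell N, L2Form F k} (hU : A.Rel T Γ U) (hV : A.Rel T Γ V) :
    A.Rel T Γ (U + V) := by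
  refine ⟨hU.1.add hV.1, add_mem hU.2.1 hV.2.1, fun p hp hd => ?_⟩
  rw [Pi.add_apply, hU.2.2 p hp hd, hV.2.2 p hp hd, add_zero]

theorem Rel.smul (c : ℝ) {U : ∀ F : Cell N, L2Form F k} (hU : A.Rel T Γ U) :
    A.Rel T Γ (c • U) := by
  refine ⟨hU.1.smul c, Submodule.smul_mem _ _ hU.2.1, fun p hp hd => ?_⟩
  rw [Pi.smul_apply, hU.2.2 p hp hd, smul_zero]

theorem Rel.sub {U V : ∀ F : Cell N, L2Form F k} (hU : A.Rel T Γ U) (hV : A.Rel T Γ V) :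
    A.Rel T Γ (U - V) := by
  refine ⟨hU.1.sub hV.1, sub_mem hU.2.1 hV.2.1, fun p hp hd => ?_⟩
  rw [Pi.sub_apply, hU.2.2 p hp hd, hV.2.2 p hp hd, sub_zero]

theorem rel_zero : A.Rel T Γ (0 : ∀ F : Cell N, L2Form F k) :=
  ⟨isTraceFamily_zero, zero_mem _, fun _ _ _ => rfl⟩

theorem Rel.mono {Γ' : Finset (Fin N × Bool)} {U : ∀ F : Cell N, L2Form F k}
    (hU : A.Rel T Γ U) (h : ∀ p ∈ Γ', p.1 ∈ T.dirs → p ∈ Γ) : A.Rel T Γ' U :=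
  ⟨hU.1, hU.2.1, fun p hp hd => hU.2.2 p (h p hp hd) hd⟩

theorem Rel.insert_facet {p : Fin N × Bool} {U : ∀ F : Cell N, L2Form F k} (hU : A.Rel T Γ U)
    (h : p.1 ∈ T.dirs → U (T.facet p.1 p.2) = 0) : A.Rel T (insert p Γ) U := by
  refine ⟨hU.1, hU.2.1, fun q hq hd => ?_⟩
  rcases mem_insert.1 hq with rfl | hq
  · exact h hd
  · exact hU.2.2 q hq hd

/-- The same Γ can be used on a facet, because pairs whose direction is not free impose no condition
there. -/
theorem Rel.facet (hT : T ∈ C.cells) {U : ∀ F : Cell N, L2Form F k} (hU : A.Rel T Γ U)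
    (j : Fin N) (c : Bool) : A.Rel (T.facet j c) Γ U := by
  have hF := T.facet_isFace j c
  refine ⟨hU.1.face hF, A.face_mem hT hU.1 hU.2.1 hF, fun p hp hd => ?_⟩
  rw [Cell.facet_dirs, mem_erase] at hd
  rw [Cell.facet_comm _ hd.1.symm]
  exact (hU.1.face (T.facet_isFace _ _)).eq_zero (hU.2.2 p hp hd.2) (Cell.facet_isFace _ _ _)

theorem Rel.deriv (hT : T ∈ C.cells) {U : ∀ F : Cell N, L2Form F k}
    {W : ∀ F : Cell N, L2Form F (k + 1)} (hU : A.Rel T Γ U) (h : IsD T U W) : A.Rel T Γ W := by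
  refine ⟨h.deriv.isTraceFamily, A.deriv_mem hT h hU.2.1, fun p hp hd => ?_⟩
  exact ((h.face (T.facet_isFace _ _)).eq_zero (hU.2.2 p hp hd) (Cell.IsFace.refl _)).2

theorem Rel.exists_isD {U : ∀ F : Cell N, L2Form F k} (hU : A.Rel T Γ U) : ∃ W, IsD T U W :=
  isTraceFamily_iff.1 hU.1

/-- The data are Y on the facet (j, c) and zero on the facets of Γ. They are consistent: the
opposite facet does not meet (j, c), and any other one meets it in a facet of (j, c) that belongs to
Γ, where Y vanishes. -/
theorem Rel.extend (hA : A.AdmitsExtensions) (hT : T ∈ C.cells) {j : Fin N} {c : Bool}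
    (hj : j ∈ T.dirs) (hΓ : (j, c) ∉ Γ) {Y : ∀ F : Cell N, L2Form F k}
    (hY : A.Rel (T.facet j c) Γ Y) :
    ∃ V, A.Rel T Γ V ∧ ∀ F : Cell N, F.IsFace (T.facet j c) → V F = Y F := by
  classical
  set G := T.facet j c with hG
  set X : ∀ F : Cell N, L2Form F k := fun F => if F.IsFace G then Y F else 0 with hX
  set K : Set (Cell N) := {F | F.IsFace G ∨ ∃ p ∈ Γ, p.1 ∈ T.dirs ∧ F.IsFace (T.facet p.1 p.2)}
    with hK
  have hXG : ∀ F : Cell N, F.IsFace G → X F = Y F := fun F hF => by simp [hX, hF]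
  have hX0 : ∀ p ∈ Γ, p.1 ∈ T.dirs → ∀ F : Cell N, F.IsFace (T.facet p.1 p.2) → X F = 0 := by
    rintro ⟨i, b⟩ hp hd F hF
    by_cases hFG : F.IsFace G
    · rw [hXG F hFG]
      by_cases hij : i = j
      · subst hij
        refine (Cell.not_isFace_opposite hd ?_ hF hFG).elim
        rintro rfl
        exact hΓ hp
      · refine (hY.1.face (Cell.facet_isFace G i b)).eq_zero (hY.2.2 (i, b) hp ?_)
          (Cell.IsFace.facet_facet (Ne.symm hij) hFG hF)
        rw [hG, Cell.facet_dirs]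
        exact mem_erase.2 ⟨hij, hd⟩
    · simp [hX, hFG]
  obtain ⟨V, hV1, hV2, hV3⟩ := exists_extension hA hT K (k := k)
    (fun F hF E hE => by
      rcases hF with hF | ⟨p, hp, hd, hF⟩
      · exact Or.inl (hE.trans hF)
      · exact Or.inr ⟨p, hp, hd, hE.trans hF⟩) X
    (fun F hF _ => by
      rcases hF with hF | ⟨p, hp, hd, hF⟩
      · refine ⟨(hY.1.face hF).congr fun E hE => (hXG E (hE.trans hF)).symm, ?_⟩
        rw [hXG F hF]
        exact A.face_mem (C.face_mem hT (T.facet_isFace j c)) hY.1 hY.2.1 hF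
      · refine ⟨isTraceFamily_zero.congr fun E hE => (hX0 p hp hd E (hE.trans hF)).symm, ?_⟩
        rw [hX0 p hp hd F hF]
        exact zero_mem _)
  refine ⟨V, ⟨hV1, hV2, fun p hp hd => ?_⟩, fun F hF => ?_⟩
  · rw [hV3 _ (Or.inr ⟨p, hp, hd, Cell.IsFace.refl _⟩) (T.facet_isFace _ _)]
    exact hX0 p hp hd _ (Cell.IsFace.refl _)
  · rw [hV3 F (Or.inl hF) (hF.trans (T.facet_isFace _ _)), hXG F hF]

/-- Extension of a primitive from a facet. -/
theorem Rel.extend_deriv (hA : A.AdmitsExtensions) (hT : T ∈ C.cells) {j : Fin N} {c : Bool}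
    (hj : j ∈ T.dirs) (hΓ : (j, c) ∉ Γ) {Y : ∀ F : Cell N, L2Form F k}
    (hY : A.Rel (T.facet j c) Γ Y) {U : ∀ F : Cell N, L2Form F (k + 1)}
    (hYU : IsD (T.facet j c) Y U) (hU : A.Rel T Γ U) :
    ∃ V W, A.Rel T Γ V ∧ IsD T V W ∧ A.Rel T (insert (j, c) Γ) (U - W) ∧
      ∀ F : Cell N, F.IsFace (T.facet j c) → V F = Y F := by
  obtain ⟨V, hV, hVY⟩ := hY.extend hA hT hj hΓ
  obtain ⟨W, hW⟩ := hV.exists_isD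
  refine ⟨V, W, hV, hW, (hU.sub (hV.deriv hT hW)).insert_facet fun _ => ?_, hVY⟩
  have hG := Cell.IsFace.refl (T.facet j c)
  rw [Pi.sub_apply, sub_eq_zero]
  exact hYU.unique (hW.face (T.facet_isFace j c)) (hVY _ hG).symm hG

theorem RelExact.congr {Γ' : Finset (Fin N × Bool)} (h : A.RelExact T Γ)
    (h1 : ∀ p : Fin N × Bool, p.1 ∈ T.dirs → (p ∈ Γ ↔ p ∈ Γ')) : A.RelExact T Γ' := by
  refine ⟨fun U hU => h.1 U (hU.mono fun p hp hd => (h1 p hd).1 hp), fun k U hU hd => ?_⟩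
  obtain ⟨V, hV, hVU⟩ := h.2 k U (hU.mono fun p hp hd => (h1 p hd).1 hp) hd
  exact ⟨V, hV.mono fun p hp hd => (h1 p hd).2 hp, hVU⟩

/-- One direction of the long exact sequence of the pair formed by the cell and the facet (j, c),
both relative to Γ. A primitive has closed trace on the new facet; subtracting the derivative of an
extension of a primitive of that trace removes it. In degree zero the closed trace is already zero.
-/
theorem RelExact.insert_facet (hA : A.AdmitsExtensions) (hT : T ∈ C.cells) {j : Fin N} {c : Bool}
    (hj : j ∈ T.dirs) (hΓ : (j, c) ∉ Γ) (h : A.RelExact T Γ) (h' : A.RelExact (T.facet j c) Γ) :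
    A.RelExact T (insert (j, c) Γ) := by
  have hsub : ∀ p ∈ Γ, p.1 ∈ T.dirs → p ∈ insert (j, c) Γ :=
    fun p hp _ => mem_insert_of_mem hp
  have hF := T.facet_isFace j c
  refine ⟨fun U hU hd => h.1 U (hU.mono hsub) hd, fun k U hU hd => ?_⟩
  obtain ⟨V, hV, hVU⟩ := h.2 k U (hU.mono hsub) hd
  have hU0 : U (T.facet j c) = 0 := hU.2.2 (j, c) (mem_insert_self _ _) hj
  have hVF : IsD (T.facet j c) V 0 :=
    (hVU.face hF).congr (fun _ _ => rfl) fun E hE => (hU.1.face hF).eq_zero hU0 hE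
  cases k with
  | zero => exact ⟨V, hV.insert_facet fun _ => h'.1 V (hV.facet hT j c) hVF, hVU⟩
  | succ k =>
    obtain ⟨Y, hY, hYV⟩ := h'.2 k V (hV.facet hT j c) hVF
    obtain ⟨Z, W, _, hZW, hVW, _⟩ := hY.extend_deriv hA hT hj hΓ hYV hV
    refine ⟨V - W, hVW, ?_⟩
    have := hVU.sub hZW.deriv
    rwa [sub_zero] at this

/-- The same exact sequence read the other way: subtracting the derivative of an extension of a
primitive on the facet makes a closed form vanish there. -/
theorem RelExact.of_insert (hA : A.AdmitsExtensions) (hT : T ∈ C.cells) {j : Fin N} {c : Bool}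
    (hj : j ∈ T.dirs) (hΓ : (j, c) ∉ Γ) (h : A.RelExact T (insert (j, c) Γ))
    (h' : A.RelExact (T.facet j c) Γ) : A.RelExact T Γ := by
  have hsub : ∀ p ∈ Γ, p.1 ∈ T.dirs → p ∈ insert (j, c) Γ :=
    fun p hp _ => mem_insert_of_mem hp
  have hF := T.facet_isFace j c
  refine ⟨fun U hU hd => h.1 U (hU.insert_facet fun _ => h'.1 U (hU.facet hT j c) (hd.face hF)) hd,
    fun k U hU hd => ?_⟩
  obtain ⟨Y, hY, hYU⟩ := h'.2 k U (hU.facet hT j c) (hd.face hF)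
  obtain ⟨Z, W, hZ, hZW, hUW, _⟩ := hY.extend_deriv hA hT hj hΓ hYU hU
  have hd' : IsD T (U - W) 0 := by
    have := hd.sub hZW.deriv
    rwa [sub_zero] at this
  obtain ⟨V, hV, hVU⟩ := h.2 k _ hUW hd'
  refine ⟨V + Z, (hV.mono hsub).add hZ, ?_⟩
  have := hVU.add hZW
  rwa [sub_add_cancel] at this

theorem LocallyExactAt.exists_const (h : A.LocallyExactAt T) {U : ∀ F : Cell N, L2Form F 0}
    (hU : A.Rel T Γ U) (hd : IsD T U 0) :
    ∃ c : ℝ, ∀ F : Cell N, F.IsFace T →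
      U F = polyForm F 0 fun _ => MvPolynomial.C c := by
  obtain ⟨c, hc⟩ := (h.1 _).1 ⟨hU.2.1, hd.isExtDeriv (Cell.IsFace.refl T)⟩
  refine ⟨c, fun F hF => hU.1.unique (isD_polyForm T 0 _).isTraceFamily ?_ hF⟩
  refine L2Form.ext fun J hJ hk => ?_
  rw [polyForm_apply _ hJ hk]
  obtain rfl := card_eq_zero.1 hk
  exact Lp.ext (hc.trans ((coeFn_polyLp T _).trans (by simp)).symm)

theorem LocallyExactAt.exists_primitive (hT : T ∈ C.cells) (h : A.LocallyExactAt T)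
    {U : ∀ F : Cell N, L2Form F (k + 1)} (hU : A.Rel T Γ U) (hd : IsD T U 0) :
    ∃ V, A.Rel T ∅ V ∧ IsD T V U := by
  obtain ⟨v, hv, hvU⟩ := h.2 k _ hU.2.1 (hd.isExtDeriv (Cell.IsFace.refl T))
  obtain ⟨V, hV, rfl⟩ := A.exists_family hT hv
  obtain ⟨W, hW⟩ := isTraceFamily_iff.1 hV
  refine ⟨V, ⟨hV, hv, by simp⟩, hW.congr (fun _ _ => rfl) fun F hF => ?_⟩
  exact hW.deriv.isTraceFamily.unique hU.1 (hW.eq_of_isExtDeriv hvU).symm hF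

theorem polyForm_const_eq_zero {c : ℝ} (h : (polyForm T 0 fun _ => MvPolynomial.C c) = 0) :
    c = 0 := by
  have h1 := polyForm_apply (T := T) (k := 0) (fun _ => MvPolynomial.C c) (J := ∅) (by simp) rfl
  rw [h] at h1
  have h2 := polyLp_eq_zero_iff.1 h1.symm T.lo ⟨le_rfl, T.lo_le_hi⟩
  simpa using h2

/-- Exactness relative to one facet. -/
theorem relExact_singleton (hA : A.AdmitsExtensions) (hT : T ∈ C.cells) {i : Fin N} {b : Bool}
    (hi : i ∈ T.dirs) (h : A.LocallyExactAt T) (h' : A.LocallyExactAt (T.facet i b)) :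
    A.RelExact T {(i, b)} := by
  have hF := T.facet_isFace i b
  have hFC := C.face_mem hT hF
  have hins : ∀ {k : ℕ} {U : ∀ F : Cell N, L2Form F k}, A.Rel T ∅ U → U (T.facet i b) = 0 →
      A.Rel T {(i, b)} U := fun hU h0 => hU.insert_facet fun _ => h0
  constructor
  · intro U hU hd
    obtain ⟨c, hc⟩ := h.exists_const hU hd
    have h0 := hU.2.2 (i, b) (mem_singleton_self _) hi
    rw [hc _ hF] at h0
    rw [hc T (Cell.IsFace.refl T), polyForm_const_eq_zero h0]
    simp only [map_zero]
    exact map_zero (polyForm T 0)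
  · intro k U hU hd
    obtain ⟨V, hV, hVU⟩ := h.exists_primitive hT hU hd
    have h0 := hU.2.2 (i, b) (mem_singleton_self _) hi
    have hVF : IsD (T.facet i b) V 0 :=
      (hVU.face hF).congr (fun _ _ => rfl) fun E hE => (hU.1.face hF).eq_zero h0 hE
    cases k with
    | zero =>
      -- The facet has the constants as cohomology in degree zero, but a constant on the facet
      -- extends to a constant on `T`, which can be subtracted from the primitive.
      obtain ⟨c, hc⟩ := h'.exists_const (hV.facet hT i b) hVF
      set X : ∀ F : Cell N, L2Form F 0 := fun F => polyForm F 0 fun _ => MvPolynomial.C c with hX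
      have hXT := isD_polyForm T 0 fun _ => MvPolynomial.C c
      have hXm : X T ∈ A.space T 0 := by
        refine ((h.1 _).2 ⟨c, ?_⟩).1
        rw [hX]
        simp only
        rw [polyForm_apply (k := 0) (J := ∅) _ (by simp) rfl]
        exact (coeFn_polyLp T _).trans (by simp)
      have hX0 : IsD T X 0 := by
        refine hXT.congr (fun _ _ => rfl) fun F _ => ?_
        have : (polyD fun _ => MvPolynomial.C c : Finset (Fin N) → MvPolynomial (Fin N) ℝ) = 0 := by
          funext L
          simp [polyD]
        rw [this, map_zero]
        rfl
      refine ⟨V - X, hins (hV.sub ⟨hXT.isTraceFamily, hXm, by simp⟩) ?_, ?_⟩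
      · rw [Pi.sub_apply, hc _ (Cell.IsFace.refl _), sub_self]
      · have := hVU.sub hX0
        rwa [sub_zero] at this
    | succ k =>
      obtain ⟨Y, hY, hYV⟩ := h'.exists_primitive hFC (hV.facet hT i b) hVF
      obtain ⟨Z, W, _, hZW, hVW, _⟩ := hY.extend_deriv hA hT hi (notMem_empty _) hYV hV
      refine ⟨V - W, hVW, ?_⟩
      have := hVU.sub hZW.deriv
      rwa [sub_zero] at this

/-- Exactness relative to a set of facets that contains just one of the two facets in some
direction. -/
theorem relExact_oneSided (hA : A.AdmitsExtensions) (hT : T ∈ C.cells) {i : Fin N} {b : Bool}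
    (hi : i ∈ T.dirs) (h : ∀ F : Cell N, F.IsFace T → A.LocallyExactAt F)
    (hΓ : ∀ p ∈ Γ, p.1 ≠ i) : A.RelExact T (insert (i, b) Γ) := by
  induction Γ using Finset.induction_on generalizing T with
  | empty => exact relExact_singleton hA hT hi (h T (Cell.IsFace.refl T)) (h _ (T.facet_isFace i b))
  | insert p Γ hp ih =>
    have hpi := hΓ p (mem_insert_self _ _)
    have hΓ' : ∀ q ∈ Γ, q.1 ≠ i := fun q hq => hΓ q (mem_insert_of_mem hq)
    have h1 := ih hT hi h hΓ'
    rw [insert_comm]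
    by_cases hd : p.1 ∈ T.dirs
    · have hF := T.facet_isFace p.1 p.2
      refine h1.insert_facet hA hT hd ?_ (ih (C.face_mem hT hF) ?_ (fun F hF' => h F (hF'.trans hF)) hΓ')
      · rw [mem_insert, not_or]
        exact ⟨fun h => hpi (congrArg Prod.fst h), hp⟩
      · rw [Cell.facet_dirs]
        exact mem_erase.2 ⟨hpi.symm, hi⟩
    · refine h1.congr fun q hq => ?_
      rw [mem_insert (b := p)]
      constructor
      · exact Or.inr
      · rintro (rfl | h)
        · exact absurd hq hd
        · exact h

/-- The facets of a cell that are not orthogonal to a direction. -/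
def sideFacets (i : Fin N) : Finset (Fin N × Bool) := univ.filter fun p => p.1 ≠ i

theorem ne_of_mem_sideFacets {i : Fin N} : ∀ p ∈ sideFacets i, p.1 ≠ i := by
  simp [sideFacets]

theorem notMem_insert_sideFacets (i : Fin N) :
    (i, true) ∉ insert (i, false) (sideFacets i) := by
  simp [sideFacets]

theorem insert_insert_sideFacets (i : Fin N) :
    insert (i, true) (insert (i, false) (sideFacets i)) = univ := by
  ext ⟨j, b⟩
  by_cases h : j = i
  · subst h; cases b <;> simp
  · simp [sideFacets, h]

/-- On a facet orthogonal to i the direction i is not free, so the side facets are all of its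
facets. -/
theorem Rel.facet_univ (hT : T ∈ C.cells) {i : Fin N} {U : ∀ F : Cell N, L2Form F k}
    (hU : A.Rel T (insert (i, false) (sideFacets i)) U) :
    A.Rel (T.facet i true) univ U := by
  refine (hU.facet hT i true).mono fun p _ hd => ?_
  rw [Cell.facet_dirs, mem_erase] at hd
  simp [sideFacets, hd.1]

theorem Rel.exists_topInt {i : Fin N} (hi : i ∈ T.dirs)
    {U : ∀ F : Cell N, L2Form F k} {W : ∀ F : Cell N, L2Form F (k + 1)}
    (hU : A.Rel T (insert (i, false) (sideFacets i)) U) (h : IsD T U W) :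
    ∃ ε : ℝ, ε ≠ 0 ∧ topInt T (W T) = ε * topInt (T.facet i true) (U (T.facet i true)) := by
  refine h.exists_topInt hi true fun j hj c hc => hU.2.2 (j, c) ?_ hj
  have := mem_univ (j, c)
  rw [← insert_insert_sideFacets i, mem_insert] at this
  exact this.resolve_left hc

/-- Induction on dimension. Relative to all facets but (i, true) the complex is exact, so the
cohomology of A_0(T) is that of A_0 of this facet, shifted by one degree; by Stokes the integrals on
both sides agree up to a nonzero factor. -/
theorem zeroExact_of_locallyExact (hA : A.AdmitsExtensions)
    (hT : T ∈ C.cells) (h : ∀ F : Cell N, F.IsFace T → A.LocallyExactAt F) : A.ZeroExact T := by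
  induction hm : T.dim using Nat.strong_induction_on generalizing T with
  | _ m ih =>
    rcases T.dirs.eq_empty_or_nonempty with he | ⟨i, hi⟩
    · have hdim : T.dim = 0 := by rw [Cell.dim, he, card_empty]
      constructor
      · intro U hU hd h0
        obtain ⟨c, hc⟩ := (h T (Cell.IsFace.refl T)).exists_const hU hd
        have hUT := hc T (Cell.IsFace.refl T)
        rw [hUT] at h0 ⊢
        unfold topInt at h0
        rw [polyForm_apply _ subset_rfl hdim, pairing_polyLp] at h0
        simp only [MvPolynomial.eval_C, mul_one, integral_const, smul_eq_mul, mul_eq_zero,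
          T.measureReal_univ_ne_zero, false_or] at h0
        rw [h0]
        simp only [map_zero]
        exact map_zero (polyForm T 0)
      · intro k U hU hd _
        refine ⟨0, rel_zero, isD_zero.congr (fun _ _ => rfl) fun F hF => ?_⟩
        exact (L2Form.eq_zero_of_dim_lt (hF.dim_le.trans_lt (by omega)) _).symm
    · have hF := T.facet_isFace i true
      have hFC := C.face_mem hT hF
      have hlt := (Cell.facet_isProperFace hi true).dim_lt
      have hR := relExact_oneSided (b := false) hA hT hi h (ne_of_mem_sideFacets (i := i))
      have hn := notMem_insert_sideFacets i
      obtain ⟨z1, z2⟩ := ih _ (hm ▸ hlt) hFC (fun E hE => h E (hE.trans hF)) rfl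
      constructor
      · exact fun U hU hd _ => hR.1 U (hU.mono fun _ _ _ => mem_univ _) hd
      · intro k U hU hd h0
        -- This primitive may fail to vanish on (i, true) only. Its trace there is closed,
        -- trace-free and of integral zero, so the induction hypothesis applies to it.
        obtain ⟨V, hV, hVU⟩ := hR.2 k U (hU.mono fun _ _ _ => mem_univ _) hd
        have hVF := hV.facet_univ hT
        have hU0 := hU.2.2 (i, true) (mem_univ _) hi
        have hVd : IsD (T.facet i true) V 0 :=
          (hVU.face hF).congr (fun _ _ => rfl) fun E hE => (hU.1.face hF).eq_zero hU0 hE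
        obtain ⟨ε, hε, hint⟩ := hV.exists_topInt hi hVU
        rw [h0] at hint
        have hint := (mul_eq_zero.1 hint.symm).resolve_left hε
        rw [← insert_insert_sideFacets i]
        cases k with
        | zero => exact ⟨V, hV.insert_facet fun _ => z1 V hVF hVd hint, hVU⟩
        | succ k =>
          obtain ⟨Y, hY, hYV⟩ := z2 k V hVF hVd hint
          obtain ⟨Z, W, _, hZW, hVW, _⟩ :=
            (hY.mono fun _ _ _ => mem_univ _).extend_deriv hA hT hi hn hYV hV
          refine ⟨V - W, hVW, ?_⟩
          have := hVU.sub hZW.deriv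
          rwa [sub_zero] at this

/-- Here the only facet without a condition is (i, true). Stokes shows that closed forms have
integral zero on it, so they can be made to vanish there; the integral over `T` that may remain is
killed by a form coming from this facet. -/
theorem relExact_of_zeroExact (hA : A.AdmitsExtensions) (hT : T ∈ C.cells) {i : Fin N}
    (hi : i ∈ T.dirs) (hz : ∀ F : Cell N, F.IsFace T → A.ZeroExact F)
    (htop : ∀ F : Cell N, F.IsFace T →
      ∃ U : ∀ E : Cell N, L2Form E F.dim, A.Rel F univ U ∧ topInt F (U F) ≠ 0) :
    A.RelExact T (insert (i, false) (sideFacets i)) := by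
  have hF := T.facet_isFace i true
  have hn := notMem_insert_sideFacets i
  obtain ⟨z1, z2⟩ := hz _ hF
  obtain ⟨t1, t2⟩ := hz T (Cell.IsFace.refl T)
  have hdim : (T.facet i true).dim + 1 = T.dim := by
    unfold Cell.dim
    rw [Cell.facet_dirs, card_erase_add_one hi]
  have hzero : ∀ {k : ℕ} {U : ∀ F : Cell N, L2Form F k},
      A.Rel T (insert (i, false) (sideFacets i)) U → IsD T U 0 →
      topInt (T.facet i true) (U (T.facet i true)) = 0 := by
    intro k U hU hd
    obtain ⟨ε, hε, hint⟩ := hU.exists_topInt hi hd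
    rw [Pi.zero_apply, topInt_zero] at hint
    exact (mul_eq_zero.1 hint.symm).resolve_left hε
  have huniv : ∀ {k : ℕ} {U : ∀ F : Cell N, L2Form F k},
      A.Rel T (insert (i, true) (insert (i, false) (sideFacets i))) U → A.Rel T univ U := by
    intro k U hU
    rwa [insert_insert_sideFacets] at hU
  constructor
  · intro U hU hd
    refine t1 U (huniv (hU.insert_facet fun _ => z1 U (hU.facet_univ hT) (hd.face hF) (hzero hU hd))) hd
      (topInt_eq_zero (by omega) _)
  · intro k U hU hd
    obtain ⟨Y, hY, hYU⟩ := z2 k U (hU.facet_univ hT) (hd.face hF) (hzero hU hd)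
    obtain ⟨Z, W, hZ, hZW, hUW, _⟩ :=
      (hY.mono fun _ _ _ => mem_univ _).extend_deriv hA hT hi hn hYU hU
    have hd' : IsD T (U - W) 0 := by
      have := hd.sub hZW.deriv
      rwa [sub_zero] at this
    -- The obstruction to a primitive of U - W is its integral. It matters only in top degree, where
    -- a multiple of the derivative of an extended form with nonzero integral on the facet has the
    -- same integral.
    have hex : ∃ (Z' : ∀ F : Cell N, L2Form F k) (W' : ∀ F : Cell N, L2Form F (k + 1)),
        A.Rel T (insert (i, false) (sideFacets i)) Z' ∧ IsD T Z' W' ∧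
        A.Rel T univ W' ∧ topInt T (W' T) = topInt T ((U - W) T) := by
      by_cases hk : k = (T.facet i true).dim
      · subst hk
        obtain ⟨Y', hY', hne⟩ := htop _ hF
        obtain ⟨Z', hZ', hZY⟩ := (hY'.mono fun _ _ _ => mem_univ _).extend hA hT hi hn
        obtain ⟨W', hW'⟩ := hZ'.exists_isD
        obtain ⟨ε, hε, hint⟩ := hZ'.exists_topInt hi hW'
        rw [hZY _ (Cell.IsFace.refl _)] at hint
        have hne' : topInt T (W' T) ≠ 0 := by
          rw [hint]
          exact mul_ne_zero hε hne
        refine ⟨(topInt T ((U - W) T) / topInt T (W' T)) • Z', _, hZ'.smul _, hW'.smul _,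
          huniv (((hZ'.deriv hT hW').smul _).insert_facet fun _ => ?_), ?_⟩
        · exact L2Form.eq_zero_of_dim_lt (by simp) _
        · rw [Pi.smul_apply, topInt_smul, div_mul_cancel₀ _ hne']
      · refine ⟨0, 0, rel_zero, isD_zero, rel_zero, ?_⟩
        rw [topInt_eq_zero (by omega), topInt_eq_zero (by omega)]
    obtain ⟨Z', W', hZ', hZW', hW', hint⟩ := hex
    have hd'' : IsD T (U - W - W') 0 := by
      have := hd'.sub hZW'.deriv
      rwa [sub_zero] at this
    obtain ⟨V, hV, hVU⟩ := t2 k _ ((huniv hUW).sub hW') hd''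
      (by rw [Pi.sub_apply, topInt_sub, hint, sub_self])
    refine ⟨V + Z' + Z, ((hV.mono fun _ _ _ => mem_univ _).add hZ').add hZ, ?_⟩
    have := (hVU.add hZW').add hZW
    rwa [sub_add_cancel, sub_add_cancel] at this

/-- A system with extensions for which the complexes `A_0(T)` have the right cohomology is
locally exact. -/
theorem locallyExact_of_zeroExact (hA : A.AdmitsExtensions)
    (hz : ∀ T ∈ C.cells, A.ZeroExact T)
    (htop : ∀ T ∈ C.cells, ∃ U : ∀ E : Cell N, L2Form E T.dim, A.Rel T univ U ∧ topInt T (U T) ≠ 0)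
    (hconst : ∀ T ∈ C.cells, ∀ u : L2Form T 0, (u ∈ A.space T 0 ∧ IsExtDeriv T u 0) ↔
      ∃ c : ℝ, u.1 ∅ =ᵐ[T.measure] fun _ => c) : A.LocallyExact := by
  suffices H : ∀ T ∈ C.cells, A.LocallyExactAt T from H
  intro T hT
  induction hm : T.dim using Nat.strong_induction_on generalizing T with
  | _ m ih =>
    refine ⟨hconst T hT, fun k u hu hd => ?_⟩
    rcases T.dirs.eq_empty_or_nonempty with he | ⟨i, hi⟩
    · have hdim : T.dim = 0 := by rw [Cell.dim, he, card_empty]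
      refine ⟨0, zero_mem _, ?_⟩
      rw [L2Form.eq_zero_of_dim_lt (by omega) u]
      exact stokesFormula_zero.isExtDeriv
    · have hP : ∀ F : Cell N, F.IsProperFace T → A.LocallyExactAt F := fun F hF =>
        ih _ (hm ▸ hF.dim_lt) F (C.face_mem hT hF.1) rfl
      have h1 := relExact_of_zeroExact hA hT hi
        (fun F hF => hz F (C.face_mem hT hF)) (fun F hF => htop F (C.face_mem hT hF))
      -- The conditions on the side facets are dropped one by one. Each side facet still has a
      -- condition on only one of its ends in direction i, so it is relatively exact by the
      -- induction hypothesis.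
      have h2 : ∀ Γ : Finset (Fin N × Bool), (∀ p ∈ Γ, p.1 ≠ i) →
          A.RelExact T (insert (i, false) Γ) → A.RelExact T {(i, false)} := by
        intro Γ
        induction Γ using Finset.induction_on with
        | empty => exact fun _ h => h
        | insert p Γ hp ihΓ =>
          intro hΓ h
          have hpi := hΓ p (mem_insert_self _ _)
          have hΓ' : ∀ q ∈ Γ, q.1 ≠ i := fun q hq => hΓ q (mem_insert_of_mem hq)
          refine ihΓ hΓ' ?_
          rw [insert_comm] at h
          by_cases hd : p.1 ∈ T.dirs
          · have hpf := Cell.facet_isProperFace hd p.2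
            have hpΓ : p ∉ insert (i, false) Γ := by
              rw [mem_insert, not_or]
              exact ⟨fun h => hpi (congrArg Prod.fst h), hp⟩
            refine h.of_insert hA hT hd hpΓ (relExact_oneSided hA (C.face_mem hT hpf.1) ?_ ?_ hΓ')
            · rw [Cell.facet_dirs]
              exact mem_erase.2 ⟨hpi.symm, hi⟩
            · intro F hF
              refine hP F ⟨hF.trans hpf.1, ?_⟩
              rintro rfl
              exact absurd (hF.dim_le.trans_lt hpf.dim_lt) (lt_irrefl _)
          · refine h.congr fun q hq => ?_
            rw [mem_insert]
            constructor
            · rintro (rfl | h)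
              · exact absurd hq hd
              · exact h
            · exact Or.inr
      have h3 := h2 _ ne_of_mem_sideFacets h1
      obtain ⟨U, hU, rfl⟩ := A.exists_family hT hu
      have hUd := hU.isD_zero_of_isExtDeriv hd
      have hUR : A.Rel T ∅ U := ⟨hU, hu, by simp⟩
      have hF := T.facet_isFace i false
      -- The last condition cannot be dropped by `RelExact.of_insert`, since constants on the facet
      -- are closed. Only forms of positive degree are at issue, and for these the facet is exact by
      -- induction.
      obtain ⟨Y, hY, hYU⟩ := (hP _ (Cell.facet_isProperFace hi false)).exists_primitive
        (C.face_mem hT hF) (hUR.facet hT i false) (hUd.face hF)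
      obtain ⟨Z, W, hZ, hZW, hUW, _⟩ := hY.extend_deriv hA hT hi (notMem_empty _) hYU hUR
      have hd' : IsD T (U - W) 0 := by
        have := hUd.sub hZW.deriv
        rwa [sub_zero] at this
      obtain ⟨V, hV, hVU⟩ := h3.2 k _ hUW hd'
      refine ⟨(V + Z) T, add_mem hV.2.1 hZ.2.1, ?_⟩
      have := hVU.add hZW
      rw [sub_add_cancel] at this
      exact this.isExtDeriv (Cell.IsFace.refl T)

end FES

/-! ### Operators on polynomials -/

/-- Substitution of a constant for a variable. -/
def substVar (i : Fin N) (c : ℝ) : MvPolynomial (Fin N) ℝ →ₐ[ℝ] MvPolynomial (Fin N) ℝ :=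
  MvPolynomial.aeval (Function.update MvPolynomial.X i (MvPolynomial.C c))

theorem substVar_X_self (i : Fin N) (c : ℝ) :
    substVar i c (MvPolynomial.X i) = MvPolynomial.C c := by
  simp [substVar]

theorem substVar_X_ne {i j : Fin N} (h : j ≠ i) (c : ℝ) :
    substVar i c (MvPolynomial.X j) = MvPolynomial.X j := by
  simp [substVar, h]

theorem substVar_C (i : Fin N) (c a : ℝ) : substVar i c (MvPolynomial.C a) = MvPolynomial.C a :=
  (substVar i c).commutes a

theorem eval_substVar (i : Fin N) (c : ℝ) (p : MvPolynomial (Fin N) ℝ) (x : Fin N → ℝ) :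
    MvPolynomial.eval x (substVar i c p) = MvPolynomial.eval (Function.update x i c) p := by
  induction p using MvPolynomial.induction_on with
  | C a => simp
  | add p q hp hq => simp [hp, hq]
  | mul_X p j hp =>
    rw [map_mul, map_mul, map_mul, hp]
    by_cases h : j = i
    · subst h; simp [substVar_X_self]
    · simp [substVar_X_ne h, h]

theorem substVar_idem (i : Fin N) (c c' : ℝ) (p : MvPolynomial (Fin N) ℝ) :
    substVar i c (substVar i c' p) = substVar i c' p := by
  refine MvPolynomial.funext fun x => ?_
  rw [eval_substVar, eval_substVar, eval_substVar, Function.update_idem]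

theorem substVar_comm {i j : Fin N} (h : i ≠ j) (c c' : ℝ) (p : MvPolynomial (Fin N) ℝ) :
    substVar i c (substVar j c' p) = substVar j c' (substVar i c p) := by
  refine MvPolynomial.funext fun x => ?_
  rw [eval_substVar, eval_substVar, eval_substVar, eval_substVar, Function.update_comm h]

theorem pderiv_substVar_self (i : Fin N) (c : ℝ) (p : MvPolynomial (Fin N) ℝ) :
    MvPolynomial.pderiv i (substVar i c p) = 0 := by
  induction p using MvPolynomial.induction_on with
  | C a => simp
  | add p q hp hq => simp [hp, hq]
  | mul_X p j hp =>
    rw [map_mul, Derivation.leibniz, hp]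
    by_cases h : j = i
    · subst h; simp [substVar_X_self]
    · simp [substVar_X_ne h, MvPolynomial.pderiv_X_of_ne h]

theorem pderiv_substVar {i j : Fin N} (h : j ≠ i) (c : ℝ) (p : MvPolynomial (Fin N) ℝ) :
    MvPolynomial.pderiv j (substVar i c p) = substVar i c (MvPolynomial.pderiv j p) := by
  induction p using MvPolynomial.induction_on with
  | C a => simp
  | add p q hp hq => simp [hp, hq]
  | mul_X p l hp =>
    rw [map_mul, Derivation.leibniz, hp, Derivation.leibniz, map_add, smul_eq_mul, smul_eq_mul,
      smul_eq_mul, smul_eq_mul, map_mul, map_mul]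
    congr 2
    by_cases hl : l = i
    · subst hl; simp [substVar_X_self, MvPolynomial.pderiv_X_of_ne h.symm]
    · rw [substVar_X_ne hl]
      by_cases hj : l = j
      · subst hj; simp
      · simp [MvPolynomial.pderiv_X_of_ne hj]

theorem substVar_monomial (i : Fin N) (c : ℝ) (d : Fin N →₀ ℕ) (a : ℝ) :
    substVar i c (MvPolynomial.monomial d a) = MvPolynomial.monomial (d.erase i) (a * c ^ d i) := by
  refine MvPolynomial.funext fun x => ?_
  rw [eval_substVar, MvPolynomial.eval_monomial, MvPolynomial.eval_monomial,
    Finsupp.prod_fintype _ _ (by simp), Finsupp.prod_fintype _ _ (by simp), mul_assoc,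
    ← mul_prod_erase univ _ (mem_univ i), ← mul_prod_erase univ (fun j => x j ^ (d.erase i) j)
      (mem_univ i)]
  simp only [Function.update_self, Finsupp.erase_same, pow_zero, one_mul]
  congr 2
  refine prod_congr rfl fun j hj => ?_
  have := ne_of_mem_erase hj
  simp [this]

theorem degree_erase_le (d : Fin N →₀ ℕ) (i : Fin N) : (d.erase i).degree + d i = d.degree := by
  have := congrArg Finsupp.degree (Finsupp.single_add_erase i d)
  rw [map_add, Finsupp.degree_single] at this
  omega

theorem substVar_mem_degLE {s : ℤ} {p : MvPolynomial (Fin N) ℝ} (hp : p ∈ degLE N s) (i : Fin N)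
    (c : ℝ) : substVar i c p ∈ degLE N s := by
  have := map_mem_degLE (t := 0) (substVar i c).toLinearMap (fun d a => ?_) hp
  · simpa using this
  · rw [AlgHom.toLinearMap_apply, substVar_monomial]
    refine monomial_mem_degLE ?_ _
    have := degree_erase_le d i
    omega

/-- The primitive with respect to a variable, without terms that are constant in this variable. -/
def primVar (i : Fin N) : MvPolynomial (Fin N) ℝ →ₗ[ℝ] MvPolynomial (Fin N) ℝ :=
  (MvPolynomial.basisMonomials (Fin N) ℝ).constr ℝ fun d =>
    MvPolynomial.monomial (d + Finsupp.single i 1) ((d i : ℝ) + 1)⁻¹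

theorem primVar_monomial (i : Fin N) (d : Fin N →₀ ℕ) (a : ℝ) :
    primVar i (MvPolynomial.monomial d a) =
      MvPolynomial.monomial (d + Finsupp.single i 1) (a * ((d i : ℝ) + 1)⁻¹) := by
  have h1 : MvPolynomial.monomial d a = a • MvPolynomial.basisMonomials (Fin N) ℝ d := by
    rw [MvPolynomial.coe_basisMonomials, MvPolynomial.smul_monomial, smul_eq_mul, mul_one]
  rw [h1, map_smul, primVar, Module.Basis.constr_basis, MvPolynomial.smul_monomial, smul_eq_mul]

theorem pderiv_primVar_self (i : Fin N) (p : MvPolynomial (Fin N) ℝ) :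
    MvPolynomial.pderiv i (primVar i p) = p := by
  induction p using MvPolynomial.induction_on' with
  | monomial d a =>
    rw [primVar_monomial, MvPolynomial.pderiv_monomial]
    have : (d i : ℝ) + 1 ≠ 0 := by positivity
    congr 1
    · congr 1
      simp
    · simp [this]
  | add p q hp hq => rw [map_add, map_add, hp, hq]

theorem pderiv_primVar {i j : Fin N} (h : i ≠ j) (p : MvPolynomial (Fin N) ℝ) :
    MvPolynomial.pderiv j (primVar i p) = primVar i (MvPolynomial.pderiv j p) := by
  induction p using MvPolynomial.induction_on' with
  | monomial d a =>
    rw [primVar_monomial, MvPolynomial.pderiv_monomial, MvPolynomial.pderiv_monomial,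
      primVar_monomial]
    by_cases hd : d j = 0
    · simp [hd, h]
    · congr 1
      · congr 1
        ext l
        simp only [Finsupp.coe_tsub, Finsupp.coe_add, Pi.sub_apply, Pi.add_apply,
          Finsupp.single_apply]
        grind
      · simp [h, h.symm]
        ring
  | add p q hp hq => rw [map_add, map_add, hp, hq, map_add, map_add]

theorem primVar_pderiv (i : Fin N) (p : MvPolynomial (Fin N) ℝ) :
    primVar i (MvPolynomial.pderiv i p) = p - substVar i 0 p := by
  induction p using MvPolynomial.induction_on' with
  | monomial d a =>
    rw [MvPolynomial.pderiv_monomial, primVar_monomial, substVar_monomial]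
    by_cases hd : d i = 0
    · have : d.erase i = d := Finsupp.erase_of_notMem_support (by simpa using hd)
      simp [hd]
    · have h1 : d - Finsupp.single i 1 + Finsupp.single i 1 = d :=
        tsub_add_cancel_of_le (by simpa [Finsupp.single_le_iff] using Nat.one_le_iff_ne_zero.2 hd)
      have h2 : (d i : ℝ) ≠ 0 := by exact_mod_cast hd
      rw [h1, zero_pow hd, mul_zero, map_zero, sub_zero]
      congr 1
      simp only [Finsupp.coe_tsub, Pi.sub_apply, Finsupp.single_eq_same]
      rw [Nat.cast_sub (Nat.one_le_iff_ne_zero.2 hd)]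
      rw [Nat.cast_one, sub_add_cancel, mul_assoc, mul_inv_cancel₀ h2, mul_one]
  | add p q hp hq => rw [map_add, map_add, map_add, hp, hq]; ring

theorem substVar_primVar {i j : Fin N} (h : i ≠ j) (c : ℝ) (p : MvPolynomial (Fin N) ℝ) :
    substVar j c (primVar i p) = primVar i (substVar j c p) := by
  induction p using MvPolynomial.induction_on' with
  | monomial d a =>
    rw [primVar_monomial, substVar_monomial, substVar_monomial, primVar_monomial]
    congr 1
    · congr 1
      ext l
      simp only [Finsupp.coe_add, Pi.add_apply, Finsupp.single_apply, Finsupp.erase_apply]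
      grind
    · simp [h, h.symm]
      ring
  | add p q hp hq => simp only [map_add, hp, hq]

theorem primVar_mem_degLE {s : ℤ} {p : MvPolynomial (Fin N) ℝ} (hp : p ∈ degLE N s) (i : Fin N) :
    primVar i p ∈ degLE N (s + 1) := by
  refine map_mem_degLE (t := 1) (primVar i) (fun d a => ?_) hp
  rw [primVar_monomial]
  refine monomial_mem_degLE ?_ _
  rw [map_add, Finsupp.degree_single]
  simp

/-- The degree gained by the primitive is in the variable that is then replaced by a constant. So
means keep the degree, which the bounds for the homotopy need. -/
theorem substVar_primVar_mem_degLE {s : ℤ} {p : MvPolynomial (Fin N) ℝ} (hp : p ∈ degLE N s)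
    (i : Fin N) (c : ℝ) : substVar i c (primVar i p) ∈ degLE N s := by
  have := map_mem_degLE (t := 0) ((substVar i c).toLinearMap ∘ₗ primVar i) (fun d a => ?_) hp
  · simpa using this
  · rw [LinearMap.comp_apply, primVar_monomial, AlgHom.toLinearMap_apply, substVar_monomial]
    refine monomial_mem_degLE ?_ _
    have := degree_erase_le d i
    have h2 : (d + Finsupp.single i 1).erase i = d.erase i := by
      ext l
      simp only [Finsupp.erase_apply, Finsupp.coe_add, Pi.add_apply, Finsupp.single_apply]
      grind
    rw [h2]
    omega

theorem mul_mem_degLE {s t : ℤ} {p q : MvPolynomial (Fin N) ℝ} (hp : p ∈ degLE N s)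
    (hq : q ∈ degLE N t) : p * q ∈ degLE N (s + t) := by
  classical
  intro d hd
  obtain ⟨a, ha, b, hb, rfl⟩ := Finset.mem_add.1 (MvPolynomial.support_mul p q hd)
  rw [map_add]
  have h1 := hp a ha
  have h2 := hq b hb
  push_cast
  linarith

theorem C_mem_degLE {s : ℤ} (hs : 0 ≤ s) (a : ℝ) : (MvPolynomial.C a : MvPolynomial (Fin N) ℝ) ∈ degLE N s :=
  monomial_mem_degLE (by simpa) a

theorem X_sub_C_mem_degLE (i : Fin N) (a : ℝ) :
    (MvPolynomial.X i - MvPolynomial.C a : MvPolynomial (Fin N) ℝ) ∈ degLE N 1 :=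
  sub_mem (monomial_mem_degLE (by simp) 1) (C_mem_degLE (by norm_num) a)

/-- The mean with respect to the variable `x i` in `[a, b]`. -/
def meanVar (i : Fin N) (a b : ℝ) : MvPolynomial (Fin N) ℝ →ₗ[ℝ] MvPolynomial (Fin N) ℝ :=
  (b - a)⁻¹ • (((substVar i b).toLinearMap - (substVar i a).toLinearMap) ∘ₗ primVar i)

/-- The primitive with respect to the variable `x i` of the deviation from the mean, which vanishes
for `x i = a` and `x i = b`. -/
def homVar (i : Fin N) (a b : ℝ) : MvPolynomial (Fin N) ℝ →ₗ[ℝ] MvPolynomial (Fin N) ℝ :=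
  primVar i - (substVar i a).toLinearMap ∘ₗ primVar i -
    LinearMap.mulLeft ℝ (MvPolynomial.X i - MvPolynomial.C a) ∘ₗ meanVar i a b

section homotopy

variable {i j : Fin N} {a b : ℝ} {p : MvPolynomial (Fin N) ℝ}

theorem meanVar_apply : meanVar i a b p =
    (b - a)⁻¹ • (substVar i b (primVar i p) - substVar i a (primVar i p)) := rfl

theorem homVar_apply : homVar i a b p = primVar i p - substVar i a (primVar i p) -
    (MvPolynomial.X i - MvPolynomial.C a) * meanVar i a b p := rfl

theorem substVar_meanVar_self (c : ℝ) : substVar i c (meanVar i a b p) = meanVar i a b p := by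
  rw [meanVar_apply, map_smul, map_sub, substVar_idem, substVar_idem]

theorem pderiv_meanVar_self : MvPolynomial.pderiv i (meanVar i a b p) = 0 := by
  rw [← substVar_meanVar_self 0, pderiv_substVar_self]

theorem substVar_meanVar (h : i ≠ j) (c : ℝ) :
    substVar j c (meanVar i a b p) = meanVar i a b (substVar j c p) := by
  simp only [meanVar_apply, map_smul, map_sub]
  rw [substVar_comm h.symm, substVar_comm h.symm, substVar_primVar h]

theorem pderiv_meanVar (h : i ≠ j) :
    MvPolynomial.pderiv j (meanVar i a b p) = meanVar i a b (MvPolynomial.pderiv j p) := by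
  simp only [meanVar_apply, Derivation.map_smul, map_sub]
  rw [pderiv_substVar h.symm, pderiv_substVar h.symm, pderiv_primVar h]

theorem pderiv_homVar_self :
    MvPolynomial.pderiv i (homVar i a b p) = p - meanVar i a b p := by
  rw [homVar_apply, map_sub, map_sub, pderiv_primVar_self, pderiv_substVar_self,
    Derivation.leibniz, pderiv_meanVar_self]
  simp

theorem substVar_homVar (h : i ≠ j) (c : ℝ) :
    substVar j c (homVar i a b p) = homVar i a b (substVar j c p) := by
  simp only [homVar_apply, map_sub, map_mul]
  rw [substVar_comm h.symm, substVar_primVar h, substVar_meanVar h, substVar_X_ne h, substVar_C]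

theorem pderiv_homVar (h : i ≠ j) :
    MvPolynomial.pderiv j (homVar i a b p) = homVar i a b (MvPolynomial.pderiv j p) := by
  simp only [homVar_apply, map_sub, Derivation.leibniz]
  rw [pderiv_substVar h.symm, pderiv_primVar h, pderiv_meanVar h, MvPolynomial.pderiv_X_of_ne h]
  simp

theorem substVar_left_homVar : substVar i a (homVar i a b p) = 0 := by
  rw [homVar_apply, map_sub, map_sub, map_mul, map_sub, substVar_X_self, substVar_C, substVar_idem]
  simp

theorem substVar_right_homVar (hab : a < b) : substVar i b (homVar i a b p) = 0 := by
  rw [homVar_apply, map_sub, map_sub, map_mul, map_sub, substVar_X_self, substVar_C, substVar_idem,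
    substVar_meanVar_self, meanVar_apply, ← map_sub, ← MvPolynomial.smul_eq_C_mul, smul_smul,
    mul_inv_cancel₀ (sub_ne_zero.2 hab.ne'), one_smul, sub_self]

/-- The mean of the derivative is a multiple of p(b) - p(a) = 0, and the primitive from a of the
derivative is p itself. -/
theorem homVar_pderiv (ha : substVar i a p = 0) (hb : substVar i b p = 0) :
    homVar i a b (MvPolynomial.pderiv i p) = p := by
  rw [homVar_apply, meanVar_apply, primVar_pderiv, map_sub, map_sub, substVar_idem, substVar_idem,
    ha, hb]
  simp

theorem meanVar_mem_degLE {s : ℤ} (hp : p ∈ degLE N s) : meanVar i a b p ∈ degLE N s :=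
  Submodule.smul_mem _ _ (sub_mem (substVar_primVar_mem_degLE hp i b)
    (substVar_primVar_mem_degLE hp i a))

theorem homVar_mem_degLE {s : ℤ} (hp : p ∈ degLE N s) : homVar i a b p ∈ degLE N (s + 1) := by
  refine sub_mem (sub_mem (primVar_mem_degLE hp i)
    (degLE_mono (by linarith) (substVar_primVar_mem_degLE hp i a))) ?_
  have := mul_mem_degLE (X_sub_C_mem_degLE i a) (meanVar_mem_degLE (i := i) (a := a) (b := b) hp)
  rwa [add_comm] at this

end homotopy

/-! ### Coefficients of polynomial forms without traces -/

/-- The coefficients of a polynomial `k`-form on `T` without traces, which involve only the free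
variables of `T`. -/
structure ZeroCoeffs (T : Cell N) (k : ℕ) (s : ℤ) (p : Finset (Fin N) → MvPolynomial (Fin N) ℝ) :
    Prop where
  supp : ∀ J, ¬ (J ⊆ T.dirs ∧ #J = k) → p J = 0
  indep : ∀ J, ∀ j ∉ T.dirs, substVar j (T.lo j) (p J) = p J
  vanish : ∀ J, ∀ i ∈ T.dirs, i ∉ J → substVar i (T.lo i) (p J) = 0 ∧ substVar i (T.hi i) (p J) = 0
  deg : ∀ J, p J ∈ degLE N s

/-- The homotopy operator in one direction on coefficients of forms. -/
def homForm (T : Cell N) (i : Fin N) (p : Finset (Fin N) → MvPolynomial (Fin N) ℝ)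
    (K : Finset (Fin N)) : MvPolynomial (Fin N) ℝ :=
  if i ∈ K then 0 else insSign i (insert i K) • homVar i (T.lo i) (T.hi i) (p (insert i K))

/-- The mean in one direction on coefficients of forms. -/
def meanForm (T : Cell N) (i : Fin N) (p : Finset (Fin N) → MvPolynomial (Fin N) ℝ)
    (J : Finset (Fin N)) : MvPolynomial (Fin N) ℝ :=
  if i ∈ J then meanVar i (T.lo i) (T.hi i) (p J) else 0

namespace ZeroCoeffs

variable {T : Cell N} {k : ℕ} {s : ℤ} {p : Finset (Fin N) → MvPolynomial (Fin N) ℝ} {i : Fin N}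

theorem homForm (hp : ZeroCoeffs T (k + 1) s p) (hi : i ∈ T.dirs) :
    ZeroCoeffs T k (s + 1) (homForm T i p) := by
  refine ⟨fun K hK => ?_, fun K j hj => ?_, fun K j hj hjK => ?_, fun K => ?_⟩ <;>
    unfold CubeFES.homForm <;> split_ifs with hiK
  · rfl
  · rw [hp.supp, map_zero, smul_zero]
    rintro ⟨h1, h2⟩
    rw [card_insert_of_notMem hiK] at h2
    exact hK ⟨(subset_insert _ _).trans h1, by omega⟩
  · exact map_zero _
  · have hij : i ≠ j := fun h => hj (h ▸ hi)
    rw [map_smul, substVar_homVar hij, hp.indep _ _ hj]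
  · simp
  · by_cases hij : i = j
    · subst hij
      rw [map_smul, map_smul, substVar_left_homVar, substVar_right_homVar (Cell.mem_dirs.1 hi)]
      simp
    · obtain ⟨h1, h2⟩ := hp.vanish (insert i K) j hj (by simp [hjK, Ne.symm hij])
      rw [map_smul, map_smul, substVar_homVar hij, substVar_homVar hij, h1, h2]
      simp
  · exact zero_mem _
  · exact Submodule.smul_mem _ _ (homVar_mem_degLE (hp.deg _))

theorem meanForm (hp : ZeroCoeffs T k s p) (hi : i ∈ T.dirs) :
    ZeroCoeffs T k s (meanForm T i p) := by
  refine ⟨fun K hK => ?_, fun K j hj => ?_, fun K j hj hjK => ?_, fun K => ?_⟩ <;>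
    unfold CubeFES.meanForm <;> split_ifs with hiK
  · rw [hp.supp _ hK, map_zero]
  · rfl
  · have hij : i ≠ j := fun h => hj (h ▸ hi)
    rw [substVar_meanVar hij, hp.indep _ _ hj]
  · exact map_zero _
  · have hij : i ≠ j := fun h => hjK (h ▸ hiK)
    obtain ⟨h1, h2⟩ := hp.vanish K j hj hjK
    rw [substVar_meanVar hij, substVar_meanVar hij, h1, h2]
    simp
  · simp
  · exact meanVar_mem_degLE (hp.deg _)
  · exact zero_mem _

theorem add {q : Finset (Fin N) → MvPolynomial (Fin N) ℝ} (hp : ZeroCoeffs T k s p)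
    (hq : ZeroCoeffs T k s q) : ZeroCoeffs T k s (p + q) := by
  refine ⟨fun K hK => ?_, fun K j hj => ?_, fun K j hj hjK => ?_, fun K => ?_⟩ <;>
    rw [Pi.add_apply]
  · rw [hp.supp K hK, hq.supp K hK, add_zero]
  · rw [map_add, hp.indep K j hj, hq.indep K j hj]
  · rw [map_add, map_add, (hp.vanish K j hj hjK).1, (hp.vanish K j hj hjK).2,
      (hq.vanish K j hj hjK).1, (hq.vanish K j hj hjK).2]
    simp
  · exact add_mem (hp.deg K) (hq.deg K)

theorem zero : ZeroCoeffs T k s (0 : Finset (Fin N) → MvPolynomial (Fin N) ℝ) := by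
  refine ⟨fun K hK => rfl, fun K j hj => ?_, fun K j hj hjK => ?_, fun K => zero_mem _⟩ <;> simp

/-- The homotopy formula in one direction. -/
theorem polyD_homForm (hp : ZeroCoeffs T k s p) (hd : polyD p = 0) (hi : i ∈ T.dirs) :
    polyD (CubeFES.homForm T i p) = p - CubeFES.meanForm T i p := by
  funext L
  rw [Pi.sub_apply]
  by_cases hiL : i ∈ L
  -- If i ∈ L, only the summand with index i survives, because the homotopy has no coefficients on
  -- index sets that contain i.
  · unfold polyD
    rw [sum_eq_single_of_mem i hiL]
    · have h1 : i ∉ L.erase i := notMem_erase i L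
      rw [CubeFES.homForm, if_neg h1, insert_erase hiL, Derivation.map_smul, smul_smul, insSign_mul_self,
        one_smul, pderiv_homVar_self, CubeFES.meanForm, if_pos hiL]
    · intro j hj hji
      have h1 : i ∈ L.erase j := mem_erase.2 ⟨hji.symm, hiL⟩
      rw [CubeFES.homForm, if_pos h1, map_zero, smul_zero]
  -- If i ∉ L, closedness is used at L ∪ {i}. The coefficient at L vanishes at both ends in
  -- direction i, so the one-dimensional homotopy inverts ∂_i on it and commutes with the other
  -- derivatives.
  · have h1 := congrFun hd (insert i L)
    rw [polyD, sum_insert hiL, erase_insert hiL, Pi.zero_apply] at h1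
    have h2 := congrArg (homVar i (T.lo i) (T.hi i)) h1
    obtain ⟨v1, v2⟩ := hp.vanish L i hi hiL
    rw [map_add, map_smul, homVar_pderiv v1 v2, map_zero, map_sum] at h2
    rw [CubeFES.meanForm, if_neg hiL, sub_zero]
    have h3 : polyD (CubeFES.homForm T i p) L = ∑ j ∈ L, -insSign i (insert i L) •
        homVar i (T.lo i) (T.hi i)
          (insSign j (insert i L) • MvPolynomial.pderiv j (p ((insert i L).erase j))) := by
      unfold polyD
      refine sum_congr rfl fun j hj => ?_
      have hij : i ≠ j := fun h => hiL (h ▸ hj)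
      have h4 : i ∉ L.erase j := fun h => hiL (mem_of_mem_erase h)
      have h5 : insert i (L.erase j) = (insert i L).erase j := (erase_insert_of_ne hij).symm
      have h6 := insSign_mul_insSign hij (mem_insert_self i L) (mem_insert_of_mem hj)
      rw [erase_insert hiL] at h6
      rw [CubeFES.homForm, if_neg h4, h5, Derivation.map_smul, pderiv_homVar hij, map_smul, smul_smul,
        smul_smul]
      congr 1
      have h7 := insSign_mul_self i (insert i L)
      have h8 := insSign_mul_self i ((insert i L).erase j)
      linear_combination (insSign i (insert i L) * insSign i ((insert i L).erase j)) * h6 +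
        (- insSign j L * insSign i ((insert i L).erase j)) * h7 +
        (-insSign i (insert i L) * insSign j (insert i L)) * h8
    rw [h3, ← smul_sum]
    have h9 := congrArg (insSign i (insert i L) • ·) h2
    simp only [smul_add, smul_smul, insSign_mul_self, one_smul, smul_zero] at h9
    rw [neg_smul]
    exact (eq_neg_of_add_eq_zero_left h9).symm

end ZeroCoeffs

theorem polyD_sub (p q : Finset (Fin N) → MvPolynomial (Fin N) ℝ) :
    polyD (p - q) = polyD p - polyD q := by
  funext L
  simp [polyD, smul_sub]

theorem polyD_add (p q : Finset (Fin N) → MvPolynomial (Fin N) ℝ) :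
    polyD (p + q) = polyD p + polyD q := by
  funext L
  simp [polyD, smul_add, sum_add_distrib]

theorem polyD_zero : polyD (0 : Finset (Fin N) → MvPolynomial (Fin N) ℝ) = 0 := by
  funext L
  simp [polyD]

theorem polyD_polyD (p : Finset (Fin N) → MvPolynomial (Fin N) ℝ) : polyD (polyD p) = 0 := by
  funext L
  have h : ∀ i j : Fin N, ∀ q : MvPolynomial (Fin N) ℝ,
      MvPolynomial.pderiv i (MvPolynomial.pderiv j q) =
        MvPolynomial.pderiv j (MvPolynomial.pderiv i q) := by
    intro i j q
    refine MvPolynomial.funext fun x => ?_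
    have e : ∀ i j : Fin N, MvPolynomial.eval x (MvPolynomial.pderiv i (MvPolynomial.pderiv j q)) =
        partialDeriv i (partialDeriv j fun y => MvPolynomial.eval y q) x := by
      intro i j
      rw [← partialDeriv_eval]
      congr 1
      funext y
      rw [partialDeriv_eval]
    rw [e, e, partialDeriv_comm (contDiff_eval q)]
  refine MvPolynomial.funext fun x => ?_
  simp only [polyD, map_sum, Derivation.map_smul, smul_sum, Pi.zero_apply, map_zero,
    MvPolynomial.smul_eval]
  refine sum_erase_antisymm L _ fun i hi j hj hij => ?_
  rw [← mul_assoc, insSign_mul_insSign hij hi hj, erase_right_comm, h]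
  ring

/-- A closed polynomial form without traces is exact up to a form that is constant in the given
directions. -/
theorem ZeroCoeffs.exists_homotopy {T : Cell N} {k : ℕ} {s : ℤ}
    {p : Finset (Fin N) → MvPolynomial (Fin N) ℝ} (hp : ZeroCoeffs T (k + 1) s p)
    (hd : polyD p = 0) (t : Finset (Fin N)) (ht : t ⊆ T.dirs) :
    ∃ q p', ZeroCoeffs T k (s + 1) q ∧ ZeroCoeffs T (k + 1) s p' ∧ polyD q = p - p' ∧
      (∀ J, ¬ t ⊆ J → p' J = 0) ∧ ∀ J, ∀ i ∈ t, substVar i (T.lo i) (p' J) = p' J := by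
  induction t using Finset.induction_on with
  | empty => exact ⟨0, p, ZeroCoeffs.zero, hp, by rw [polyD_zero, sub_self], by simp, by simp⟩
  | insert i t hit ih =>
    obtain ⟨q, p', hq, hp', hqp, h1, h2⟩ := ih ((subset_insert _ _).trans ht)
    have hi := ht (mem_insert_self i t)
    have hd' : polyD p' = 0 := by
      have h3 := polyD_polyD q
      rwa [hqp, polyD_sub, hd, zero_sub, neg_eq_zero] at h3
    -- The homotopy in the new direction acts on the remainder p', not on p, so each direction
    -- raises the degree of the primitive only from s to s + 1.
    refine ⟨q + CubeFES.homForm T i p', CubeFES.meanForm T i p', hq.add (hp'.homForm hi), hp'.meanForm hi, ?_,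
      fun J hJ => ?_, fun J j hj => ?_⟩
    · rw [polyD_add, hqp, hp'.polyD_homForm hd' hi]
      abel
    · unfold CubeFES.meanForm
      split_ifs with hiJ
      · rw [h1 J fun htJ => hJ (insert_subset hiJ htJ), map_zero]
      · rfl
    · unfold CubeFES.meanForm
      split_ifs with hiJ
      · by_cases hij : j = i
        · subst hij
          rw [substVar_meanVar_self]
        · rw [substVar_meanVar (Ne.symm hij), h2 J j ((mem_insert.1 hj).resolve_left hij)]
      · exact map_zero _

/-! ### Polynomial forms without traces -/

theorem eval_eq_eval_piecewise {c : Fin N → ℝ} {q : MvPolynomial (Fin N) ℝ} {s : Finset (Fin N)}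
    (h : ∀ i ∈ s, substVar i (c i) q = q) (x : Fin N → ℝ) :
    MvPolynomial.eval x q = MvPolynomial.eval (s.piecewise c x) q := by
  induction s using Finset.induction_on with
  | empty => simp
  | insert i s hi ih =>
    rw [ih fun j hj => h j (mem_insert_of_mem hj), piecewise_insert, ← eval_substVar,
      h i (mem_insert_self i s)]

/-- On a degenerate box a polynomial function has many representatives; freezing the variables of
the non-free directions selects one, without raising the degree. -/
theorem exists_substVar_eq (s : Finset (Fin N)) (c : Fin N → ℝ) {m : ℤ}
    {q : MvPolynomial (Fin N) ℝ} (hq : q ∈ degLE N m) :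
    ∃ q' ∈ degLE N m, (∀ j ∈ s, substVar j (c j) q' = q') ∧
      ∀ x : Fin N → ℝ, (∀ j ∈ s, x j = c j) → MvPolynomial.eval x q' = MvPolynomial.eval x q := by
  induction s using Finset.induction_on with
  | empty => exact ⟨q, hq, by simp, fun _ _ => rfl⟩
  | insert i s hi ih =>
    obtain ⟨q', h1, h2, h3⟩ := ih
    refine ⟨substVar i (c i) q', substVar_mem_degLE h1 _ _, fun j hj => ?_, fun x hx => ?_⟩
    · by_cases hij : j = i
      · subst hij
        exact substVar_idem _ _ _ _
      · rw [substVar_comm hij, h2 j ((mem_insert.1 hj).resolve_left hij)]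
    · rw [eval_substVar, ← hx i (mem_insert_self i s), Function.update_eq_self]
      exact h3 x fun j hj => hx j (mem_insert_of_mem hj)

theorem Cell.eq_lo_of_mem_box {T : Cell N} {x : Fin N → ℝ} (hx : x ∈ T.box) {j : Fin N}
    (hj : j ∉ T.dirs) : x j = T.lo j :=
  le_antisymm ((hx.2 j).trans (Cell.lo_eq_hi hj).ge) (hx.1 j)

/-- The free variables run through infinite sets, and the others do not occur in q. -/
theorem eq_zero_of_eval_box {T : Cell N} {q : MvPolynomial (Fin N) ℝ}
    (hq : ∀ j ∉ T.dirs, substVar j (T.lo j) q = q)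
    (h : ∀ x ∈ T.box, MvPolynomial.eval x q = 0) : q = 0 := by
  refine MvPolynomial.funext_set
    (fun i => if i ∈ T.dirs then Set.Icc (T.lo i) (T.hi i) else Set.univ) (fun i => ?_)
    fun x hx => ?_
  · split_ifs with hi
    · exact Set.Icc_infinite (Cell.mem_dirs.1 hi)
    · exact Set.infinite_univ
  · rw [map_zero, eval_eq_eval_piecewise (c := T.lo) (s := T.dirsᶜ)
      (fun j hj => hq j (mem_compl.1 hj))]
    refine h _ ⟨fun i => ?_, fun i => ?_⟩ <;> by_cases hi : i ∈ T.dirs <;>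
      simp [Finset.piecewise, hi]
    · have := hx i (Set.mem_univ i)
      simp only [hi, if_true] at this
      exact this.1
    · have := hx i (Set.mem_univ i)
      simp only [hi, if_true] at this
      exact this.2
    · exact T.lo_le_hi i

/-- The polynomial forms without traces. -/
def polyZero (T : Cell N) (s : ℤ) (k : ℕ) : Submodule ℝ (L2Form T k) where
  carrier := {u | u ∈ polyForms T s k ∧ IsTraceFree T u}
  add_mem' := by
    rintro _ _ ⟨ha, U, hU, rfl, hU0⟩ ⟨hb, V, hV, rfl, hV0⟩
    refine ⟨add_mem ha hb, U + V, hU.add hV, rfl, fun F hF => ?_⟩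
    rw [Pi.add_apply, hU0 F hF, hV0 F hF, add_zero]
  zero_mem' := ⟨zero_mem _, 0, isTraceFamily_zero, rfl, fun _ _ => rfl⟩
  smul_mem' := by
    rintro c _ ⟨ha, U, hU, rfl, hU0⟩
    refine ⟨Submodule.smul_mem _ _ ha, c • U, hU.smul c, rfl, fun F hF => ?_⟩
    rw [Pi.smul_apply, hU0 F hF, smul_zero]

theorem IsTraceFree.eq_zero {T : Cell N} {k : ℕ} {U : ∀ F : Cell N, L2Form F k}
    (h : IsTraceFree T (U T)) (hU : IsTraceFamily T U) {F : Cell N} (hF : F.IsProperFace T) :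
    U F = 0 := by
  obtain ⟨V, hV, hVU, h0⟩ := h
  rw [hU.unique hV hVU.symm hF.1, h0 F hF]

theorem IsTraceFamily.isTraceFree {T : Cell N} {k : ℕ} {U : ∀ F : Cell N, L2Form F k}
    (hU : IsTraceFamily T U) (h : ∀ i ∈ T.dirs, ∀ b, U (T.facet i b) = 0) :
    IsTraceFree T (U T) := by
  refine ⟨U, hU, rfl, fun F hF => ?_⟩
  obtain ⟨i, hi, b, hFi⟩ := hF.exists_facet
  exact (hU.face (T.facet_isFace i b)).eq_zero (h i hi b) hFi

theorem IsTraceFree.deriv {T : Cell N} {k : ℕ} {U : ∀ F : Cell N, L2Form F k}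
    {W : ∀ F : Cell N, L2Form F (k + 1)} (h : IsTraceFree T (U T)) (hW : IsD T U W) :
    IsTraceFree T (W T) :=
  ⟨W, hW.deriv.isTraceFamily, rfl, fun F hF =>
    ((hW.face hF.1).eq_zero (h.eq_zero hW.isTraceFamily hF) (Cell.IsFace.refl F)).2⟩

theorem IsTraceFree.topInt_deriv {T : Cell N} {k : ℕ} {U : ∀ F : Cell N, L2Form F k}
    {W : ∀ F : Cell N, L2Form F (k + 1)} (h : IsTraceFree T (U T)) (hW : IsD T U W) :
    topInt T (W T) = 0 := by
  rcases T.dirs.eq_empty_or_nonempty with he | ⟨i, hi⟩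
  · have hdim : T.dim = 0 := by rw [Cell.dim, he, card_empty]
    exact topInt_eq_zero (by omega) _
  · have h0 : ∀ j ∈ T.dirs, ∀ c, U (T.facet j c) = 0 := fun j hj c =>
      h.eq_zero hW.isTraceFamily (Cell.facet_isProperFace hj c)
    obtain ⟨ε, -, hε⟩ := hW.exists_topInt hi true fun j hj c _ => h0 j hj c
    rw [hε, h0 i hi, topInt_zero, mul_zero]

namespace ZeroCoeffs

variable {T : Cell N} {k : ℕ} {s : ℤ} {p : Finset (Fin N) → MvPolynomial (Fin N) ℝ}

theorem mem_polyZero (hp : ZeroCoeffs T k s p) : polyForm T k p ∈ polyZero T s k := by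
  refine ⟨mem_polyForms_iff.2 ⟨p, hp.deg, rfl⟩,
    (isD_polyForm T k p).isTraceFamily.isTraceFree fun i hi b => ?_⟩
  refine L2Form.ext fun J hJ hk => ?_
  rw [polyForm_apply _ hJ hk]
  refine polyLp_eq_zero_iff.2 fun x hx => ?_
  rw [Cell.facet_dirs] at hJ
  obtain ⟨h1, h2⟩ := hp.vanish J i hi fun h => notMem_erase i _ (hJ h)
  have h3 := Cell.eq_lo_of_mem_box hx (j := i) (by simp [Cell.facet_dirs])
  rw [Cell.facet_lo_self] at h3
  rw [← Function.update_eq_self i x, ← eval_substVar, h3]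
  cases b <;> simp [h1, h2]

theorem polyD_eq_zero (hp : ZeroCoeffs T k s p) (h : IsExtDeriv T (polyForm T k p) 0) :
    polyD p = 0 := by
  funext L
  have hind : ∀ j ∉ T.dirs, ∀ J, MvPolynomial.pderiv j (p J) = 0 := fun j hj J => by
    rw [← hp.indep J j hj, pderiv_substVar_self]
  by_cases hL : L ⊆ T.dirs ∧ #L = k + 1
  · have h1 := (isD_polyForm T k p).eq_of_isExtDeriv h
    have h2 := congrArg (fun w : L2Form T (k + 1) => w.1 L) h1
    rw [polyForm_apply _ hL.1 hL.2] at h2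
    refine eq_zero_of_eval_box (T := T) (fun j hj => ?_) (polyLp_eq_zero_iff.1 h2.symm)
    simp only [polyD, map_sum, map_smul]
    refine sum_congr rfl fun i hi => ?_
    have hij : i ≠ j := fun h => hj (h ▸ hL.1 hi)
    rw [← pderiv_substVar hij, hp.indep _ j hj]
  · refine sum_eq_zero fun i hi => ?_
    by_cases hid : i ∈ T.dirs
    · rw [hp.supp (L.erase i), map_zero, smul_zero]
      rintro ⟨h1, h2⟩
      rw [card_erase_of_mem hi] at h2
      have := card_pos.2 ⟨i, hi⟩
      refine hL ⟨?_, by omega⟩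
      rw [← insert_erase hi]
      exact insert_subset hid h1
    · rw [hind i hid, smul_zero]

end ZeroCoeffs

/-- For normalised coefficients, identities that hold on a box hold as identities of polynomials.
Zero traces thus become vanishing under substitution of the two ends. -/
theorem exists_zeroCoeffs {T : Cell N} {k : ℕ} {s : ℤ} {u : L2Form T k}
    (hu : u ∈ polyZero T s k) : ∃ p, ZeroCoeffs T k s p ∧ polyForm T k p = u := by
  classical
  obtain ⟨p, hp, rfl⟩ := mem_polyForms_iff.1 hu.1
  choose q hq1 hq2 hq3 using fun J => exists_substVar_eq T.dirsᶜ T.lo (hp J)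
  set q' : Finset (Fin N) → MvPolynomial (Fin N) ℝ :=
    fun J => if J ⊆ T.dirs ∧ #J = k then q J else 0 with hq'
  have hqi : ∀ J, ∀ j ∉ T.dirs, substVar j (T.lo j) (q' J) = q' J := by
    intro J j hj
    simp only [hq']
    split_ifs
    · exact hq2 J j (mem_compl.2 hj)
    · exact map_zero _
  have hqp : polyForm T k q' = polyForm T k p := by
    refine L2Form.ext fun J hJ hk => ?_
    rw [polyForm_apply _ hJ hk, polyForm_apply _ hJ hk, ← sub_eq_zero, ← map_sub]
    refine polyLp_eq_zero_iff.2 fun x hx => ?_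
    simp only [hq', hJ, hk, and_self, if_true]
    rw [map_sub, hq3 J x fun j hj => Cell.eq_lo_of_mem_box hx (mem_compl.1 hj), sub_self]
  refine ⟨q', ⟨fun J hJ => if_neg hJ, hqi, fun J i hi hiJ => ?_, fun J => ?_⟩, hqp⟩
  · by_cases hJ : J ⊆ T.dirs ∧ #J = k
    · have htr : IsTraceFree T (polyForm T k q') := hqp ▸ hu.2
      have key : ∀ b : Bool, substVar i (if b then T.hi i else T.lo i) (q' J) = 0 := by
        intro b
        have h1 : polyForm (T.facet i b) k q' = 0 :=
          IsTraceFree.eq_zero (U := fun F => polyForm F k q') htr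
            (isD_polyForm T k q').isTraceFamily (Cell.facet_isProperFace hi b)
        have h2 := congrArg (fun w : L2Form (T.facet i b) k => w.1 J) h1
        rw [polyForm_apply _ (by rw [Cell.facet_dirs]; exact subset_erase.2 ⟨hJ.1, hiJ⟩) hJ.2] at h2
        refine eq_zero_of_eval_box (T := T) (fun j hj => ?_) fun x hx => ?_
        · have hij : j ≠ i := fun h => hj (h ▸ hi)
          rw [substVar_comm hij, hqi J j hj]
        · rw [eval_substVar]
          refine polyLp_eq_zero_iff.1 h2 _ ⟨fun j => ?_, fun j => ?_⟩ <;> by_cases hij : j = i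
          · subst hij
            rw [Cell.facet_lo_self, Function.update_self]
          · rw [Cell.facet_lo_ne _ _ hij, Function.update_of_ne hij]
            exact hx.1 j
          · subst hij
            rw [Cell.facet_hi_self, Function.update_self]
          · rw [Cell.facet_hi_ne _ _ hij, Function.update_of_ne hij]
            exact hx.2 j
      exact ⟨by simpa using key false, by simpa using key true⟩
    · simp only [hq', if_neg hJ, map_zero, and_self]
  · simp only [hq']
    split_ifs
    · exact hq1 J
    · exact zero_mem _

/-- The complex of polynomial forms without traces has no cohomology but that detected by the
integral. -/
theorem exists_polyZero_primitive {T : Cell N} {k : ℕ} {s : ℤ} {u : L2Form T (k + 1)}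
    (hu : u ∈ polyZero T s (k + 1)) (hd : IsExtDeriv T u 0) (h0 : topInt T u = 0) :
    ∃ v ∈ polyZero T (s + 1) k, IsExtDeriv T v u := by
  obtain ⟨p, hp, rfl⟩ := exists_zeroCoeffs hu
  obtain ⟨q, p', hq, hp', hqp, h1, h2⟩ := hp.exists_homotopy (hp.polyD_eq_zero hd) T.dirs subset_rfl
  have hD := isD_polyForm T k q
  -- After homotopies in all free directions only a constant multiple of the volume form is left.
  -- Its integral is that of u, since derivatives of trace-free forms have integral zero; so it
  -- vanishes.
  have hp0 : p' = 0 := by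
    funext J
    by_cases hJ : T.dirs ⊆ J
    · by_cases hJ' : J ⊆ T.dirs ∧ #J = k + 1
      · obtain rfl : J = T.dirs := subset_antisymm hJ'.1 hJ
        have h3 := hq.mem_polyZero.2.topInt_deriv (U := fun F => polyForm F k q) hD
        rw [hqp, map_sub, topInt_sub, h0, zero_sub, neg_eq_zero, topInt,
          polyForm_apply _ subset_rfl hJ'.2, pairing_polyLp] at h3
        have h4 : ∀ x, MvPolynomial.eval x (p' T.dirs) = MvPolynomial.eval T.lo (p' T.dirs) := by
          intro x
          rw [eval_eq_eval_piecewise (c := T.lo) (s := univ) fun i _ => ?_]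
          · rw [piecewise_univ]
          · by_cases hi : i ∈ T.dirs
            · exact h2 _ i hi
            · exact hp'.indep _ i hi
        simp only [h4, mul_one, integral_const, smul_eq_mul, mul_eq_zero,
          T.measureReal_univ_ne_zero, false_or] at h3
        refine MvPolynomial.funext fun x => ?_
        rw [h4 x, h3]
        simp
      · exact hp'.supp J hJ'
    · exact h1 J hJ
  rw [hp0, sub_zero] at hqp
  refine ⟨_, hq.mem_polyZero, ?_⟩
  have := hD.isExtDeriv (Cell.IsFace.refl T)
  rwa [hqp] at this

/-- The volume form. -/
theorem exists_polyZero_topInt {T : Cell N} {k : ℕ} (hk : k = T.dim) {s : ℤ} (hs : 0 ≤ s) :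
    ∃ u ∈ polyZero T s k, topInt T u ≠ 0 := by
  subst hk
  refine ⟨polyForm T T.dim fun _ => MvPolynomial.C 1, ⟨mem_polyForms_iff.2
    ⟨_, fun _ => C_mem_degLE hs 1, rfl⟩, (isD_polyForm T T.dim _).isTraceFamily.isTraceFree
    fun i hi b => L2Form.eq_zero_of_dim_lt (Cell.facet_isProperFace hi b).dim_lt _⟩, ?_⟩
  rw [topInt, polyForm_apply (k := T.dim) (J := T.dirs) _ subset_rfl rfl, pairing_polyLp]
  simpa using T.measureReal_univ_ne_zero

theorem const_mem_polyForms {T : Cell N} {s : ℤ} (hs : 0 ≤ s) {u : L2Form T 0} {c : ℝ}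
    (hu : u.1 ∅ =ᵐ[T.measure] fun _ => c) : u ∈ polyForms T s 0 := by
  refine mem_polyForms_iff.2 ⟨fun _ => MvPolynomial.C c, fun _ => C_mem_degLE hs c, ?_⟩
  refine L2Form.ext fun J hJ hk => ?_
  rw [polyForm_apply _ hJ hk]
  obtain rfl := card_eq_zero.1 hk
  exact Lp.ext ((coeFn_polyLp T _).trans ((by simp : (fun x => MvPolynomial.eval x
    (MvPolynomial.C c : MvPolynomial (Fin N) ℝ)) =ᵐ[T.measure] fun _ => c).trans hu.symm))

/-- Take P plus a complement of P ⊔ Z. No inclusion between P and Z is needed. -/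
theorem exists_relative_complement {V : Type*} [AddCommGroup V] [Module ℝ V] (P Z : Submodule ℝ V) :
    ∃ G : Submodule ℝ V, P ≤ G ∧ G ⊓ Z ≤ P ∧ G ⊔ Z = ⊤ := by
  obtain ⟨D, hD⟩ := Submodule.exists_isCompl (P ⊔ Z)
  refine ⟨P ⊔ D, le_sup_left, ?_, ?_⟩
  · rintro x ⟨hx, hz⟩
    obtain ⟨p, hp, d, hd, rfl⟩ := Submodule.mem_sup.1 hx
    have h1 : d ∈ P ⊔ Z := by
      have := sub_mem (Submodule.mem_sup_right (S := P) hz) (Submodule.mem_sup_left (T := Z) hp)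
      rwa [add_sub_cancel_left] at this
    have h2 := (Submodule.disjoint_def.1 hD.disjoint) d h1 hd
    rw [h2, add_zero]
    exact hp
  · rw [sup_right_comm, hD.sup_eq_top]

namespace FES

variable {C : CubicalComplex N} {A : FES C} {T : Cell N} {k r : ℕ}

/-! ### The minimal subsystem -/

/-- The forms in `A^k_0(T)` whose exterior derivatives are polynomial forms of the right degree. -/
def almostClosed (A : FES C) (r : ℕ) (T : Cell N) (k : ℕ) : Submodule ℝ (L2Form T k) where
  carrier := {u | ∃ U W, IsD T U W ∧ U T = u ∧ u ∈ A.zeroSubmodule T k ∧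
    W T ∈ polyZero T ((r : ℤ) - (k + 1 : ℕ)) (k + 1)}
  add_mem' := by
    rintro _ _ ⟨U, W, hW, rfl, hU, hWT⟩ ⟨U', W', hW', rfl, hU', hWT'⟩
    exact ⟨U + U', W + W', hW.add hW', rfl, add_mem hU hU', add_mem hWT hWT'⟩
  zero_mem' := ⟨0, 0, isD_zero, rfl, zero_mem _, zero_mem _⟩
  smul_mem' := by
    rintro c _ ⟨U, W, hW, rfl, hU, hWT⟩
    exact ⟨c • U, c • W, hW.smul c, rfl, Submodule.smul_mem _ _ hU, Submodule.smul_mem _ _ hWT⟩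

theorem exists_complementSpace (A : FES C) (r : ℕ) (T : Cell N) (k : ℕ) :
    ∃ G : Submodule ℝ (L2Form T k), polyForms T ((r : ℤ) - k) k ≤ G ∧
      G ⊓ A.almostClosed r T k ≤ polyForms T ((r : ℤ) - k) k ∧ G ⊔ A.almostClosed r T k = ⊤ :=
  exists_relative_complement _ _

/-- A complement of the almost closed forms relative to the polynomial forms. -/
def complementSpace (A : FES C) (r : ℕ) (T : Cell N) (k : ℕ) : Submodule ℝ (L2Form T k) :=
  (A.exists_complementSpace r T k).choose

theorem polyForms_le_complementSpace :
    polyForms T ((r : ℤ) - k) k ≤ A.complementSpace r T k :=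
  (A.exists_complementSpace r T k).choose_spec.1

theorem complementSpace_inf_le :
    A.complementSpace r T k ⊓ A.almostClosed r T k ≤ polyForms T ((r : ℤ) - k) k :=
  (A.exists_complementSpace r T k).choose_spec.2.1

theorem complementSpace_sup : A.complementSpace r T k ⊔ A.almostClosed r T k = ⊤ :=
  (A.exists_complementSpace r T k).choose_spec.2.2

/-- The spaces of the minimal subsystem. -/
def minSpace (A : FES C) (r : ℕ) (T : Cell N) (k : ℕ) : Submodule ℝ (L2Form T k) where
  carrier := {u | u ∈ A.space T k ∧ ∃ U W, IsD T U W ∧ U T = u ∧ ∀ F : Cell N, F.IsFace T →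
    U F ∈ A.complementSpace r F k ∧ W F ∈ A.complementSpace r F (k + 1)}
  add_mem' := by
    rintro _ _ ⟨ha, U, W, hW, rfl, hU⟩ ⟨hb, U', W', hW', rfl, hU'⟩
    exact ⟨add_mem ha hb, U + U', W + W', hW.add hW', rfl, fun F hF =>
      ⟨add_mem (hU F hF).1 (hU' F hF).1, add_mem (hU F hF).2 (hU' F hF).2⟩⟩
  zero_mem' := ⟨zero_mem _, 0, 0, isD_zero, rfl, fun F _ => ⟨zero_mem _, zero_mem _⟩⟩
  smul_mem' := by
    rintro c _ ⟨ha, U, W, hW, rfl, hU⟩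
    exact ⟨Submodule.smul_mem _ _ ha, c • U, c • W, hW.smul c, rfl, fun F hF =>
      ⟨Submodule.smul_mem _ _ (hU F hF).1, Submodule.smul_mem _ _ (hU F hF).2⟩⟩

theorem minSpace_le : A.minSpace r T k ≤ A.space T k := fun _ h => h.1

theorem mem_minSpace {U : ∀ F : Cell N, L2Form F k} {W : ∀ F : Cell N, L2Form F (k + 1)}
    (h : IsD T U W) : U T ∈ A.minSpace r T k ↔ U T ∈ A.space T k ∧ ∀ F : Cell N, F.IsFace T →
      U F ∈ A.complementSpace r F k ∧ W F ∈ A.complementSpace r F (k + 1) := by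
  constructor
  · rintro ⟨ha, U', W', hW', hU', hG⟩
    refine ⟨ha, fun F hF => ?_⟩
    rw [← hW'.isTraceFamily.unique h.isTraceFamily hU' hF, ← hW'.unique h hU' hF]
    exact hG F hF
  · rintro ⟨ha, hG⟩
    exact ⟨ha, U, W, h, rfl, hG⟩

/-- A subsystem of `A` with the same polynomial forms. -/
def minSystem (A : FES C) (r : ℕ) : FES C where
  space := A.minSpace r
  finiteDimensional T hT k := by
    have := A.finiteDimensional T hT k
    exact Submodule.finiteDimensional_of_le minSpace_le
  subset_fullSpace T hT k u hu := A.subset_fullSpace T hT k u hu.1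
  extDeriv_mem T hT k u hu w hw := by
    obtain ⟨ha, U, W, hW, rfl, hG⟩ := hu
    rw [hW.eq_of_isExtDeriv hw, mem_minSpace hW.deriv]
    exact ⟨A.deriv_mem hT hW ha, fun F hF => ⟨(hG F hF).2, zero_mem _⟩⟩
  pullback_mem T hT k U hU hUT F hF := by
    obtain ⟨W, hW⟩ := isTraceFamily_iff.1 hU
    rw [mem_minSpace hW] at hUT
    rw [mem_minSpace (hW.face hF)]
    exact ⟨A.face_mem hT hU hUT.1 hF, fun E hE => hUT.2 E (hE.trans hF)⟩

theorem polyForms_le_minSpace (hT : T ∈ C.cells) (hP : A.ContainsPoly r) :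
    polyForms T ((r : ℤ) - k) k ≤ A.minSpace r T k := by
  intro u hu
  obtain ⟨U, W, hW, rfl, h⟩ := exists_family_of_mem_polyForms hu
  refine (mem_minSpace hW).2 ⟨hP T hT k hu, fun F _ =>
    ⟨polyForms_le_complementSpace (h F).1, polyForms_le_complementSpace ?_⟩⟩
  have := (h F).2
  rwa [sub_sub, ← Nat.cast_add_one] at this

theorem containsPoly_minSystem (hP : A.ContainsPoly r) : (A.minSystem r).ContainsPoly r :=
  fun _ hT _ => polyForms_le_minSpace hT hP

/-- The condition on complements is used twice: first on du, which is closed and hence almost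
closed, then on u, which is almost closed because du has just been found to be polynomial. -/
theorem zeroSubmodule_minSystem (hT : T ∈ C.cells) (hP : A.ContainsPoly r) :
    (A.minSystem r).zeroSubmodule T k = polyZero T ((r : ℤ) - k) k := by
  ext u
  constructor
  · rintro ⟨⟨ha, U, W, hW, rfl, hG⟩, h0⟩
    refine ⟨?_, h0⟩
    have h1 := hG T (Cell.IsFace.refl T)
    have hW0 := h0.deriv hW
    have h2 : W T ∈ A.almostClosed r T (k + 1) :=
      ⟨W, 0, hW.deriv, rfl, ⟨A.deriv_mem hT hW ha, hW0⟩, zero_mem _⟩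
    have h3 := complementSpace_inf_le ⟨h1.2, h2⟩
    exact complementSpace_inf_le ⟨h1.1, U, W, hW, rfl, ⟨ha, h0⟩, h3, hW0⟩
  · exact fun hu => ⟨polyForms_le_minSpace hT hP hu.1, hu.2⟩

/-! ### Compatibility of the minimal subsystem -/

theorem rel_univ_iff {U : ∀ F : Cell N, L2Form F k} :
    A.Rel T univ U ↔ IsTraceFamily T U ∧ U T ∈ A.zeroSubmodule T k := by
  constructor
  · rintro ⟨h1, h2, h3⟩
    exact ⟨h1, h2, h1.isTraceFree fun i hi b => h3 (i, b) (mem_univ _) hi⟩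
  · rintro ⟨h1, h2, h3⟩
    exact ⟨h1, h2, fun p _ hp => h3.eq_zero h1 (Cell.facet_isProperFace hp p.2)⟩

theorem polyZero_le_zeroSubmodule (hT : T ∈ C.cells) (hP : A.ContainsPoly r) :
    polyZero T ((r : ℤ) - k) k ≤ A.zeroSubmodule T k :=
  fun _ hu => ⟨hP T hT k hu.1, hu.2⟩

/-- The complex `A_0(T)` modulo polynomial forms is exact. -/
theorem exists_of_almostClosed (hz : A.ZeroExact T) (hT : T ∈ C.cells) (hr : T.dim ≤ r)
    (hP : A.ContainsPoly r) {z : L2Form T (k + 1)} (hzz : z ∈ A.almostClosed r T (k + 1)) :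
    ∃ U W, IsD T U W ∧ U T ∈ A.zeroSubmodule T k ∧
      z - W T ∈ polyZero T ((r : ℤ) - (k + 1 : ℕ)) (k + 1) := by
  obtain ⟨Z, W, hW, rfl, hZ, hWT⟩ := hzz
  have hWc := hW.deriv.isExtDeriv (Cell.IsFace.refl T)
  -- The derivative of z is a closed trace-free polynomial form with integral zero. It has a
  -- polynomial primitive v one degree higher, so z - v is closed.
  obtain ⟨v, hv, hvW⟩ := exists_polyZero_primitive hWT hWc (hZ.2.topInt_deriv hW)
  rw [show (r : ℤ) - (k + 1 + 1 : ℕ) + 1 = (r : ℤ) - (k + 1 : ℕ) by push_cast; ring] at hv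
  obtain ⟨V, X, hVX, rfl, -⟩ := exists_family_of_mem_polyForms hv.1
  have hXW : X T = W T := (hVX.eq_of_isExtDeriv hvW).symm
  -- In top degree a polynomial volume form absorbs the integral of z - v. Its degree bound r - dim
  -- T is nonnegative by `hr`.
  have hvol : ∃ u ∈ polyZero T ((r : ℤ) - (k + 1 : ℕ)) (k + 1), IsExtDeriv T u 0 ∧
      topInt T u = topInt T ((Z - V) T) := by
    by_cases hk : k + 1 = T.dim
    · obtain ⟨u, hu, hne⟩ := exists_polyZero_topInt hk (s := (r : ℤ) - (k + 1 : ℕ))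
        (sub_nonneg.2 (by rw [hk]; exact_mod_cast hr))
      refine ⟨(topInt T ((Z - V) T) / topInt T u) • u, Submodule.smul_mem _ _ hu, ?_, ?_⟩
      · obtain ⟨U', W', hW', hU', -⟩ := exists_family_of_mem_polyForms hu.1
        have h1 := (hW'.smul (topInt T ((Z - V) T) / topInt T u)).isExtDeriv (Cell.IsFace.refl T)
        rw [Pi.smul_apply, hU', L2Form.eq_zero_of_dim_lt (by omega) (((_ : ℝ) • W') T)] at h1
        exact h1
      · rw [topInt_smul, div_mul_cancel₀ _ hne]
    · refine ⟨0, zero_mem _, stokesFormula_zero.isExtDeriv, ?_⟩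
      rw [topInt_eq_zero hk, topInt_eq_zero hk]
  obtain ⟨u, hu, hud, hint⟩ := hvol
  obtain ⟨U', W', hW', rfl, -⟩ := exists_family_of_mem_polyForms hu.1
  have hd : IsD T (Z - V - U') 0 := by
    refine ((hW.isTraceFamily.sub hVX.isTraceFamily).sub hW'.isTraceFamily).isD_zero_of_isExtDeriv ?_
    have h1 := ((hW.sub hVX).sub hW').isExtDeriv (Cell.IsFace.refl T)
    have h2 : (W - X - W') T = 0 := by
      rw [Pi.sub_apply, Pi.sub_apply, hXW, sub_self, ← hW'.eq_of_isExtDeriv hud, sub_self]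
    rwa [h2] at h1
  have hle := polyZero_le_zeroSubmodule (k := k + 1) hT hP
  have hmem : (Z - V - U') T ∈ A.zeroSubmodule T (k + 1) := sub_mem (sub_mem hZ (hle hv)) (hle hu)
  obtain ⟨Y, hY, hYZ⟩ := hz.2 k (Z - V - U') (rel_univ_iff.2 ⟨hd.isTraceFamily, hmem⟩) hd
    (by rw [Pi.sub_apply, topInt_sub, hint, sub_self])
  refine ⟨Y, _, hYZ, (rel_univ_iff.1 hY).2, ?_⟩
  have : Z T - (Z - V - U') T = V T + U' T := by
    simp only [Pi.sub_apply]
    abel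
  rw [this]
  exact add_mem hv hu

/-- An extension V in A is corrected by two trace-free forms: Y brings dV into the chosen
complement, then Z' brings V - Y into its own. Subtracting Z' does not spoil the first correction,
because its derivative is polynomial and the complements contain the polynomial forms. -/
theorem admitsExtensions_minSystem (hA : A.Compatible) (hr : ∀ T ∈ C.cells, T.dim ≤ r)
    (hP : A.ContainsPoly r) : (A.minSystem r).AdmitsExtensions := by
  intro T hT k U hU
  obtain ⟨V, hV, hVT, hVU⟩ := hA.1 T hT k U fun F hF => ⟨minSpace_le (hU F hF).1, (hU F hF).2⟩
  obtain ⟨W, hW⟩ := isTraceFamily_iff.1 hV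
  have hz : A.ZeroExact T := zeroExact_of_locallyExact hA.1 hT fun F hF => hA.2 F (C.face_mem hT hF)
  obtain ⟨g, hg, z, hzz, hgz⟩ := Submodule.mem_sup.1
    (complementSpace_sup (A := A) (r := r) (T := T) (k := k + 1) ▸ Submodule.mem_top (x := W T))
  obtain ⟨Y, X, hYX, hY, hp⟩ := exists_of_almostClosed hz hT (hr T hT) hP hzz
  obtain ⟨g', hg', z', hzz', hgz'⟩ := Submodule.mem_sup.1
    (complementSpace_sup (A := A) (r := r) (T := T) (k := k) ▸ Submodule.mem_top (x := (V - Y) T))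
  obtain ⟨Z', X', hZX', rfl, hZ', hX'⟩ := hzz'
  have hD := (hW.sub hYX).sub hZX'
  have h0 : ∀ F : Cell N, F.IsProperFace T → (V - Y - Z') F = U F := by
    intro F hF
    rw [Pi.sub_apply, Pi.sub_apply, hY.2.eq_zero hYX.isTraceFamily hF,
      hZ'.2.eq_zero hZX'.isTraceFamily hF, sub_zero, sub_zero, hVU F hF]
  refine ⟨V - Y - Z', hD.isTraceFamily, ?_, h0⟩
  change _ ∈ A.minSpace r T k
  refine (mem_minSpace hD).2 ⟨sub_mem (sub_mem hVT hY.1) hZ'.1, fun F hF => ?_⟩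
  by_cases hFT : F = T
  · subst hFT
    constructor
    · have : (V - Y - Z') F = g' := by
        rw [Pi.sub_apply, ← hgz', add_sub_cancel_right]
      rw [this]
      exact hg'
    · have : (W - X - X') F = g + (z - X F) - X' F := by
        rw [Pi.sub_apply, Pi.sub_apply, ← hgz]
        abel
      rw [this]
      exact sub_mem (add_mem hg (polyForms_le_complementSpace hp.1))
        (polyForms_le_complementSpace hX'.1)
  · have hF' : F.IsProperFace T := ⟨hF, hFT⟩
    have h1 := (hU F hF').1
    rw [← h0 F hF'] at h1
    exact ((mem_minSpace (hD.face hF)).1 h1).2 F (Cell.IsFace.refl F)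

/-- Local exactness is checked on the trace-free complexes alone, which are now polynomial:
homotopies give primitives, volume forms give nonzero integrals, and degree zero is inherited from
A. -/
theorem compatible_minSystem (hA : A.Compatible) (hr : ∀ T ∈ C.cells, T.dim ≤ r)
    (hP : A.ContainsPoly r) : (A.minSystem r).Compatible := by
  have hE := admitsExtensions_minSystem hA hr hP
  refine ⟨hE, locallyExact_of_zeroExact hE (fun T hT => ?_) (fun T hT => ?_) fun T hT u => ?_⟩
  · have hz : A.ZeroExact T :=
      zeroExact_of_locallyExact hA.1 hT fun F hF => hA.2 F (C.face_mem hT hF)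
    refine ⟨fun U hU => hz.1 U ⟨hU.1, minSpace_le hU.2.1, hU.2.2⟩, fun k U hU hd hint => ?_⟩
    obtain ⟨h1, h2⟩ := rel_univ_iff.1 hU
    rw [zeroSubmodule_minSystem hT hP] at h2
    obtain ⟨v, hv, hvU⟩ := exists_polyZero_primitive h2 (hd.isExtDeriv (Cell.IsFace.refl T)) hint
    rw [show (r : ℤ) - (k + 1 : ℕ) + 1 = (r : ℤ) - k by push_cast; ring] at hv
    obtain ⟨V, W, hW, rfl, -⟩ := exists_family_of_mem_polyForms hv.1
    refine ⟨V, rel_univ_iff.2 ⟨hW.isTraceFamily, ?_⟩, hW.congr (fun _ _ => rfl) fun F hF =>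
      hW.deriv.isTraceFamily.unique h1 (hW.eq_of_isExtDeriv hvU).symm hF⟩
    rw [zeroSubmodule_minSystem hT hP]
    exact hv
  · obtain ⟨u, hu, hne⟩ := exists_polyZero_topInt (T := T) rfl (s := (r : ℤ) - T.dim)
      (sub_nonneg.2 (by exact_mod_cast hr T hT))
    obtain ⟨U, W, hW, rfl, -⟩ := exists_family_of_mem_polyForms hu.1
    refine ⟨U, rel_univ_iff.2 ⟨hW.isTraceFamily, ?_⟩, hne⟩
    rw [zeroSubmodule_minSystem hT hP]
    exact hu
  · constructor
    · rintro ⟨h1, h2⟩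
      exact ((hA.2 T hT).1 u).1 ⟨minSpace_le h1, h2⟩
    · intro h
      refine ⟨?_, (((hA.2 T hT).1 u).2 h).2⟩
      obtain ⟨c, hc⟩ := h
      refine polyForms_le_minSpace hT hP (const_mem_polyForms ?_ hc)
      simp

/-- Minimality against `minSystem`, which is contained in A, leaves no room between the two. -/
theorem zeroSubmodule_eq_of_isMinimal (hr : ∀ T ∈ C.cells, T.dim ≤ r) (hA : A.IsMinimal r)
    (hT : T ∈ C.cells) : A.zeroSubmodule T k = polyZero T ((r : ℤ) - k) k := by
  obtain ⟨hc, hP, hmin⟩ := hA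
  have h1 := hmin _ (compatible_minSystem hc hr hP) (containsPoly_minSystem hP) T hT k
  have := A.finiteDimensional T hT k
  have h2 : A.minSpace r T k = A.space T k := Submodule.eq_of_le_of_finrank_le minSpace_le h1
  rw [← zeroSubmodule_minSystem hT hP]
  ext u
  rw [mem_zeroSubmodule, mem_zeroSubmodule, ← h2]
  rfl

theorem isMinimal_of_zeroSubmodule_eq (hA : A.Compatible) (hP : A.ContainsPoly r)
    (h : ∀ T ∈ C.cells, ∀ k : ℕ, A.zeroSubmodule T k = polyZero T ((r : ℤ) - k) k) :
    A.IsMinimal r := by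
  refine ⟨hA, hP, fun B hB hBP T hT k => finrank_le_of_zeroSubmodule_le hB.1 (fun F hF => ?_) hT⟩
  rw [h F hF k]
  exact polyZero_le_zeroSubmodule hF hBP

end FES

/-! ### Division by the boundary polynomials -/

theorem X_sub_C_dvd_sub_substVar (i : Fin N) (c : ℝ) (p : MvPolynomial (Fin N) ℝ) :
    MvPolynomial.X i - MvPolynomial.C c ∣ p - substVar i c p := by
  induction p using MvPolynomial.induction_on with
  | C a => simp
  | add p q hp hq =>
    rw [map_add, add_sub_add_comm]
    exact dvd_add hp hq
  | mul_X p j hp =>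
    have : p * MvPolynomial.X j - substVar i c (p * MvPolynomial.X j) =
        (p - substVar i c p) * MvPolynomial.X j +
          substVar i c p * (MvPolynomial.X j - substVar i c (MvPolynomial.X j)) := by
      rw [map_mul]
      ring
    rw [this]
    refine dvd_add (hp.mul_right _) (Dvd.dvd.mul_left ?_ _)
    by_cases h : j = i
    · subst h
      rw [substVar_X_self]
    · rw [substVar_X_ne h, sub_self]
      exact dvd_zero _

theorem mem_degLE_iff_totalDegree {s : ℤ} {p : MvPolynomial (Fin N) ℝ} (hp : p ≠ 0) :
    p ∈ degLE N s ↔ (p.totalDegree : ℤ) ≤ s := by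
  have hd : ∀ d : Fin N →₀ ℕ, d.degree = d.sum fun _ e => e := fun d => rfl
  constructor
  · intro h
    have hne : p.support.Nonempty := MvPolynomial.support_nonempty.2 hp
    obtain ⟨d, hds, hdt⟩ := exists_mem_eq_sup _ hne fun d : Fin N →₀ ℕ => d.sum fun _ e => e
    rw [MvPolynomial.totalDegree, hdt, ← hd]
    exact h d hds
  · intro h d hds
    have := MvPolynomial.le_totalDegree hds
    rw [← hd] at this
    omega

theorem X_sub_C_ne_zero (i : Fin N) (c : ℝ) :
    (MvPolynomial.X i - MvPolynomial.C c : MvPolynomial (Fin N) ℝ) ≠ 0 := by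
  intro h
  have := congrArg (MvPolynomial.eval fun _ => c + 1) h
  simp at this

theorem totalDegree_X_sub_C (i : Fin N) (c : ℝ) :
    (MvPolynomial.X i - MvPolynomial.C c : MvPolynomial (Fin N) ℝ).totalDegree = 1 := by
  refine le_antisymm ?_ ?_
  · have := (mem_degLE_iff_totalDegree (X_sub_C_ne_zero i c)).1 (X_sub_C_mem_degLE i c)
    exact_mod_cast this
  · have h1 : (MvPolynomial.X i - MvPolynomial.C c + MvPolynomial.C c :
      MvPolynomial (Fin N) ℝ).totalDegree = 1 := by
      rw [sub_add_cancel, MvPolynomial.totalDegree_X]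
    have h2 := MvPolynomial.totalDegree_add (MvPolynomial.X i - MvPolynomial.C c)
      (MvPolynomial.C c : MvPolynomial (Fin N) ℝ)
    rw [h1, MvPolynomial.totalDegree_C] at h2
    simpa using h2

theorem exists_eq_X_sub_C_mul {i : Fin N} {c : ℝ} {s : ℤ} {p : MvPolynomial (Fin N) ℝ}
    (hp : p ∈ degLE N s) (h : substVar i c p = 0) :
    ∃ q ∈ degLE N (s - 1), p = (MvPolynomial.X i - MvPolynomial.C c) * q := by
  obtain ⟨q, hq⟩ := X_sub_C_dvd_sub_substVar i c p
  rw [h, sub_zero] at hq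
  refine ⟨q, ?_, hq⟩
  by_cases hq0 : q = 0
  · rw [hq0]
    exact zero_mem _
  · have hp0 : p ≠ 0 := by
      rw [hq]
      exact mul_ne_zero (X_sub_C_ne_zero i c) hq0
    rw [mem_degLE_iff_totalDegree hp0, hq,
      MvPolynomial.totalDegree_mul_of_isDomain (X_sub_C_ne_zero i c) hq0,
      totalDegree_X_sub_C] at hp
    rw [mem_degLE_iff_totalDegree hq0]
    push_cast at hp
    linarith

/-- The product of the polynomials `(x_i - lo_i) (hi_i - x_i)` for `i` in `K`. -/
def bubble (T : Cell N) (K : Finset (Fin N)) : MvPolynomial (Fin N) ℝ :=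
  ∏ i ∈ K, (MvPolynomial.X i - MvPolynomial.C (T.lo i)) *
    -(MvPolynomial.X i - MvPolynomial.C (T.hi i))

theorem eval_bubble (T : Cell N) (K : Finset (Fin N)) (x : Fin N → ℝ) :
    MvPolynomial.eval x (bubble T K) = ∏ i ∈ K, (x i - T.lo i) * (T.hi i - x i) := by
  simp [bubble, map_prod]

theorem bubble_ne_zero (T : Cell N) (K : Finset (Fin N)) : bubble T K ≠ 0 :=
  prod_ne_zero_iff.2 fun _ _ => mul_ne_zero (X_sub_C_ne_zero _ _) (neg_ne_zero.2 (X_sub_C_ne_zero _ _))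

theorem substVar_bubble (T : Cell N) {K : Finset (Fin N)} {i : Fin N} (hi : i ∉ K) (c : ℝ) :
    substVar i c (bubble T K) = bubble T K := by
  rw [bubble, map_prod]
  refine prod_congr rfl fun j hj => ?_
  have hij : j ≠ i := fun h => hi (h ▸ hj)
  rw [map_mul, map_neg, map_sub, map_sub, substVar_X_ne hij, substVar_C, substVar_C]

theorem bubble_mem_degLE (T : Cell N) (K : Finset (Fin N)) : bubble T K ∈ degLE N (2 * #K) := by
  induction K using Finset.induction_on with
  | empty =>
    have h1 : bubble T ∅ = MvPolynomial.C 1 := by simp [bubble]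
    rw [h1]
    exact C_mem_degLE (by simp) 1
  | insert i K hi ih =>
    have h1 : bubble T (insert i K) = (MvPolynomial.X i - MvPolynomial.C (T.lo i)) *
        -(MvPolynomial.X i - MvPolynomial.C (T.hi i)) * bubble T K := prod_insert hi
    rw [h1, card_insert_of_notMem hi]
    have := mul_mem_degLE (mul_mem_degLE (X_sub_C_mem_degLE i (T.lo i))
      (neg_mem (X_sub_C_mem_degLE i (T.hi i)))) ih
    refine degLE_mono (le_of_eq ?_) this
    push_cast
    ring

/-- Dividing by the factors in other variables preserves vanishing at both ends of x_i, and the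
factor x_i - lo_i takes the nonzero value hi_i - lo_i at the other end. Each division lowers the
degree bound by one. -/
theorem exists_eq_bubble_mul {T : Cell N} {s : ℤ} {p : MvPolynomial (Fin N) ℝ}
    (hp : p ∈ degLE N s) (K : Finset (Fin N)) (hK : K ⊆ T.dirs)
    (h : ∀ i ∈ K, substVar i (T.lo i) p = 0 ∧ substVar i (T.hi i) p = 0) :
    ∃ q ∈ degLE N (s - 2 * #K), p = bubble T K * q := by
  induction K using Finset.induction_on with
  | empty => exact ⟨p, by simpa using hp, by simp [bubble]⟩
  | insert i K hi ih =>
    obtain ⟨q, hq, hpq⟩ := ih ((subset_insert _ _).trans hK) fun j hj => h j (mem_insert_of_mem hj)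
    obtain ⟨h1, h2⟩ := h i (mem_insert_self i K)
    rw [hpq, map_mul, substVar_bubble T hi] at h1 h2
    have h1 := (mul_eq_zero.1 h1).resolve_left (bubble_ne_zero T K)
    have h2 := (mul_eq_zero.1 h2).resolve_left (bubble_ne_zero T K)
    obtain ⟨q1, hq1, rfl⟩ := exists_eq_X_sub_C_mul hq h1
    rw [map_mul, map_sub, substVar_X_self, substVar_C, ← map_sub] at h2
    have hlt := Cell.mem_dirs.1 (hK (mem_insert_self i K))
    have h2 := (mul_eq_zero.1 h2).resolve_left
      ((map_ne_zero_iff _ (MvPolynomial.C_injective _ _)).2 (sub_ne_zero.2 hlt.ne'))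
    obtain ⟨q2, hq2, rfl⟩ := exists_eq_X_sub_C_mul hq1 h2
    refine ⟨-q2, degLE_mono (le_of_eq ?_) (neg_mem hq2), ?_⟩
    · rw [card_insert_of_notMem hi]
      push_cast
      ring
    · rw [hpq]
      have h3 : bubble T (insert i K) = (MvPolynomial.X i - MvPolynomial.C (T.lo i)) *
        -(MvPolynomial.X i - MvPolynomial.C (T.hi i)) * bubble T K := prod_insert hi
      rw [h3]
      ring

theorem polyLp_eq_zero_of_integral_bubble {T : Cell N} {K : Finset (Fin N)} (hK : K ⊆ T.dirs)
    {q : MvPolynomial (Fin N) ℝ}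
    (h : ∫ x, MvPolynomial.eval x (bubble T K * q ^ 2) ∂T.measure = 0) : polyLp T q = 0 := by
  have hpos : ∀ x ∈ T.inside, 0 < MvPolynomial.eval x (bubble T K) := by
    intro x hx
    rw [eval_bubble]
    refine prod_pos fun i hi => ?_
    have := (hx i).1 (hK hi)
    exact mul_pos (sub_pos.2 this.1) (sub_pos.2 this.2)
  rw [integral_eq_zero_iff_of_nonneg_ae] at h
  · rw [Lp.eq_zero_iff_ae_eq_zero]
    filter_upwards [h, coeFn_polyLp T q, T.ae_inside] with x h1 h2 h3
    rw [h2]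
    simp only [map_mul, map_pow, Pi.zero_apply] at h1
    exact pow_eq_zero_iff (two_ne_zero) |>.1 ((mul_eq_zero.1 h1).resolve_left (hpos x h3).ne')
  · filter_upwards [T.ae_inside] with x hx
    simp only [map_mul, map_pow, Pi.zero_apply]
    exact mul_nonneg (hpos x hx).le (sq_nonneg _)
  · exact T.integrable_of_continuous (contDiff_eval _).continuous

/-! ### Unisolvence -/

theorem integral_mul_eq_inner {T : Cell N} (f g : Lp ℝ 2 T.measure) :
    ∫ x, f x * g x ∂T.measure = inner ℝ f g := by
  rw [L2.inner_def]
  refine integral_congr_ae (Filter.Eventually.of_forall fun x => ?_)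
  simp [mul_comm]

/-- The integrated wedge product as a bilinear map. -/
def wedgeMap (T : Cell N) (k l : ℕ) : L2Form T k →ₗ[ℝ] L2Form T l →ₗ[ℝ] ℝ :=
  LinearMap.mk₂ ℝ (fun u v => integralWedge T u v)
    (fun u u' v => by
      simp only [integralWedge, integral_mul_eq_inner, Submodule.coe_add, Pi.add_apply,
        inner_add_left, mul_add, sum_add_distrib])
    (fun c u v => by
      simp only [integralWedge, integral_mul_eq_inner, Submodule.coe_smul, Pi.smul_apply,
        real_inner_smul_left, mul_left_comm _ c, ← mul_sum, smul_eq_mul])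
    (fun u v v' => by
      simp only [integralWedge, integral_mul_eq_inner, Submodule.coe_add, Pi.add_apply,
        inner_add_right, mul_add, sum_add_distrib])
    (fun c u v => by
      simp only [integralWedge, integral_mul_eq_inner, Submodule.coe_smul, Pi.smul_apply,
        real_inner_smul_right, mul_left_comm _ c, ← mul_sum, smul_eq_mul])

theorem wedgeSign_mul_self (J K : Finset (Fin N)) : wedgeSign J K * wedgeSign J K = 1 := by
  unfold wedgeSign
  rw [← mul_pow]
  simp

/-- The coefficients of the form without traces that is dual to a polynomial form. -/
def dualCoeffs (T : Cell N) (q : Finset (Fin N) → MvPolynomial (Fin N) ℝ) (J : Finset (Fin N)) :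
    MvPolynomial (Fin N) ℝ :=
  wedgeSign J (T.dirs \ J) • (bubble T (T.dirs \ J) * q (T.dirs \ J))

theorem card_dirs_sdiff {T : Cell N} {k : ℕ} {J : Finset (Fin N)} (hJ : J ⊆ T.dirs) (hk : #J = k) :
    #(T.dirs \ J) = T.dim - k := by
  rw [card_sdiff_of_subset hJ, hk, Cell.dim]

/-- The sign in `dualCoeffs` cancels the one in the wedge product, so the pairing is a sum of
integrals of squares with weights that are positive inside the cell; each must vanish. -/
theorem integralWedge_dualCoeffs_eq_zero {T : Cell N} {k : ℕ} (hk : k ≤ T.dim)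
    {q : Finset (Fin N) → MvPolynomial (Fin N) ℝ}
    (h : integralWedge T (polyForm T k (dualCoeffs T q)) (polyForm T (T.dim - k) q) = 0) :
    polyForm T (T.dim - k) q = 0 := by
  set t : Finset (Fin N) → ℝ := fun J => wedgeSign J (T.dirs \ J) *
    ∫ x, (polyForm T k (dualCoeffs T q)).1 J x *
      (polyForm T (T.dim - k) q).1 (T.dirs \ J) x ∂T.measure with ht
  have ht1 : ∀ J ⊆ T.dirs, #J = k → t J =
      ∫ x, MvPolynomial.eval x (bubble T (T.dirs \ J) * q (T.dirs \ J) ^ 2) ∂T.measure := by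
    intro J hJ hJk
    simp only [ht]
    rw [polyForm_apply _ hJ hJk, polyForm_apply _ sdiff_subset (card_dirs_sdiff hJ hJk),
      ← integral_const_mul]
    refine integral_congr_ae ?_
    filter_upwards [coeFn_polyLp T (dualCoeffs T q J), coeFn_polyLp T (q (T.dirs \ J))] with x h1 h2
    rw [h1, h2, dualCoeffs]
    simp only [MvPolynomial.smul_eval, map_mul, map_pow]
    linear_combination (MvPolynomial.eval x (bubble T (T.dirs \ J)) *
      MvPolynomial.eval x (q (T.dirs \ J)) ^ 2) * wedgeSign_mul_self J (T.dirs \ J)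
  have ht2 : ∀ J, #J ≠ k → t J = 0 := by
    intro J hJk
    simp only [ht]
    rw [polyForm_apply_of_card_ne _ hJk, integral_mul_eq_inner, inner_zero_left, mul_zero]
  have ht3 : ∀ J ∈ T.dirs.powerset, 0 ≤ t J := by
    intro J hJ
    rw [mem_powerset] at hJ
    by_cases hJk : #J = k
    · rw [ht1 J hJ hJk]
      refine integral_nonneg_of_ae ?_
      filter_upwards [T.ae_box] with x hx
      simp only [map_mul, map_pow, Pi.zero_apply, eval_bubble]
      exact mul_nonneg (prod_nonneg fun i _ =>
        mul_nonneg (sub_nonneg.2 (hx.1 i)) (sub_nonneg.2 (hx.2 i))) (sq_nonneg _)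
    · exact (ht2 J hJk).ge
  have ht4 := (sum_eq_zero_iff_of_nonneg ht3).1 h
  refine L2Form.ext fun K hK hKk => ?_
  have hc : #(T.dirs \ K) = k := by
    rw [card_dirs_sdiff hK hKk]
    omega
  have h5 := ht4 (T.dirs \ K) (mem_powerset.2 sdiff_subset)
  rw [ht1 _ sdiff_subset hc, Finset.sdiff_sdiff_eq_self hK] at h5
  rw [polyForm_apply _ hK hKk]
  exact polyLp_eq_zero_of_integral_bubble hK h5

theorem dualCoeffs_mem_polyZero {T : Cell N} {k : ℕ} {s : ℤ} (hk : k ≤ T.dim)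
    {q : Finset (Fin N) → MvPolynomial (Fin N) ℝ}
    (hq : ∀ K, q K ∈ degLE N (s + 2 * k - 2 * T.dim)) :
    polyForm T k (dualCoeffs T q) ∈ polyZero T s k := by
  have htr : IsTraceFree T (polyForm T k (dualCoeffs T q)) := by
    refine (isD_polyForm T k _).isTraceFamily.isTraceFree fun i hi b => ?_
    refine L2Form.ext fun J hJ hJk => ?_
    rw [polyForm_apply _ hJ hJk]
    refine polyLp_eq_zero_iff.2 fun x hx => ?_
    rw [Cell.facet_dirs] at hJ
    have h3 := Cell.eq_lo_of_mem_box hx (j := i) (by simp [Cell.facet_dirs])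
    rw [Cell.facet_lo_self] at h3
    have h4 : i ∈ T.dirs \ J := mem_sdiff.2 ⟨hi, fun h => notMem_erase i _ (hJ h)⟩
    have h5 : MvPolynomial.eval x (bubble T (T.dirs \ J)) = 0 := by
      rw [eval_bubble]
      refine prod_eq_zero h4 ?_
      rw [h3]
      cases b <;> simp
    rw [dualCoeffs, MvPolynomial.smul_eval, map_mul, h5]
    simp
  refine ⟨fun J => ?_, htr⟩
  by_cases hJ : J ⊆ T.dirs ∧ #J = k
  · rw [polyForm_apply _ hJ.1 hJ.2]
    refine ⟨dualCoeffs T q J, ?_, coeFn_polyLp T _⟩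
    -- With m = dim T, the weight has degree 2(m - k), which is what the bound s + 2k - 2m leaves up
    -- to s.
    refine Submodule.smul_mem (degLE N s) _ (degLE_mono (le_of_eq ?_)
      (mul_mem_degLE (bubble_mem_degLE T _) (hq _)))
    rw [card_dirs_sdiff hJ.1 hJ.2]
    push_cast [hk]
    ring
  · rw [(polyForm T k (dualCoeffs T q)).2 J hJ]
    refine ⟨0, by simp, ?_⟩
    filter_upwards [Lp.coeFn_zero ℝ 2 T.measure] with x hx
    simpa using hx

/-- A polynomial form without traces is dual to a polynomial form. -/
theorem exists_dualCoeffs {T : Cell N} {k : ℕ} {s : ℤ} {u : L2Form T k}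
    (hu : u ∈ polyZero T s k) :
    ∃ q, (∀ K, q K ∈ degLE N (s + 2 * k - 2 * T.dim)) ∧ polyForm T k (dualCoeffs T q) = u := by
  obtain ⟨p, hp, rfl⟩ := exists_zeroCoeffs hu
  have hex : ∀ K, ∃ q ∈ degLE N (s + 2 * k - 2 * T.dim), #(T.dirs \ K) = k → K ⊆ T.dirs →
      p (T.dirs \ K) = bubble T K * q := by
    intro K
    by_cases hK : #(T.dirs \ K) = k ∧ K ⊆ T.dirs
    · obtain ⟨q, hq, hpq⟩ := exists_eq_bubble_mul (hp.deg (T.dirs \ K)) K hK.2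
        fun i hi => hp.vanish _ i (hK.2 hi) fun h => (mem_sdiff.1 h).2 hi
      refine ⟨q, degLE_mono (le_of_eq ?_) hq, fun _ _ => hpq⟩
      have h1 := card_dirs_sdiff hK.2 rfl
      have h2 := card_le_card hK.2
      rw [hK.1] at h1
      unfold Cell.dim at *
      omega
    · exact ⟨0, zero_mem _, fun h1 h2 => absurd ⟨h1, h2⟩ hK⟩
  choose q hq hpq using hex
  refine ⟨fun K => wedgeSign (T.dirs \ K) K • q K, fun K => Submodule.smul_mem _ _ (hq K), ?_⟩
  refine L2Form.ext fun J hJ hJk => ?_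
  rw [polyForm_apply _ hJ hJk, polyForm_apply _ hJ hJk]
  congr 1
  have h1 := hpq (T.dirs \ J) (by rwa [Finset.sdiff_sdiff_eq_self hJ]) sdiff_subset
  rw [Finset.sdiff_sdiff_eq_self hJ] at h1
  rw [dualCoeffs, Finset.sdiff_sdiff_eq_self hJ, mul_smul_comm, smul_smul, wedgeSign_mul_self, one_smul, h1]

/-- Both injections into duals force equal dimensions, so an injective map is onto. -/
theorem exists_eq_of_nondegenerate {V W : Type*} [AddCommGroup V] [Module ℝ V]
    [FiniteDimensional ℝ V] [AddCommGroup W] [Module ℝ W] [FiniteDimensional ℝ W]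
    (f : V →ₗ[ℝ] W →ₗ[ℝ] ℝ) (hl : ∀ v, f v = 0 → v = 0)
    (hr : ∀ w, (∀ v, f v w = 0) → w = 0) (ℓ : W →ₗ[ℝ] ℝ) : ∃ v, f v = ℓ := by
  have hinj : Function.Injective f := (injective_iff_map_eq_zero f).2 hl
  have hinj' : Function.Injective f.flip := (injective_iff_map_eq_zero f.flip).2
    fun w hw => hr w fun v => LinearMap.congr_fun hw v
  have h1 : Module.finrank ℝ V ≤ Module.finrank ℝ (Module.Dual ℝ W) :=
    LinearMap.finrank_le_finrank_of_injective hinj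
  have h2 : Module.finrank ℝ W ≤ Module.finrank ℝ (Module.Dual ℝ V) :=
    LinearMap.finrank_le_finrank_of_injective hinj'
  rw [Subspace.dual_finrank_eq] at h1 h2
  exact (LinearMap.injective_iff_surjective_of_finrank_eq_finrank
    (V₂ := Module.Dual ℝ W)
    ((le_antisymm h1 h2).trans Subspace.dual_finrank_eq.symm)).1 hinj ℓ

namespace FES

variable {C : CubicalComplex N} {A : FES C} {T : Cell N} {k r : ℕ}

/-- The degrees of freedom on a cell. -/
def cellDofs (r : ℕ) (T : Cell N) (k : ℕ) :
    L2Form T k →ₗ[ℝ] Module.Dual ℝ (polyForms T ((r : ℤ) + k - 2 * T.dim) (T.dim - k)) :=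
  if k ≤ T.dim then
    (Submodule.dualRestrict (polyForms T ((r : ℤ) + k - 2 * T.dim) (T.dim - k))) ∘ₗ
      wedgeMap T k (T.dim - k)
  else 0

theorem cellDofs_apply (hk : k ≤ T.dim) (u : L2Form T k)
    (v : polyForms T ((r : ℤ) + k - 2 * T.dim) (T.dim - k)) :
    cellDofs r T k u v = integralWedge T u v.1 := by
  rw [cellDofs, if_pos hk]
  rfl

theorem eq_zero_of_cellDofs {u : L2Form T k} (hu : u ∈ polyZero T ((r : ℤ) - k) k)
    (h : cellDofs r T k u = 0) : u = 0 := by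
  by_cases hk : k ≤ T.dim
  · obtain ⟨q, hq, rfl⟩ := exists_dualCoeffs hu
    have hq' : ∀ K, q K ∈ degLE N ((r : ℤ) + k - 2 * T.dim) := fun K => by
      have := hq K
      rwa [show (r : ℤ) - k + 2 * k - 2 * T.dim = r + k - 2 * T.dim by ring] at this
    have h1 := LinearMap.congr_fun h ⟨polyForm T (T.dim - k) q, mem_polyForms_iff.2 ⟨q, hq', rfl⟩⟩
    rw [cellDofs_apply hk] at h1
    have h2 := integralWedge_dualCoeffs_eq_zero hk h1
    refine L2Form.ext fun J hJ hJk => ?_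
    have h3 := congrArg (fun w : L2Form T (T.dim - k) => w.1 (T.dirs \ J)) h2
    rw [polyForm_apply _ sdiff_subset (card_dirs_sdiff hJ hJk)] at h3
    have h4 := polyLp_eq_zero_iff.1 h3
    rw [polyForm_apply _ hJ hJk]
    refine polyLp_eq_zero_iff.2 fun x hx => ?_
    rw [dualCoeffs, MvPolynomial.smul_eval, map_mul, h4 x hx, mul_zero, mul_zero]
  · exact L2Form.eq_zero_of_dim_lt (not_le.1 hk) u

/-- The map q ↦ `dualCoeffs T q` pairs positively with q, so the pairing is nondegenerate on both
sides. -/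
theorem exists_polyZero_cellDofs (hk : k ≤ T.dim)
    [FiniteDimensional ℝ (polyZero T ((r : ℤ) - k) k)]
    [FiniteDimensional ℝ (polyForms T ((r : ℤ) + k - 2 * T.dim) (T.dim - k))]
    (ℓ : polyForms T ((r : ℤ) + k - 2 * T.dim) (T.dim - k) →ₗ[ℝ] ℝ) :
    ∃ u ∈ polyZero T ((r : ℤ) - k) k, cellDofs r T k u = ℓ := by
  set f : polyZero T ((r : ℤ) - k) k →ₗ[ℝ]
    polyForms T ((r : ℤ) + k - 2 * T.dim) (T.dim - k) →ₗ[ℝ] ℝ :=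
    cellDofs r T k ∘ₗ (polyZero T ((r : ℤ) - k) k).subtype with hf
  have hl : ∀ u, f u = 0 → u = 0 := fun u hu =>
    Subtype.ext (eq_zero_of_cellDofs (r := r) (T := T) (k := k) u.2 hu)
  have hr : ∀ v, (∀ u, f u v = 0) → v = 0 := by
    rintro ⟨v, hv⟩ h
    obtain ⟨q, hq, rfl⟩ := mem_polyForms_iff.1 hv
    have hq' : ∀ K, q K ∈ degLE N ((r : ℤ) - k + 2 * k - 2 * T.dim) := fun K => by
      have := hq K
      rwa [show (r : ℤ) + k - 2 * T.dim = r - k + 2 * k - 2 * T.dim by ring] at this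
    have h1 := h ⟨_, dualCoeffs_mem_polyZero hk hq'⟩
    rw [hf, LinearMap.comp_apply, cellDofs_apply hk] at h1
    exact Subtype.ext (integralWedge_dualCoeffs_eq_zero hk h1)
  obtain ⟨u, hu⟩ := exists_eq_of_nondegenerate
    (V := polyZero T ((r : ℤ) - k) k)
    (W := polyForms T ((r : ℤ) + k - 2 * T.dim) (T.dim - k)) f hl hr ℓ
  exact ⟨u, u.2, hu⟩

/-- The pairing is bijective on each A^k_0(F); `exists_of_dofs` and `eq_zero_of_dofs` carry this
over to A^k(T). Faces of dimension less than k get the zero functional, as they carry no k-forms. -/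
theorem unisolvent_of_zeroSubmodule_eq (hA : A.AdmitsExtensions) (hP : A.ContainsPoly r)
    (h : ∀ T ∈ C.cells, ∀ k : ℕ, A.zeroSubmodule T k = polyZero T ((r : ℤ) - k) k) :
    A.Unisolvent r := by
  intro T hT k ℓ
  have hinj : ∀ F ∈ C.cells, ∀ u ∈ A.zeroSubmodule F k, cellDofs r F k u = 0 → u = 0 :=
    fun F hF u hu h0 => eq_zero_of_cellDofs (h F hF k ▸ hu) h0
  obtain ⟨U, hU, hUT, hUd⟩ := exists_of_dofs hA (fun F => cellDofs r F k)
    (fun F => if k ≤ F.dim then ℓ F else 0) hinj (fun F hF u => by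
      by_cases hk : k ≤ F.dim
      · have := A.finiteDimensional F hF k
        have := A.finiteDimensional F hF (F.dim - k)
        have h1 : FiniteDimensional ℝ (polyZero F ((r : ℤ) - k) k) :=
          Submodule.finiteDimensional_of_le
            ((polyZero_le_zeroSubmodule hF hP).trans fun _ hu => hu.1)
        have h2 : FiniteDimensional ℝ (polyForms F ((r : ℤ) + k - 2 * F.dim) (F.dim - k)) := by
          -- With m = dim F, finite dimension is inherited from A^{m-k}(F): the bound r + k - 2m is
          -- at most r - (m - k).
          refine Submodule.finiteDimensional_of_le
            ((polyForms_mono F ?_ _).trans (hP F hF (F.dim - k)))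
          push_cast [hk]
          have : (k : ℤ) ≤ F.dim := by exact_mod_cast hk
          linarith
        obtain ⟨a, ha, hae⟩ := exists_polyZero_cellDofs (r := r) (T := F) (k := k) hk (ℓ F - cellDofs r F k u)
        rw [h F hF k, if_pos hk]
        exact ⟨a, ha, hae⟩
      · refine ⟨0, zero_mem _, ?_⟩
        rw [cellDofs, if_neg hk, if_neg hk]
        simp) hT
  refine ⟨U T, ⟨hUT, U, hU, rfl, fun F hF hk v => ?_⟩, ?_⟩
  · rw [← cellDofs_apply hk, hUd F hF, if_pos hk]
  · rintro _ ⟨hVT, V, hV, rfl, hVd⟩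
    rw [← sub_eq_zero]
    refine eq_zero_of_dofs (fun F => cellDofs r F k) hinj hT (hV.sub hU) (sub_mem hVT hUT)
      fun F hF => ?_
    rw [Pi.sub_apply, map_sub, hUd F hF, sub_eq_zero]
    by_cases hk : k ≤ F.dim
    · rw [if_pos hk]
      refine LinearMap.ext fun v => ?_
      rw [cellDofs_apply hk]
      exact hVd F hF hk v
    · rw [if_neg hk, cellDofs, if_neg hk]
      rfl

end FES

end CubeFES

end

theorem mainTheorem5 {N : ℕ} (n r : ℕ) (hr : n ≤ r) (C : CubeFES.CubicalComplex N)
    (hC : ∀ T ∈ C.cells, T.dim ≤ n) (A : CubeFES.FES C) (hA : A.Compatible)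
    (hP : A.ContainsPoly r) :
    (A.IsMinimal r ↔
      ∀ T ∈ C.cells, ∀ k : ℕ,
        A.zeroSpace T k =
          {u | u ∈ CubeFES.polyForms T ((r : ℤ) - k) k ∧ CubeFES.IsTraceFree T u}) ∧
    (A.IsMinimal r → A.Unisolvent r) := by
  have hd : ∀ T ∈ C.cells, T.dim ≤ r := fun T hT => (hC T hT).trans hr
  refine ⟨⟨fun h T hT k => ?_, fun h => ?_⟩, fun h => ?_⟩
  · exact congrArg SetLike.coe (CubeFES.FES.zeroSubmodule_eq_of_isMinimal (k := k) hd h hT)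
  · exact CubeFES.FES.isMinimal_of_zeroSubmodule_eq hA hP fun T hT k =>
      SetLike.coe_injective (h T hT k)
  · exact CubeFES.FES.unisolvent_of_zeroSubmodule_eq hA.1 hP fun T hT k =>
      CubeFES.FES.zeroSubmodule_eq_of_isMinimal hd h hT
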